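/- Throughout, $n$, $p$, $q$ are powers of two and $\log x=\max\{1,\log_2 x\}$. **Machine and cost.** A static DAG algorithm (without recomputation) on $M(q)$ runs on processing elements $0,\dots,q-1$ in a sequence of supersteps with labels in $[0,\log q)$, fixed by the input size. Every DAG node is evaluated exactly once, by one processing element that knows the values of all predecessors (nodes of indegree 0 are inputs, each held initially by one processing element); every message carries one value known to its sender, or is a dummy, and is available to the receiver from the next superstep on; in an $i$-superstep messages are exchanged only between processing elements whose indices share the $i$ most significant bits. In the folding on $p\le q$ processors, processor $j$ carries out the work of the $q/p$ consecutive processing elements starting with $jq/p$. The degree $h^s(n,p)$ of a superstep $s$ is the maximum number of messages that a processor sends to, or receives from, other processors in it. With $L^i$ the set of $i$-supersteps, $S^i=|L^i|$ and $F^i(n,p)=\sum_{s\in L^i}h^s(n,p)$, the communication complexity on $M(p,\sigma)$ is $H(n,p,\sigma)=\sum_{i=0}^{\log p-1}(F^i(n,p)+S^i\sigma)$. The algorithm is $(\alpha,p)$-wise if $\sum_{i<j}F^i(n,2^j)\ge\alpha\frac{p}{2^j}\sum_{i<j}F^i(n,p)$ for all $1\le j\le\log p$ and all $n$. **Problem and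 class.** The $(n,2)$-stencil DAG has the nodes $\langle i_0,i_1,i_2\rangle\in\{0,\dots,n-1\}^3$ and the arcs from $\langle i_0,i_1,i_2\rangle$ to $\langle i_0+\delta_0,i_1+\delta_1,i_2+1\rangle$, $\delta_0,\delta_1\in\{0,\pm1\}$, as far as these nodes exist. For $0<\varepsilon<1$, $\mathscr C_2$ is the class of static algorithms for this problem, without recomputation, such that no processing element evaluates more than $\varepsilon n^3$ nodes, and such that the same holds for all foldings on $q'\ge2$ processors. For $0<\beta\le 1$, an algorithm of $\mathscr C_2$ is $\beta$-optimal on $M(p,\sigma)$ with respect to $\mathscr C_2$ if $H(n,p,\sigma)\le\frac1\beta H'(n,p,\sigma)$ for the complexity $H'$ of every $M(p,\sigma)$-algorithm in $\mathscr C_2$. **Algorithm**, on $M(n^2)$ with virtual processors (VPs) $0,\dots,n^2-1$. Let $k=2^{\lceil\sqrt{\log n}\rceil}$ and $D=\lceil\log_k n\rceil$; let $s_i=n/k^i$ for $0\le i<D$ and $s_D=1$. A polyhedron of level $i$ is the set of nodes with prescribed integers $A,B,C,E$, $|A+B-C-E|\le1$, where $A,B,C,E$ are the integer parts of $(i_2+i_0+w)/s_i$,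 $(i_2-i_0+w)/s_i$, $(i_2+i_1+w)/s_i$, $(i_2-i_1+w)/s_i$ with $w=\lfloor 3n/2\rfloor$. It is a (half-open, possibly truncated) octahedron if $A+B=C+E$, and a tetrahedron otherwise. Seventeen polyhedra of level 0 cover the array, namely those with $(A,B),(C,E)\in\{(1,1),(2,0),(2,1),(2,2),(3,1)\}$; polyhedra of level $i$ are partitioned into polyhedra of level $i+1$, and those of them with equal $A+B+C+E$ form a stripe; with $\kappa_i=s_i/s_{i+1}$ these are at most $4\kappa_i-3$ stripes. The inputs (time $i_2=0$) are initially distributed one per VP (VP $i_0+n\,i_1$). In 17 stages, the polyhedra of level 0 are evaluated by increasing $A+B+C+E$ (ties: lexicographically), each stage starting with a 0-superstep that distributes the inputs of its polyhedron. A polyhedron of level $i<D$ is evaluated in $4\kappa_i-3$ phases, one per stripe: the polyhedra of level $i+1$ in the stripe are evaluated recursively and in parallel by disjoint consecutive segments of VPs ($s_{i+1}^2$ VPs for an octahedron, $s_{i+1}^2/2$ for a tetrahedron), allotted in lexicographic order of $(A,B,C,E)$ within the segment of the parent. Each phase starts with a superstep of label $2\log_2(n/s_i)$ ($=2i\log_2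 k$) in which these polyhedra receive their inputs (the values evaluated outside that they need), and in which the outputs (values needed outside) of the polyhedra of the preceding phase that are outputs of the parent are sent to the parent's segment; one more such superstep after the last phase only collects outputs. Inputs and outputs of a polyhedron are distributed evenly over its segment (cyclically, in lexicographic order of $(i_2,i_1,i_0)$). A polyhedron of level $D$ has at most one node, which its VP evaluates. In every $l$-superstep each VP also sends one dummy message to the VP whose index differs from its own in exactly the $(l+1)$-st most significant bit. **Theorem.** For every $n$ this algorithm evaluates the $(n,2)$-stencil DAG on $M(n^2)$. 1. For every $C\ge 0$ there is $K>0$ such that for all $n$, all $1<p\le n^2$ and all $0\le\sigma\le C\,n^2/p$ its communication complexity satisfies $$H(n,p,\sigma)\le K\,\frac{n^2}{\sqrt p}\,8^{\sqrt{\log n}} .$$ 2. There is a constant $\alpha\in(0,1]$ such that the algorithm is $(\alpha,n^2)$-wise (for all $n\ge2$). 3. There is $\varepsilon_0\in(0,1)$ such that for every constant $\varepsilon\in[\varepsilon_0,1)$ in the definition of $\mathscr C_2$ and every $C\ge0$ there is $c>0$ such that for all $n$, all $1<p\le n^2$ and all $0\le\sigma\le C\,n^2/p$ the algorithm is $\bigl(c/8^{\sqrt{\log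 n}}\bigr)$-optimal on $M(p,\sigma)$ with respect to $\mathscr C_2$. -/

import Mathlib

/-! ### Static DAG algorithms on the machine `M(q)` and their communication cost -/

namespace NetObl

/-- `log x = max {1, log₂ x}` on natural numbers (used on powers of two, where it is exact). -/
def lg (x : ℕ) : ℕ := max 1 (Nat.log 2 x)

/-- `log x = max {1, log₂ x}` on real numbers. -/
noncomputable def rlog (x : ℝ) : ℝ := max 1 (Real.logb 2 x)

def IsPowTwo (x : ℕ) : Prop := ∃ a : ℕ, x = 2 ^ a

/-- A constant-size message from `src` to `dst`. It carries the value of one DAG node, or nothing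
(`val = none`, a dummy message). -/
structure Msg (V : Type) where
  src : ℕ
  dst : ℕ
  val : Option V
deriving DecidableEq

/-- The data of a static DAG algorithm without recomputation on the `q` processing elements
`0, …, q - 1`: a sequence of `len` supersteps, the label of each superstep, the messages
sent in each superstep, and for every DAG node the unique processing element that evaluates it
(for a node of indegree 0: that initially holds this input) together with the superstep in which
that happens. All this depends on the input size only, not on the input values. -/
structure StaticAlg (V : Type) (q : ℕ) where
  len : ℕ
  label : ℕ → ℕ
  msgs : ℕ → Multiset (Msg V)
  owner : V → ℕ
  time : V → ℕ

namespace StaticAlg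

variable {V : Type} {q : ℕ}

/-- In superstep `s` the processing element `r` knows the value of the node `w`: it evaluates `w`
itself in superstep `s` or before, or it received the value in an earlier superstep. -/
def Knows (A : StaticAlg V q) (r s : ℕ) (w : V) : Prop :=
  (A.owner w = r ∧ A.time w ≤ s) ∨
    ∃ s' < s, ∃ m ∈ A.msgs s', m.dst = r ∧ m.val = some w

/-- `A` is a legal algorithm on `M(q)` that evaluates the DAG with node set `nodes` and arcs `arc`:
labels are in range; an `i`-superstep only exchanges messages between processing elements whose
indices share the `i` most significant bits; every node is evaluated, with all its operands
known to the processing element that evaluates it; and only known values are sent. -/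
structure Evaluates (A : StaticAlg V q) (nodes : Finset V) (arc : V → V → Prop) : Prop where
  label_lt : ∀ s < A.len, A.label s < lg q
  range : ∀ s < A.len, ∀ m ∈ A.msgs s, m.src < q ∧ m.dst < q
  cluster : ∀ s < A.len, ∀ m ∈ A.msgs s,
    m.src / (q / 2 ^ A.label s) = m.dst / (q / 2 ^ A.label s)
  owner_lt : ∀ u ∈ nodes, A.owner u < q
  time_lt : ∀ u ∈ nodes, A.time u < A.len
  operands : ∀ u ∈ nodes, ∀ w ∈ nodes, arc w u → A.Knows (A.owner u) (A.time u) w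
  sends : ∀ s < A.len, ∀ m ∈ A.msgs s, ∀ w, m.val = some w → w ∈ nodes ∧ A.Knows m.src s w

/-- The processor of the folding on `p` processors that carries out the work of the processing
element `r` (for powers of two `p ≤ q`). -/
def block (q p r : ℕ) : ℕ := r / (q / p)

/-- Number of messages sent by processor `j` in superstep `s` of the folding on `p` processors. -/
def sent (A : StaticAlg V q) (p s j : ℕ) : ℕ :=
  ((A.msgs s).filter fun m => block q p m.src = j ∧ block q p m.dst ≠ j).card

/-- Number of messages received by processor `j` in superstep `s` of the folding. -/
def received (A : StaticAlg V q) (p s j : ℕ) : ℕ :=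
  ((A.msgs s).filter fun m => block q p m.dst = j ∧ block q p m.src ≠ j).card

/-- The degree `h^s(n, p)` of superstep `s` in the folding on `p` processors. -/
def degree (A : StaticAlg V q) (p s : ℕ) : ℕ :=
  (Finset.range p).sup fun j => max (A.sent p s j) (A.received p s j)

/-- The set `L^i(n)` of `i`-supersteps. -/
def steps (A : StaticAlg V q) (i : ℕ) : Finset ℕ :=
  (Finset.range A.len).filter fun s => A.label s = i

/-- The cumulative degree `F^i(n, p)`. -/
def F (A : StaticAlg V q) (i p : ℕ) : ℕ := ∑ s ∈ A.steps i, A.degree p s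

/-- The communication complexity `H(n, p, σ)` of the folding on the evaluation model
`M(p, σ)`. -/
def H (A : StaticAlg V q) (p : ℕ) (σ : ℝ) : ℝ :=
  ∑ i ∈ Finset.range (lg p), ((A.F i p : ℝ) + ((A.steps i).card : ℝ) * σ)

/-- `(α, p)`-wiseness, for one input size. -/
def IsWise (A : StaticAlg V q) (α : ℝ) (p : ℕ) : Prop :=
  ∀ j : ℕ, 1 ≤ j → j ≤ lg p →
    α * ((p : ℝ) / 2 ^ j) * ∑ i ∈ Finset.range j, (A.F i p : ℝ) ≤
      ∑ i ∈ Finset.range j, (A.F i (2 ^ j) : ℝ)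

/-- Number of nodes that processor `j` evaluates in the folding on `p` processors. -/
def load (A : StaticAlg V q) (nodes : Finset V) (p j : ℕ) : ℕ :=
  (nodes.filter fun u => block q p (A.owner u) = j).card

end StaticAlg

/-! ### The `(n,2)`-stencil problem and the class `𝒞₂` -/

/-- A node `⟨i₀, i₁, i₂⟩`; `i₀, i₁` are the space coordinates and `i₂` is the time. -/
abbrev Node := ℕ × ℕ × ℕ

def stencilNodes (n : ℕ) : Finset Node :=
  Finset.range n ×ˢ Finset.range n ×ˢ Finset.range n

/-- There is an arc from `u` to `⟨u₀ + δ₀, u₁ + δ₁, u₂ + 1⟩` for all `δ₀, δ₁ ∈ {0, ±1}`. -/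
def Arc (u v : Node) : Prop :=
  v.2.2 = u.2.2 + 1 ∧ (v.1 ≤ u.1 + 1 ∧ u.1 ≤ v.1 + 1) ∧ (v.2.1 ≤ u.2.1 + 1 ∧ u.2.1 ≤ v.2.1 + 1)

instance (u v : Node) : Decidable (Arc u v) := by unfold Arc; infer_instance

/-- The class `𝒞₂` for `q` processing elements, balance constant `ε` and instance size `n`: static
algorithms for the `(n,2)`-stencil without recomputation (built into `StaticAlg`) such that neither
in the algorithm itself nor in any of its foldings a processing element evaluates more than
`ε n³` nodes. -/
def InClass (ε : ℝ) (n : ℕ) {q : ℕ} (A : StaticAlg Node q) : Prop :=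
  A.Evaluates (stencilNodes n) Arc ∧
    ∀ p : ℕ, IsPowTwo p → 2 ≤ p → p ≤ q → ∀ j < p,
      (A.load (stencilNodes n) p j : ℝ) ≤ ε * (n : ℝ) ^ 3

/-- `A` (folded on `p` processors) is `β`-optimal on `M(p, σ)` with respect to `𝒞₂`, for instance
size `n`. -/
def IsOptimalOn (β ε : ℝ) (n p : ℕ) (σ : ℝ) {q : ℕ} (A : StaticAlg Node q) : Prop :=
  (0 < β ∧ β ≤ 1) ∧ InClass ε n A ∧
    ∀ B : StaticAlg Node p, InClass ε n B → A.H p σ ≤ 1 / β * B.H p σ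

/-! ### The octahedron/tetrahedron algorithm on `M(n²)`

Everything is defined for an arbitrary branching factor `k`; the algorithm uses
`k = 2 ^ ⌈√(log n)⌉`. Polyhedra of level `i` have side `n / k ^ i`; on the last level they have
side 1 and contain at most one node.

The polyhedra of side `s` are the sets of nodes on which the four functions `i₂ + i₀`, `i₂ - i₀`,
`i₂ + i₁`, `i₂ - i₁` (shifted by a constant) have prescribed quotients `A, B, C, D` modulo `s`.
Since `(i₂ + i₀) + (i₂ - i₀) = (i₂ + i₁) + (i₂ - i₁)`, such a set can only be inhabited if
`A + B` and `C + D` differ by at most one: it is a (half-open) octahedron of axis `i₂` and width `s`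
if `A + B = C + D`, and a tetrahedron otherwise. The horizontal stripe of a polyhedron is determined
by `A + B + C + D`. -/

namespace OctTet

/-- The quadruple `(A, B, C, D)` of a polyhedron. -/
abbrev Cell := ℕ × ℕ × ℕ × ℕ

def cellSum (c : Cell) : ℕ := c.1 + c.2.1 + c.2.2.1 + c.2.2.2

def IsOct (c : Cell) : Prop := c.1 + c.2.1 = c.2.2.1 + c.2.2.2

def IsPoly (c : Cell) : Prop :=
  c.1 + c.2.1 ≤ c.2.2.1 + c.2.2.2 + 1 ∧ c.2.2.1 + c.2.2.2 ≤ c.1 + c.2.1 + 1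

instance (c : Cell) : Decidable (IsOct c) := by unfold IsOct; infer_instance
instance (c : Cell) : Decidable (IsPoly c) := by unfold IsPoly; infer_instance

/-- Number of elements of `X` that precede `a` in the order given by the key `f`. -/
def rank {α : Type} (f : α → ℕ) (X : Finset α) (a : α) : ℕ := (X.filter fun b => f b < f a).card

variable (n k : ℕ)

/-- Side of the polyhedra of level `i`. -/
def side (i : ℕ) : ℕ := max 1 (n / k ^ i)

/-- Each side of a polyhedron of level `i` is divided into `fan i` parts
(`k` parts, or `n / k ^ τ < k` parts on the last level of the recursion). -/
def fan (i : ℕ) : ℕ := side n k i / side n k (i + 1)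

/-- Number of the level whose polyhedra have side 1. -/
def depth : ℕ := Nat.clog k n

/-- The polyhedron of level `i` that contains `u`. With the shift `3 n / 2` the octahedron of level
0 with quadruple `(2, 1, 2, 1)` is inscribed in the array. -/
def cell (i : ℕ) (u : Node) : Cell :=
  ((3 * n / 2 + u.2.2 + u.1) / side n k i, (3 * n / 2 + u.2.2 - u.1) / side n k i,
    (3 * n / 2 + u.2.2 + u.2.1) / side n k i, (3 * n / 2 + u.2.2 - u.2.1) / side n k i)

/-- The 17 polyhedra of level 0 that cover the array, in the order of their evaluation. -/
def stages : List Cell :=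
  let L : List (ℕ × ℕ) := [(1, 1), (2, 0), (2, 1), (2, 2), (3, 1)]
  (List.range 9).flatMap fun S => L.flatMap fun p =>
    (L.map fun q => ((p.1, p.2, q.1, q.2) : Cell)).filter fun c => IsPoly c ∧ cellSum c = S

/-- Index of the stripe, within its parent polyhedron of level `i`, of the polyhedron of level
`i + 1` that contains `u`; it lies between `0` and `4 * fan i - 4`. -/
def stripe (i : ℕ) (u : Node) : ℕ :=
  cellSum (cell n k (i + 1) u) - fan n k i * cellSum (cell n k i u)

/-- Stripe indices of the polyhedra of levels `1, …, i` that contain `u`. -/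
def path (i : ℕ) (u : Node) : List ℕ := (List.range i).map fun j => stripe n k j u

/-- The polyhedra of level `i + 1` in the same parent and the same stripe as the one containing
`u`. -/
def siblings (i : ℕ) (u : Node) : Finset Cell :=
  let κ := fan n k i
  let c := cell n k i u
  let I : ℕ → Finset ℕ := fun a => Finset.Ico (κ * a) (κ * a + κ)
  (I c.1 ×ˢ I c.2.1 ×ˢ I c.2.2.1 ×ˢ I c.2.2.2).filter fun c' =>
    IsPoly c' ∧ cellSum c' = cellSum (cell n k (i + 1) u)

/-- Key for the lexicographic order of polyhedra (all entries are less than `4 * n`). -/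
def cellKey (c : Cell) : ℕ :=
  ((c.1 * (4 * n) + c.2.1) * (4 * n) + c.2.2.1) * (4 * n) + c.2.2.2

/-- Key for the enumeration of the nodes by increasing time, row and column. -/
def nodeKey (u : Node) : ℕ := (u.2.2 * n + u.2.1) * n + u.1

/-- Number of consecutive VPs that evaluate the polyhedron `c` of level `i`: an octahedron of side
`s` is evaluated by `s²` VPs, a tetrahedron by half as many. -/
def segSize (i : ℕ) (c : Cell) : ℕ := if IsOct c then side n k i ^ 2 else side n k i ^ 2 / 2

/-- First VP of the segment that evaluates the polyhedron of level `i` containing `u`: the polyhedra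
of one stripe get consecutive disjoint segments within the segment of their parent. -/
def base : ℕ → Node → ℕ
  | 0, _ => 0
  | i + 1, u => base i u +
      rank (cellKey n) (siblings n k i u) (cell n k (i + 1) u) *
        segSize n k (i + 1) (cell n k (i + 1) u)

/-- `u` is evaluated within the polyhedron `c` of level `i` (the inputs, of time 0, are given). -/
def InBody (i : ℕ) (c : Cell) (u : Node) : Prop := 1 ≤ u.2.2 ∧ cell n k i u = c

instance (i : ℕ) (c : Cell) (u : Node) : Decidable (InBody n k i c u) := by
  unfold InBody; infer_instance

/-- Nodes whose values are needed for the evaluation of the polyhedron `c`, but not evaluated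
within `c`. -/
def inputs (i : ℕ) (c : Cell) : Finset Node :=
  (stencilNodes n).filter fun u =>
    ¬ InBody n k i c u ∧ ∃ v ∈ stencilNodes n, Arc u v ∧ cell n k i v = c

/-- Nodes evaluated within the polyhedron `c` whose values are needed outside. -/
def outputs (i : ℕ) (c : Cell) : Finset Node :=
  (stencilNodes n).filter fun u =>
    InBody n k i c u ∧ ∃ v ∈ stencilNodes n, Arc u v ∧ cell n k i v ≠ c

/-- The VP that holds the input `u` of the polyhedron of level `i` containing `v`: the inputs of a
polyhedron are evenly distributed over its segment. -/
def inHolder (i : ℕ) (v u : Node) : ℕ :=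
  base n k i v +
    rank (nodeKey n) (inputs n k i (cell n k i v)) u % segSize n k i (cell n k i v)

/-- The VP that holds `u` as an output of the polyhedron of level `i` containing `u`, once this
polyhedron has been evaluated: also outputs are evenly distributed. -/
def outHolder (i : ℕ) (u : Node) : ℕ :=
  base n k i u +
    rank (nodeKey n) (outputs n k i (cell n k i u)) u % segSize n k i (cell n k i u)

/-- The array of inputs (nodes of time 0) is evenly distributed, one node per VP. -/
def inputVP (u : Node) : ℕ := u.1 + n * u.2.1

/-- The VP from which the polyhedron of level `i` containing `v` gets its input `u`. -/
def source : ℕ → Node → Node → ℕ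
  | 0, u, _ => if u.2.2 = 0 then inputVP n u else outHolder n k 0 u
  | i + 1, u, v =>
      if InBody n k i (cell n k i v) u then outHolder n k (i + 1) u else inHolder n k i v u

/-- The supersteps of a stage are indexed by lists. The superstep `[]` distributes the inputs of the
stage. The superstep `ρ ++ [r]` belongs to the recursive evaluation of the polyhedra in the nested
stripes `ρ`; it starts the phase in which the polyhedra of their `r`-th stripe are evaluated
(and collects results of the preceding phase); the last value of `r` only collects. `phases m ρ`
lists the supersteps of this evaluation when `m` further levels of recursion remain. -/
def phases : ℕ → List ℕ → List (List ℕ)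
  | 0, _ => []
  | m + 1, ρ =>
      (List.range (4 * fan n k ρ.length - 2)).flatMap fun r =>
        (ρ ++ [r]) :: (if r < 4 * fan n k ρ.length - 3 then phases m (ρ ++ [r]) else [])

/-- All supersteps: 17 stages, each with one superstep for the distribution of its inputs followed
by the recursive evaluation of its polyhedron. -/
def schedule : List (Cell × List ℕ) :=
  stages.flatMap fun g => ([] :: phases n k (depth n k) []).map fun ρ => (g, ρ)

/-- The label `2 i log k` for the supersteps of recursion level `i` (and 0 at the start of a
stage). -/
def labelOf (ρ : List ℕ) : ℕ := 2 * Nat.log 2 (n / side n k (ρ.length - 1))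

/-- The inputs of all polyhedra whose evaluation starts with the superstep `(g, ρ)`. -/
def deliver (a : Cell × List ℕ) : Finset (Msg Node) :=
  let i := a.2.length
  ((stencilNodes n ×ˢ stencilNodes n).filter fun e =>
      Arc e.1 e.2 ∧ cell n k 0 e.2 = a.1 ∧ path n k i e.2 = a.2 ∧
        ¬ InBody n k i (cell n k i e.2) e.1).image
    fun e => ⟨source n k i e.1 e.2, inHolder n k i e.2 e.1, some e.1⟩

/-- For `ρ = ρ' ++ [r + 1]`: those outputs of the polyhedra evaluated in the preceding phase
`ρ' ++ [r]` that are also outputs of the parent polyhedron. -/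
def collect (a : Cell × List ℕ) : Finset (Msg Node) :=
  let i := a.2.length - 1
  ((stencilNodes n).filter fun u =>
      cell n k 0 u = a.1 ∧ path n k i u ++ [stripe n k i u + 1] = a.2 ∧
        u ∈ outputs n k i (cell n k i u)).image
    fun u => ⟨outHolder n k (i + 1) u, outHolder n k i u, some u⟩

/-- In an `l`-superstep each VP sends one dummy message to the VP whose index differs from its own
in the `(l + 1)`-st most significant bit. -/
def dummies (l : ℕ) : Multiset (Msg Node) :=
  (Multiset.range (n ^ 2)).map fun r => ⟨r, r ^^^ (n ^ 2 / 2 ^ (l + 1)), none⟩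

/-- The algorithm on `M(n²)` with branching factor `k`. A node of positive time is evaluated by the
VP in charge of its polyhedron of side 1, right after the superstep that delivers its operands. -/
def alg : StaticAlg Node (n ^ 2) where
  len := (schedule n k).length
  label s := labelOf n k ((schedule n k).getD s default).2
  msgs s :=
    let a := (schedule n k).getD s default
    (deliver n k a ∪ collect n k a).val + dummies n (labelOf n k a.2)
  owner u := if u.2.2 = 0 then inputVP n u else base n k (depth n k) u
  time u :=
    if u.2.2 = 0 then 0
    else (schedule n k).idxOf (cell n k 0 u, path n k (depth n k) u) + 1

end OctTet

/-- The network-oblivious algorithm for the `(n,2)`-stencil, with `k = 2 ^ ⌈√(log n)⌉`. -/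
noncomputable def stencilAlg (n : ℕ) : StaticAlg Node (n ^ 2) :=
  OctTet.alg n (2 ^ ⌈Real.sqrt (rlog n)⌉₊)

end NetObl

/-! Upper bound. The four coordinates i₂ ± i₀, i₂ ± i₁ never decrease along an arc, so evaluation by
increasing `cellSum` respects all dependences and the recursion over stripes is legal
(`OctTet.alg_evaluates`). All polyhedra of a stripe are of one kind, and counting them shows that
their segments fit into the segment of the parent (`OctTet.Params.card_siblings_mul_segSize_le`).
Inputs and outputs of a polyhedron of side s lie in a thin shell, so there are O(s²) of them for
about s² VPs; hence a VP sends and receives O(1) messages per superstep, and a superstep costs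
O(n²/p) on p processors, σ included. It remains to count the supersteps with label below log p. They
belong to d ≤ 1 + log p / (2 log k) levels of recursion, so there are O((4k)^d) of them, and (4k)^d
≤ 4^d · k · √p. With k = 2^e, e = ⌈√log n⌉, there are at most e levels, and 4^e · 2^e = 8^e
(`OctTet.sum_card_steps_sqrt_le`).

Wiseness. The dummy messages force degree n²/2^j on every superstep of label below j, while the
degree on M(n²) is bounded by a constant (`OctTet.alg_isWise`).

Lower bound. Colour every node by its owner and let D be the total degree of an algorithm on M(p). A
node with a successor of another colour must be sent by its owner, so there are at most p·D such
nodes. By isoperimetry (`card_ne_pairs_le`), most grid boxes of side m have a dominating colour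
unless m·p·D is of order n³. Along the chain of boxes of sides m, 2m, 4m, …, n around a node, this
colour stays dominant as long as few messages are exchanged while each box is being evaluated
(`StaticAlg.Evaluates.dominates_of_dominates`). Boxes far apart in time on one column are not in
progress simultaneously, so for side r the average of this communication is O(r·D/n), whereas order
r² is needed to break the dominance. The failure probabilities decay geometrically in the scale. If
D is small, some node survives all scales and one processor evaluates almost everything, against the
load condition. The choice m ≈ n/√p gives D ≥ c·n²/√p (`exists_stencil_lower_bound`).

Optimality is the quotient of the two bounds, once the algorithm is known to lie in the class: each
half of the VPs evaluates a fixed fraction of the nodes (`OctTet.half_loads`). -/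

namespace NetObl

namespace StaticAlg

variable {V : Type} {q : ℕ} {A : StaticAlg V q} {nodes : Finset V} {arc : V → V → Prop}

/-! ### Lower bound: values only travel through messages -/

theorem Evaluates.time_le_of_knows (hA : A.Evaluates nodes arc) {w : V} :
    ∀ s ≤ A.len, ∀ r, A.Knows r s w → A.time w ≤ s := by
  intro s
  induction s using Nat.strong_induction_on with
  | _ s ih =>
    rintro hs r (⟨_, h⟩ | ⟨s', hs', m, hm, _, hv⟩)
    · exact h
    · exact (ih s' hs' (by omega) _ (hA.sends s' (by omega) m hm w hv).2).trans hs'.le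

/-- Trace the value backwards through the messages that carried it until the sender is the owner.
The interval for `s'` is what later places this message in a superstep where a given box is in
progress. -/
theorem Evaluates.exists_sent (hA : A.Evaluates nodes arc) {w : V} :
    ∀ s ≤ A.len, ∀ r, r ≠ A.owner w → A.Knows r s w →
      ∃ s', A.time w ≤ s' ∧ s' < s ∧ ∃ m ∈ A.msgs s',
        m.src = A.owner w ∧ m.dst ≠ A.owner w ∧ m.val = some w := by
  intro s
  induction s using Nat.strong_induction_on with
  | _ s ih =>
    rintro hs r hr (⟨h, _⟩ | ⟨s', hs', m, hm, hd, hv⟩)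
    · exact absurd h.symm hr
    · have hk := (hA.sends s' (by omega) m hm w hv).2
      by_cases hsrc : m.src = A.owner w
      · exact ⟨s', hA.time_le_of_knows s' (by omega) _ hk, hs', m, hm, hsrc, hd ▸ hr, hv⟩
      · obtain ⟨t, h1, h2, h3⟩ := ih s' hs' (by omega) _ hsrc hk
        exact ⟨t, h1, h2.trans hs', h3⟩

theorem Evaluates.exists_received (hA : A.Evaluates nodes arc) {w : V} {r : ℕ}
    (hr : r ≠ A.owner w) :
    ∀ s ≤ A.len, A.Knows r s w →
      ∃ s', A.time w ≤ s' ∧ s' < s ∧ ∃ m ∈ A.msgs s',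
        m.dst = r ∧ m.src ≠ r ∧ m.val = some w := by
  intro s
  induction s using Nat.strong_induction_on with
  | _ s ih =>
    rintro hs (⟨h, _⟩ | ⟨s', hs', m, hm, hd, hv⟩)
    · exact absurd h.symm hr
    · have hk := (hA.sends s' (by omega) m hm w hv).2
      by_cases hsrc : m.src = r
      · obtain ⟨t, h1, h2, h3⟩ := ih s' hs' (by omega) (hsrc ▸ hk)
        exact ⟨t, h1, h2.trans hs', h3⟩
      · exact ⟨s', hA.time_le_of_knows s' (by omega) _ hk, hs', m, hm, hd, hsrc, hv⟩

/-- A message carries one value only, so distinct nodes need distinct messages. -/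
theorem card_le_sum_card_filter [DecidableEq V] (A : StaticAlg V q) (J : Finset ℕ) (U : Finset V)
    (P : Msg V → Prop) [DecidablePred P]
    (h : ∀ u ∈ U, ∃ s ∈ J, ∃ m ∈ A.msgs s, P m ∧ m.val = some u) :
    U.card ≤ ∑ s ∈ J, ((A.msgs s).filter P).card := by
  classical
  calc U.card = (U.image some).card :=
        (Finset.card_image_of_injective _ (Option.some_injective V)).symm
    _ ≤ (J.biUnion fun s => (((A.msgs s).filter P).map Msg.val).toFinset).card := by
        refine Finset.card_le_card fun x hx => ?_
        obtain ⟨u, hu, rfl⟩ := Finset.mem_image.1 hx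
        obtain ⟨s, hs, m, hm, hP, hv⟩ := h u hu
        refine Finset.mem_biUnion.2 ⟨s, hs, ?_⟩
        rw [Multiset.mem_toFinset, Multiset.mem_map]
        exact ⟨m, Multiset.mem_filter.2 ⟨hm, hP⟩, hv⟩
    _ ≤ ∑ s ∈ J, ((A.msgs s).filter P).card := by
        refine Finset.card_biUnion_le.trans (Finset.sum_le_sum fun s _ => ?_)
        exact (Multiset.toFinset_card_le _).trans (by simp)

theorem block_self {p : ℕ} (hp : 0 < p) (r : ℕ) : block p p r = r := by
  simp [block, Nat.div_self hp]

theorem sent_le_degree (A : StaticAlg V q) {p j : ℕ} (hj : j < p) (s : ℕ) :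
    A.sent p s j ≤ A.degree p s :=
  (le_max_left _ _).trans
    (Finset.le_sup (f := fun j => max (A.sent p s j) (A.received p s j)) (Finset.mem_range.2 hj))

theorem received_le_degree (A : StaticAlg V q) {p j : ℕ} (hj : j < p) (s : ℕ) :
    A.received p s j ≤ A.degree p s :=
  (le_max_right _ _).trans
    (Finset.le_sup (f := fun j => max (A.sent p s j) (A.received p s j)) (Finset.mem_range.2 hj))

/-- The supersteps during which the evaluation of the node set `B` is in progress. -/
def activeSteps (A : StaticAlg V q) (B : Finset V) : Finset ℕ :=
  (Finset.range A.len).filter fun s => (∃ u ∈ B, A.time u ≤ s) ∧ ∃ v ∈ B, s < A.time v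

/-- The cumulative degree of the supersteps during which the evaluation of `B` is in progress. -/
def activeDegree (A : StaticAlg V q) (B : Finset V) : ℕ := ∑ s ∈ A.activeSteps B, A.degree q s

/-- The value of `u` leaves `r` after `u` is evaluated and before its foreign successor in `B` is;
both nodes belong to `B`, so this happens in an active superstep of `B`. -/
theorem Evaluates.card_sent_le [DecidableEq V] (hA : A.Evaluates nodes arc) (B U : Finset V) {r : ℕ}
    (hr : r < q) (hB : B ⊆ nodes) (hUB : U ⊆ B)
    (hU : ∀ u ∈ U, A.owner u = r ∧ ∃ v ∈ B, arc u v ∧ A.owner v ≠ r) :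
    U.card ≤ A.activeDegree B := by
  refine (A.card_le_sum_card_filter (A.activeSteps B) U
    (fun m => block q q m.src = r ∧ block q q m.dst ≠ r) ?_).trans
      (Finset.sum_le_sum fun s _ => A.sent_le_degree hr s)
  intro u hu
  obtain ⟨hur, v, hv, huv, hvr⟩ := hU u hu
  have hvt := hA.time_lt v (hB hv)
  obtain ⟨s, h1, h2, m, hm, h3, h4, h5⟩ := hA.exists_sent (A.time v) hvt.le (A.owner v)
    (hur ▸ hvr) (hA.operands v (hB hv) u (hB (hUB hu)) huv)
  have hq : 0 < q := by omega
  refine ⟨s, ?_, m, hm, ?_, h5⟩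
  · simp only [activeSteps, Finset.mem_filter, Finset.mem_range]
    exact ⟨by omega, ⟨u, hUB hu, h1⟩, v, hv, h2⟩
  · rw [block_self hq, block_self hq]
    exact ⟨h3.trans hur, hur ▸ h4⟩

theorem Evaluates.card_received_le [DecidableEq V] (hA : A.Evaluates nodes arc) (B U : Finset V)
    {r : ℕ} (hr : r < q) (hB : B ⊆ nodes) (hUB : U ⊆ B)
    (hU : ∀ u ∈ U, A.owner u ≠ r ∧ ∃ v ∈ B, arc u v ∧ A.owner v = r) :
    U.card ≤ A.activeDegree B := by
  refine (A.card_le_sum_card_filter (A.activeSteps B) U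
    (fun m => block q q m.dst = r ∧ block q q m.src ≠ r) ?_).trans
      (Finset.sum_le_sum fun s _ => A.received_le_degree hr s)
  intro u hu
  obtain ⟨hur, v, hv, huv, hvr⟩ := hU u hu
  have hvt := hA.time_lt v (hB hv)
  obtain ⟨s, h1, h2, m, hm, h3, h4, h5⟩ := hA.exists_received hur.symm (A.time v) hvt.le
    (hvr ▸ hA.operands v (hB hv) u (hB (hUB hu)) huv)
  have hq : 0 < q := by omega
  refine ⟨s, ?_, m, hm, ?_, h5⟩
  · simp only [activeSteps, Finset.mem_filter, Finset.mem_range]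
    exact ⟨by omega, ⟨u, hUB hu, h1⟩, v, hv, h2⟩
  · rw [block_self hq, block_self hq]
    exact ⟨h3, h4⟩

/-- The total degree of all supersteps. -/
def totalDegree (A : StaticAlg V q) (p : ℕ) : ℕ := ∑ s ∈ Finset.range A.len, A.degree p s

theorem activeDegree_le (A : StaticAlg V q) (B : Finset V) : A.activeDegree B ≤ A.totalDegree q :=
  Finset.sum_le_sum_of_subset (Finset.filter_subset _ _)

theorem Evaluates.totalDegree_le_H (hA : A.Evaluates nodes arc) {σ : ℝ} (hσ : 0 ≤ σ) :
    (A.totalDegree q : ℝ) ≤ A.H q σ := by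
  have h1 : A.totalDegree q = ∑ i ∈ Finset.range (lg q), A.F i q := by
    unfold totalDegree F steps
    rw [Finset.sum_fiberwise_of_maps_to
      (fun s hs => Finset.mem_range.2 (hA.label_lt s (Finset.mem_range.1 hs)))]
  rw [h1, H]
  push_cast
  refine Finset.sum_le_sum fun i _ => ?_
  have : 0 ≤ ((A.steps i).card : ℝ) * σ := by positivity
  linarith

/-- Some successor of a node that lies in `E` is evaluated by a different processing element. -/
theorem Evaluates.card_boundary_le [DecidableEq V] (hA : A.Evaluates nodes arc) (E : Finset V)
    (hE : E ⊆ nodes)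
    (h : ∀ u ∈ E, ∃ v ∈ nodes, arc u v ∧ A.owner v ≠ A.owner u) :
    E.card ≤ q * A.totalDegree q := by
  have : E.card ≤ A.totalDegree q * (Finset.range q).card := by
    refine Finset.card_le_mul_card_image_of_maps_to (f := A.owner)
      (fun u hu => Finset.mem_range.2 (hA.owner_lt u (hE hu))) _ fun r hr => ?_
    refine (hA.card_sent_le nodes _ (Finset.mem_range.1 hr) subset_rfl
      ((Finset.filter_subset _ _).trans hE) ?_).trans (A.activeDegree_le nodes)
    intro u hu
    obtain ⟨h1, h2⟩ := Finset.mem_filter.1 hu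
    obtain ⟨v, hv, h3, h4⟩ := h u h1
    exact ⟨h2, v, hv, h3, h2 ▸ h4⟩
  rwa [Finset.card_range, mul_comm] at this

end StaticAlg

/-! ### Lower bound: isoperimetry in boxes -/

/-- The cube of side `r` with smallest corner `a`. -/
def cube (a : Node) (r : ℕ) : Finset Node :=
  Finset.Ico a.1 (a.1 + r) ×ˢ Finset.Ico a.2.1 (a.2.1 + r) ×ˢ Finset.Ico a.2.2 (a.2.2 + r)

theorem mem_cube {a u : Node} {r : ℕ} : u ∈ cube a r ↔
    (a.1 ≤ u.1 ∧ u.1 < a.1 + r) ∧ (a.2.1 ≤ u.2.1 ∧ u.2.1 < a.2.1 + r) ∧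
      a.2.2 ≤ u.2.2 ∧ u.2.2 < a.2.2 + r := by
  simp [cube]

theorem card_cube (a : Node) (r : ℕ) : (cube a r).card = r ^ 3 := by
  simp [cube, Finset.card_product]; ring

/-- The nodes of `B` that have a successor of a different colour in `B`. -/
def colorBoundary {α : Type} [DecidableEq α] (f : Node → α) (B : Finset Node) : Finset Node :=
  B.filter fun u => ∃ v ∈ B, Arc u v ∧ f v ≠ f u

section Isoperimetry

variable {α : Type} [DecidableEq α] {f : Node → α} {a : Node} {r : ℕ}

theorem eq_of_notMem_colorBoundary {B : Finset Node} {u v : Node}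
    (hu : u ∈ B) (hv : v ∈ B) (h : u ∉ colorBoundary f B) (huv : Arc u v) : f v = f u := by
  by_contra hne
  exact h (Finset.mem_filter.2 ⟨hu, v, hv, huv, hne⟩)

theorem color_const_time {x y : ℕ} (hx : a.1 ≤ x ∧ x < a.1 + r) (hy : a.2.1 ≤ y ∧ y < a.2.1 + r)
    (h : ∀ b ∈ colorBoundary f (cube a r), ¬ (b.1 = x ∧ b.2.1 = y)) (t : ℕ) (h1 : a.2.2 ≤ t)
    (h2 : t < a.2.2 + r) : f (x, y, t) = f (x, y, a.2.2) := by
  induction t, h1 using Nat.le_induction with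
  | base => rfl
  | succ t ht ih =>
    rw [← ih (by omega)]
    refine eq_of_notMem_colorBoundary (mem_cube.2 ⟨hx, hy, ht, by grind⟩)
      (mem_cube.2 ⟨hx, hy, by grind, h2⟩) (fun hb => h _ hb ⟨rfl, rfl⟩) ?_
    simp [Arc]

/-- Arcs always advance time, so two spatial neighbours are compared through a common successor or,
on the top layer, through a common predecessor. This is why the separating node may be at time `t`
or one earlier. -/
theorem color_const_fst {y t : ℕ} (hy : a.2.1 ≤ y ∧ y < a.2.1 + r)
    (ht : a.2.2 ≤ t ∧ t < a.2.2 + r)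
    (h : ∀ b ∈ colorBoundary f (cube a r), ¬ (b.2.1 = y ∧ (b.2.2 = t ∨ b.2.2 + 1 = t))) (x : ℕ)
    (h1 : a.1 ≤ x) (h2 : x < a.1 + r) : f (x, y, t) = f (a.1, y, t) := by
  induction x, h1 using Nat.le_induction with
  | base => rfl
  | succ x hx ih =>
    rw [← ih (by omega)]
    by_cases htop : t + 1 < a.2.2 + r
    · have e1 : f (x, y, t + 1) = f (x, y, t) :=
        eq_of_notMem_colorBoundary (mem_cube.2 ⟨⟨hx, by grind⟩, hy, ht⟩)
          (mem_cube.2 ⟨⟨hx, by grind⟩, hy, by grind, htop⟩)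
          (fun hb => h _ hb ⟨rfl, Or.inl rfl⟩) (by simp [Arc])
      have e2 : f (x, y, t + 1) = f (x + 1, y, t) :=
        eq_of_notMem_colorBoundary (mem_cube.2 ⟨⟨by grind, h2⟩, hy, ht⟩)
          (mem_cube.2 ⟨⟨hx, by grind⟩, hy, by grind, htop⟩)
          (fun hb => h _ hb ⟨rfl, Or.inl rfl⟩) (by simp [Arc]; omega)
      rw [← e2, e1]
    -- The positions `x` and `x + 1` both fit into the cube, so `r ≥ 2` and the top layer has
    -- another layer of the cube below it.
    · obtain ⟨t, rfl⟩ : ∃ t', t = t' + 1 := ⟨t - 1, by omega⟩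
      have hw : ((x, y, t) : Node) ∈ cube a r :=
        mem_cube.2 ⟨⟨hx, by grind⟩, hy, by grind, by grind⟩
      have hb : ((x, y, t) : Node) ∉ colorBoundary f (cube a r) :=
        fun hb => h _ hb ⟨rfl, Or.inr rfl⟩
      have e1 : f (x + 1, y, t + 1) = f (x, y, t) :=
        eq_of_notMem_colorBoundary hw (mem_cube.2 ⟨⟨by grind, h2⟩, hy, ht⟩) hb
          (by simp [Arc]; omega)
      have e2 : f (x, y, t + 1) = f (x, y, t) :=
        eq_of_notMem_colorBoundary hw (mem_cube.2 ⟨⟨hx, by grind⟩, hy, ht⟩) hb (by simp [Arc])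
      rw [e1, e2]

theorem color_const_snd {x t : ℕ} (hx : a.1 ≤ x ∧ x < a.1 + r)
    (ht : a.2.2 ≤ t ∧ t < a.2.2 + r)
    (h : ∀ b ∈ colorBoundary f (cube a r), ¬ (b.1 = x ∧ (b.2.2 = t ∨ b.2.2 + 1 = t))) (y : ℕ)
    (h1 : a.2.1 ≤ y) (h2 : y < a.2.1 + r) : f (x, y, t) = f (x, a.2.1, t) := by
  induction y, h1 using Nat.le_induction with
  | base => rfl
  | succ y hy ih =>
    rw [← ih (by omega)]
    by_cases htop : t + 1 < a.2.2 + r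
    · have e1 : f (x, y, t + 1) = f (x, y, t) :=
        eq_of_notMem_colorBoundary (mem_cube.2 ⟨hx, ⟨hy, by grind⟩, ht⟩)
          (mem_cube.2 ⟨hx, ⟨hy, by grind⟩, by grind, htop⟩)
          (fun hb => h _ hb ⟨rfl, Or.inl rfl⟩) (by simp [Arc])
      have e2 : f (x, y, t + 1) = f (x, y + 1, t) :=
        eq_of_notMem_colorBoundary (mem_cube.2 ⟨hx, ⟨by grind, h2⟩, ht⟩)
          (mem_cube.2 ⟨hx, ⟨hy, by grind⟩, by grind, htop⟩)
          (fun hb => h _ hb ⟨rfl, Or.inl rfl⟩) (by simp [Arc]; omega)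
      rw [← e2, e1]
    · obtain ⟨t, rfl⟩ : ∃ t', t = t' + 1 := ⟨t - 1, by omega⟩
      have hw : ((x, y, t) : Node) ∈ cube a r :=
        mem_cube.2 ⟨hx, ⟨hy, by grind⟩, by grind, by grind⟩
      have hb : ((x, y, t) : Node) ∉ colorBoundary f (cube a r) :=
        fun hb => h _ hb ⟨rfl, Or.inr rfl⟩
      have e1 : f (x, y + 1, t + 1) = f (x, y, t) :=
        eq_of_notMem_colorBoundary hw (mem_cube.2 ⟨hx, ⟨by grind, h2⟩, ht⟩) hb
          (by simp [Arc]; omega)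
      have e2 : f (x, y, t + 1) = f (x, y, t) :=
        eq_of_notMem_colorBoundary hw (mem_cube.2 ⟨hx, ⟨hy, by grind⟩, ht⟩) hb (by simp [Arc])
      rw [e1, e2]

/-- A pair of nodes of different colours is separated by a boundary node in one of three ways. -/
theorem exists_boundary_of_ne {u v : Node} (hu : u ∈ cube a r) (hv : v ∈ cube a r)
    (huv : f u ≠ f v) : ∃ b ∈ colorBoundary f (cube a r),
      (b.2.1 = u.2.1 ∧ (b.2.2 = u.2.2 ∨ b.2.2 + 1 = u.2.2)) ∨
      (b.1 = v.1 ∧ (b.2.2 = u.2.2 ∨ b.2.2 + 1 = u.2.2)) ∨ (b.1 = v.1 ∧ b.2.1 = v.2.1) := by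
  by_contra! hcon
  rw [mem_cube] at hu hv
  obtain ⟨u0, u1, u2⟩ := u
  obtain ⟨v0, v1, v2⟩ := v
  refine huv ?_
  -- The route from `u` to `v` changes the first coordinate, then the second, both at the time of
  -- `u`, and finally runs along the column of `v`.
  have e1 := color_const_fst (f := f) hu.2.1 hu.2.2 (fun b hb => by have := (hcon b hb).1; tauto)
  have e2 := color_const_snd (f := f) hv.1 hu.2.2 (fun b hb => by have := (hcon b hb).2.1; tauto)
  have e3 := color_const_time (f := f) hv.1 hv.2.1 (fun b hb => by have := (hcon b hb).2.2; tauto)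
  dsimp only at *
  rw [e1 u0 hu.1.1 hu.1.2, ← e1 v0 hv.1.1 hv.1.2, e2 u1 hu.2.1.1 hu.2.1.2,
    ← e2 v1 hv.2.1.1 hv.2.1.2, e3 u2 hu.2.2.1 hu.2.2.2, ← e3 v2 hv.2.2.1 hv.2.2.2]

/-- Charge each pair to a boundary node that separates it. By the three cases of
`exists_boundary_of_ne` a fixed boundary node is charged at most 2r⁴ + 2r⁴ + r⁴ times: the position
of the boundary node fixes the other coordinates, up to two choices of the time in the first two
cases. -/
theorem card_ne_pairs_le (f : Node → α) (a : Node) (r : ℕ) :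
    ((cube a r ×ˢ cube a r).filter fun e => f e.1 ≠ f e.2).card ≤
      5 * r ^ 4 * (colorBoundary f (cube a r)).card := by
  have hI : ∀ x : ℕ, (Finset.Ico x (x + r)).card = r := by simp
  have h2 : ∀ x : ℕ, ({x, x + 1} : Finset ℕ).card = 2 := fun x => Finset.card_pair (by omega)
  let I0 := Finset.Ico a.1 (a.1 + r)
  let I1 := Finset.Ico a.2.1 (a.2.1 + r)
  let I2 := Finset.Ico a.2.2 (a.2.2 + r)
  let X1 : Node → Finset (Node × Node) := fun b =>
    (I0 ×ˢ ({b.2.1} : Finset ℕ) ×ˢ ({b.2.2, b.2.2 + 1} : Finset ℕ)) ×ˢ (I0 ×ˢ I1 ×ˢ I2)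
  let X2 : Node → Finset (Node × Node) := fun b =>
    (I0 ×ˢ I1 ×ˢ ({b.2.2, b.2.2 + 1} : Finset ℕ)) ×ˢ (({b.1} : Finset ℕ) ×ˢ I1 ×ˢ I2)
  let X3 : Node → Finset (Node × Node) := fun b =>
    (I0 ×ˢ I1 ×ˢ I2) ×ˢ (({b.1} : Finset ℕ) ×ˢ ({b.2.1} : Finset ℕ) ×ˢ I2)
  have hsub : ((cube a r ×ˢ cube a r).filter fun e => f e.1 ≠ f e.2) ⊆
      (colorBoundary f (cube a r)).biUnion fun b => X1 b ∪ (X2 b ∪ X3 b) := by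
    rintro ⟨u, v⟩ h
    rw [Finset.mem_filter, Finset.mem_product] at h
    obtain ⟨⟨hu, hv⟩, hne⟩ := h
    obtain ⟨b, hb, hcase⟩ := exists_boundary_of_ne hu hv hne
    refine Finset.mem_biUnion.2 ⟨b, hb, ?_⟩
    rw [mem_cube] at hu hv
    dsimp only at hu hv hcase
    simp only [X1, X2, X3, I0, I1, I2, Finset.mem_union, Finset.mem_product, Finset.mem_Ico,
      Finset.mem_singleton, Finset.mem_insert]
    rcases hcase with ⟨h1, h2⟩ | ⟨h1, h2⟩ | ⟨h1, h2⟩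
    · left
      exact ⟨⟨hu.1, h1.symm, by omega⟩, hv⟩
    · right; left
      exact ⟨⟨hu.1, hu.2.1, by omega⟩, h1.symm, hv.2⟩
    · right; right
      exact ⟨hu, h1.symm, h2.symm, hv.2.2⟩
  refine (Finset.card_le_card hsub).trans ?_
  rw [mul_comm]
  refine Finset.card_biUnion_le_card_mul _ _ _ fun b _ => ?_
  refine (Finset.card_union_le _ _).trans ?_
  have hX1 : (X1 b).card = 2 * r ^ 4 := by
    simp only [X1, I0, I1, I2, Finset.card_product, hI, h2, Finset.card_singleton]; ring
  have hX2 : (X2 b).card = 2 * r ^ 4 := by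
    simp only [X2, I0, I1, I2, Finset.card_product, hI, h2, Finset.card_singleton]; ring
  have hX3 : (X3 b).card = r ^ 4 := by
    simp only [X3, I0, I1, I2, Finset.card_product, hI, Finset.card_singleton]; ring
  have := Finset.card_union_le (X2 b) (X3 b)
  omega

/-- A colouring of a cube with small boundary has a dominating colour. -/
theorem exists_dominating_color (hr : 0 < r) {η : ℝ}
    (h : 5 * ((colorBoundary f (cube a r)).card : ℝ) ≤ η * r ^ 2) :
    ∃ u ∈ cube a r, (1 - η) * (r : ℝ) ^ 3 ≤ ((cube a r).filter fun v => f v = f u).card := by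
  have hcard := card_ne_pairs_le f a r
  have hsum : ((cube a r ×ˢ cube a r).filter fun e => f e.1 ≠ f e.2).card =
      ∑ u ∈ cube a r, ((cube a r).filter fun v => f u ≠ f v).card := by
    simp only [Finset.card_filter, Finset.sum_product]
  have hne : (cube a r).Nonempty := by
    rw [← Finset.card_pos, card_cube]; positivity
  -- At most η·r⁶ ordered pairs have different colours, so some of the r³ nodes disagrees with at
  -- most η·r³ others.
  obtain ⟨u, hu, hle⟩ : ∃ u ∈ cube a r,
      (((cube a r).filter fun v => f u ≠ f v).card : ℝ) ≤ η * r ^ 3 := by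
    refine Finset.exists_le_of_sum_le hne ?_
    rw [Finset.sum_const, card_cube, nsmul_eq_mul]
    have h1 : ((∑ u ∈ cube a r, ((cube a r).filter fun v => f u ≠ f v).card : ℕ) : ℝ) ≤
        5 * r ^ 4 * ((colorBoundary f (cube a r)).card : ℝ) := by
      rw [← hsum]; exact_mod_cast hcard
    push_cast at h1 ⊢
    calc _ ≤ _ := h1
      _ = r ^ 4 * (5 * ((colorBoundary f (cube a r)).card : ℝ)) := by ring
      _ ≤ r ^ 4 * (η * r ^ 2) := by gcongr
      _ = _ := by ring
  refine ⟨u, hu, ?_⟩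
  have h3 := Finset.card_filter_add_card_filter_not (s := cube a r) (fun v => f v = f u)
  rw [card_cube] at h3
  have h4 : ((cube a r).filter fun v => ¬ f v = f u) = (cube a r).filter fun v => f u ≠ f v :=
    Finset.filter_congr fun v _ => by rw [eq_comm]
  rw [h4] at h3
  have h5 : (((cube a r).filter fun v => f v = f u).card : ℝ) +
      (((cube a r).filter fun v => f u ≠ f v).card : ℝ) = r ^ 3 := by exact_mod_cast h3
  linarith

/-- A colour class with small boundary is either almost empty or almost everything. -/
theorem color_small_or_large (P : Node → Prop) [DecidablePred P] {η : ℝ}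
    (h : 5 * ((colorBoundary (fun u => decide (P u)) (cube a r)).card : ℝ) ≤ η * r ^ 2) :
    (((cube a r).filter P).card : ℝ) ≤ 2 * η * r ^ 3 ∨
      (1 - 2 * η) * (r : ℝ) ^ 3 ≤ ((cube a r).filter P).card := by
  have hcard := card_ne_pairs_le (fun u => decide (P u)) a r
  have h3 := Finset.card_filter_add_card_filter_not (s := cube a r) P
  rw [card_cube] at h3
  have hprod : ((cube a r).filter P).card * ((cube a r).filter fun v => ¬ P v).card ≤
      5 * r ^ 4 * (colorBoundary (fun u => decide (P u)) (cube a r)).card := by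
    refine le_trans ?_ hcard
    rw [← Finset.card_product]
    refine Finset.card_le_card ?_
    rintro ⟨u, v⟩ he
    simp only [Finset.mem_product, Finset.mem_filter] at he ⊢
    refine ⟨⟨he.1.1, he.2.1⟩, ?_⟩
    simp [he.1.2, he.2.2]
  set x := ((cube a r).filter P).card
  set y := ((cube a r).filter fun v => ¬ P v).card
  have h5 : (x : ℝ) + y = r ^ 3 := by exact_mod_cast h3
  have h6 : (x : ℝ) * y ≤ 5 * r ^ 4 * (colorBoundary (fun u => decide (P u)) (cube a r)).card := by
    exact_mod_cast hprod
  have h7 : (x : ℝ) * y ≤ η * r ^ 3 * r ^ 3 := by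
    calc _ ≤ _ := h6
      _ = r ^ 4 * (5 * ((colorBoundary (fun u => decide (P u)) (cube a r)).card : ℝ)) := by ring
      _ ≤ r ^ 4 * (η * r ^ 2) := by gcongr
      _ = _ := by ring
  by_contra! hcon
  obtain ⟨hx, hy⟩ := hcon
  have hx0 : (0 : ℝ) ≤ x := Nat.cast_nonneg _
  have hy0 : (0 : ℝ) ≤ y := Nat.cast_nonneg _
  have hy' : 2 * η * r ^ 3 < y := by linarith
  have hη : 0 ≤ η * (r : ℝ) ^ 3 := by
    have : (0 : ℝ) ≤ η * r ^ 2 := le_trans (by positivity) h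
    calc (0 : ℝ) ≤ η * r ^ 2 * r := by positivity
      _ = _ := by ring
  -- The larger of `x`, `y` is at least r³/2, so if the other exceeded 2η·r³, the product would
  -- exceed η·r⁶.
  rcases le_total (x : ℝ) y with hxy | hxy
  · nlinarith
  · nlinarith

end Isoperimetry

end NetObl

namespace NetObl

/-! ### Lower bound: dyadic boxes -/

/-- The box of the grid of side `r` that contains `u`. -/
def boxOf (r : ℕ) (u : Node) : Finset Node :=
  cube (r * (u.1 / r), r * (u.2.1 / r), r * (u.2.2 / r)) r

theorem mem_boxOf {r : ℕ} (hr : 0 < r) {u v : Node} :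
    v ∈ boxOf r u ↔ v.1 / r = u.1 / r ∧ v.2.1 / r = u.2.1 / r ∧ v.2.2 / r = u.2.2 / r := by
  have key : ∀ a b : ℕ, (r * (b / r) ≤ a ∧ a < r * (b / r) + r) ↔ a / r = b / r := by
    intro a b
    rw [Nat.div_eq_iff hr]; grind
  simp only [boxOf, mem_cube, key]

theorem card_boxOf (r : ℕ) (u : Node) : (boxOf r u).card = r ^ 3 := card_cube _ _

theorem mem_stencilNodes {n : ℕ} {u : Node} :
    u ∈ stencilNodes n ↔ u.1 < n ∧ u.2.1 < n ∧ u.2.2 < n := by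
  simp [stencilNodes]

theorem card_stencilNodes (n : ℕ) : (stencilNodes n).card = n ^ 3 := by
  simp [stencilNodes, Finset.card_product]; ring

theorem boxOf_subset_stencilNodes {n r : ℕ} (hr : 0 < r) (hrn : r ∣ n) {u : Node}
    (hu : u ∈ stencilNodes n) : boxOf r u ⊆ stencilNodes n := by
  obtain ⟨m, rfl⟩ := hrn
  intro v hv
  rw [mem_boxOf hr] at hv
  rw [mem_stencilNodes] at hu ⊢
  have key : ∀ a b : ℕ, a / r = b / r → b < r * m → a < r * m := by
    intro a b h hb
    rw [mul_comm] at hb ⊢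
    rw [← Nat.div_lt_iff_lt_mul hr] at hb ⊢
    omega
  exact ⟨key _ _ hv.1 hu.1, key _ _ hv.2.1 hu.2.1, key _ _ hv.2.2 hu.2.2⟩

theorem boxOf_subset_boxOf_two_mul {r : ℕ} (hr : 0 < r) (u : Node) :
    boxOf r u ⊆ boxOf (2 * r) u := by
  intro v hv
  rw [mem_boxOf hr] at hv
  rw [mem_boxOf (by omega)]
  simp only [mul_comm 2 r, ← Nat.div_div_eq_div_mul, hv.1, hv.2.1, hv.2.2, and_self]

/-- Markov's inequality for finite sums. -/
theorem card_filter_lt_mul_le {ι : Type*} (N : Finset ι) (g : ι → ℝ) (hg : ∀ i ∈ N, 0 ≤ g i)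
    (τ : ℝ) : ((N.filter fun i => τ < g i).card : ℝ) * τ ≤ ∑ i ∈ N, g i := by
  calc ((N.filter fun i => τ < g i).card : ℝ) * τ = ∑ i ∈ N.filter fun i => τ < g i, τ := by
        rw [Finset.sum_const, nsmul_eq_mul]
    _ ≤ ∑ i ∈ N.filter fun i => τ < g i, g i :=
        Finset.sum_le_sum fun i hi => (Finset.mem_filter.1 hi).2.le
    _ ≤ ∑ i ∈ N, g i :=
        Finset.sum_le_sum_of_subset_of_nonneg (Finset.filter_subset _ _) fun i hi _ => hg i hi

namespace StaticAlg

variable {n p : ℕ} {A : StaticAlg Node p}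

theorem Evaluates.time_le_of_arc (hA : A.Evaluates (stencilNodes n) Arc) {u v : Node}
    (hu : u ∈ stencilNodes n) (hv : v ∈ stencilNodes n) (huv : Arc u v) : A.time u ≤ A.time v :=
  hA.time_le_of_knows _ (hA.time_lt v hv).le _ (hA.operands v hv u hu huv)

/-- Light cone: in each time step both space coordinates can approach those of `v` by one, so there
is a chain of arcs from `u` to `v`. -/
theorem Evaluates.time_le_of_dist (hA : A.Evaluates (stencilNodes n) Arc) {v : Node}
    (hv : v ∈ stencilNodes n) : ∀ d : ℕ, ∀ u ∈ stencilNodes n, v.2.2 = u.2.2 + d →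
      v.1 ≤ u.1 + d → u.1 ≤ v.1 + d → v.2.1 ≤ u.2.1 + d → u.2.1 ≤ v.2.1 + d →
      A.time u ≤ A.time v := by
  intro d
  induction d with
  | zero =>
    intro u _ h1 h2 h3 h4 h5
    have : u = v := Prod.ext (by omega) (Prod.ext (by omega) (by omega))
    rw [this]
  | succ d ih =>
    intro u hu h1 h2 h3 h4 h5
    have hstep : ∀ a b : ℕ, a ≤ b + (d + 1) → b ≤ a + (d + 1) → a < n → b < n →
        ∃ c, c < n ∧ (c ≤ b + 1 ∧ b ≤ c + 1) ∧ a ≤ c + d ∧ c ≤ a + d := by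
      intro a b hab hba ha hb
      rcases lt_trichotomy a b with h | h | h
      · exact ⟨b - 1, by omega, by omega, by omega, by omega⟩
      · exact ⟨b, by omega, by omega, by omega, by omega⟩
      · exact ⟨b + 1, by omega, by omega, by omega, by omega⟩
    rw [mem_stencilNodes] at hv hu
    obtain ⟨x, hx1, hx2, hx3, hx4⟩ := hstep v.1 u.1 h2 h3 hv.1 hu.1
    obtain ⟨y, hy1, hy2, hy3, hy4⟩ := hstep v.2.1 u.2.1 h4 h5 hv.2.1 hu.2.1
    have hw : ((x, y, u.2.2 + 1) : Node) ∈ stencilNodes n :=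
      mem_stencilNodes.2 ⟨hx1, hy1, by dsimp only; omega⟩
    refine (hA.time_le_of_arc (mem_stencilNodes.2 hu) hw ⟨rfl, hx2, hy2⟩).trans ?_
    exact ih _ hw (by dsimp only; omega) hx3 hx4 hy3 hy4

/-- On a fixed column, two boxes with at least one whole box between them are evaluated one after
the other, since every node of the later box depends on every node of the earlier one. Hence the
boxes in progress occupy at most two adjacent levels, that is at most 2r nodes of the column. -/
theorem Evaluates.card_filter_mem_activeSteps_le (hA : A.Evaluates (stencilNodes n) Arc) {r : ℕ}
    (hr : 0 < r) (hrn : r ∣ n) (s : ℕ) :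
    ((stencilNodes n).filter fun u => s ∈ A.activeSteps (boxOf r u)).card ≤ 2 * r * n ^ 2 := by
  have hc : (Finset.range n ×ˢ Finset.range n).card = n ^ 2 := by
    rw [Finset.card_product, Finset.card_range, sq]
  rw [← hc]
  refine Finset.card_le_mul_card_image_of_maps_to (f := fun u : Node => (u.1, u.2.1)) ?_ _ ?_
  · intro u hu
    have := mem_stencilNodes.1 (Finset.mem_filter.1 hu).1
    simp [this.1, this.2.1]
  rintro ⟨x, y⟩ -
  set X := ((stencilNodes n).filter fun u => s ∈ A.activeSteps (boxOf r u)).filter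
    fun u => (u.1, u.2.1) = (x, y) with hX
  have hXmem : ∀ u ∈ X, u ∈ stencilNodes n ∧ s ∈ A.activeSteps (boxOf r u) ∧ u.1 = x ∧
      u.2.1 = y := by
    intro u hu
    simp only [hX, Finset.mem_filter, Prod.mk.injEq] at hu
    exact ⟨hu.1.1, hu.1.2, hu.2.1, hu.2.2⟩
  rcases X.eq_empty_or_nonempty with h0 | hne
  · simp [h0]
  obtain ⟨u, hu, hmin⟩ := Finset.exists_min_image X (fun u => u.2.2) hne
  obtain ⟨hun, hus, hux, huy⟩ := hXmem u hu
  have : X.card ≤ (Finset.Ico (r * (u.2.2 / r)) (r * (u.2.2 / r) + 2 * r)).card := by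
    refine Finset.card_le_card_of_injOn (fun u => u.2.2) ?_ ?_
    · intro w hw
      obtain ⟨hwn, hws, hwx, hwy⟩ := hXmem w hw
      have hle := hmin w hw
      rw [Finset.coe_Ico, Set.mem_Ico]
      dsimp only
      have h1 : r * (u.2.2 / r) ≤ u.2.2 := Nat.mul_div_le _ _
      refine ⟨by omega, ?_⟩
      by_contra hlt
      push Not at hlt
      have hdiv : u.2.2 / r + 2 ≤ w.2.2 / r := by
        rw [Nat.le_div_iff_mul_le hr]; linarith
      simp only [activeSteps, Finset.mem_filter] at hus hws
      obtain ⟨-, -, a, ha, has⟩ := hus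
      obtain ⟨-, ⟨b, hb, hbs⟩, -⟩ := hws
      have ha' := boxOf_subset_stencilNodes hr hrn hun ha
      have hb' := boxOf_subset_stencilNodes hr hrn hwn hb
      simp only [boxOf, mem_cube] at ha hb
      have hmul : r * (u.2.2 / r) + 2 * r ≤ r * (w.2.2 / r) := by
        calc r * (u.2.2 / r) + 2 * r = r * (u.2.2 / r + 2) := by ring
          _ ≤ _ := Nat.mul_le_mul_left _ hdiv
      rw [hux, huy] at ha
      rw [hwx, hwy] at hb
      -- The times of `a` and `b` differ by more than `r`, their space coordinates by less than `r`;
      -- yet `b` is done by superstep `s` and `a` is not.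
      have := hA.time_le_of_dist hb' (b.2.2 - a.2.2) a ha' (by omega) (by omega) (by omega)
        (by omega) (by omega)
      omega
    · intro w hw w' hw' heq
      obtain ⟨-, -, h1, h2⟩ := hXmem w hw
      obtain ⟨-, -, h3, h4⟩ := hXmem w' hw'
      ext
      · rw [h1, h3]
      · rw [h2, h4]
      · exact heq
  simpa using this

/-- The averaged amount of communication during the evaluation of a box of side `r`. -/
theorem Evaluates.sum_activeDegree_le (hA : A.Evaluates (stencilNodes n) Arc) {r : ℕ}
    (hr : 0 < r) (hrn : r ∣ n) :
    ∑ u ∈ stencilNodes n, A.activeDegree (boxOf r u) ≤ 2 * r * n ^ 2 * A.totalDegree p := by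
  calc ∑ u ∈ stencilNodes n, A.activeDegree (boxOf r u)
      = ∑ s ∈ Finset.range A.len,
          ∑ _u ∈ (stencilNodes n).filter (fun u => s ∈ A.activeSteps (boxOf r u)),
            A.degree p s := by
        unfold activeDegree
        refine Finset.sum_comm' fun u s => ?_
        simp only [Finset.mem_filter, activeSteps]
        tauto
    _ ≤ ∑ s ∈ Finset.range A.len, 2 * r * n ^ 2 * A.degree p s := by
        refine Finset.sum_le_sum fun s _ => ?_
        rw [Finset.sum_const, smul_eq_mul]
        exact Nat.mul_le_mul_right _ (hA.card_filter_mem_activeSteps_le hr hrn s)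
    _ = _ := by rw [totalDegree, Finset.mul_sum]

/-- Double counting: a boundary node lies in the boxes of at most r³ nodes `u`, namely those of its
own box, and the whole array has at most p · `totalDegree` boundary nodes. -/
theorem Evaluates.sum_card_colorBoundary_le (hA : A.Evaluates (stencilNodes n) Arc) {r : ℕ}
    (hr : 0 < r) (hrn : r ∣ n) :
    ∑ u ∈ stencilNodes n, (colorBoundary A.owner (boxOf r u)).card ≤
      r ^ 3 * (p * A.totalDegree p) := by
  set E := (stencilNodes n).filter fun b => ∃ v ∈ stencilNodes n, Arc b v ∧ A.owner v ≠ A.owner b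
    with hE
  have hEcard : E.card ≤ p * A.totalDegree p :=
    hA.card_boundary_le E (Finset.filter_subset _ _) fun u hu => (Finset.mem_filter.1 hu).2
  calc ∑ u ∈ stencilNodes n, (colorBoundary A.owner (boxOf r u)).card
      = ∑ u ∈ stencilNodes n, ∑ _b ∈ colorBoundary A.owner (boxOf r u), 1 := by simp
    _ = ∑ b ∈ E, ∑ _u ∈ (stencilNodes n).filter
          (fun u => b ∈ colorBoundary A.owner (boxOf r u)), 1 := by
        refine Finset.sum_comm' fun u b => ?_
        simp only [Finset.mem_filter, hE]
        refine ⟨fun ⟨h1, h2⟩ => ⟨⟨h1, h2⟩, ?_⟩, fun ⟨h1, _⟩ => h1⟩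
        obtain ⟨h3, v, hv, h4⟩ := Finset.mem_filter.1 h2
        have hsub := boxOf_subset_stencilNodes hr hrn h1
        exact ⟨hsub h3, v, hsub hv, h4⟩
    _ ≤ ∑ b ∈ E, r ^ 3 := by
        refine Finset.sum_le_sum fun b _ => ?_
        rw [Finset.sum_const, smul_eq_mul, mul_one, ← card_boxOf r b]
        refine Finset.card_le_card fun u hu => ?_
        have := (mem_boxOf hr).1 (Finset.mem_filter.1 (Finset.mem_filter.1 hu).2).1
        exact (mem_boxOf hr).2 ⟨this.1.symm, this.2.1.symm, this.2.2.symm⟩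
    _ ≤ _ := by
        rw [Finset.sum_const, smul_eq_mul, mul_comm]
        exact Nat.mul_le_mul_left _ hEcard

/-- Boundary nodes owned by `q` must be sent by `q`, the others must be received by `q`, all while
`B` is in progress. Unlike the boundary of the full colouring, that of a single class costs no
factor `p`. -/
theorem Evaluates.card_colorBoundary_owner_le (hA : A.Evaluates (stencilNodes n) Arc) {q : ℕ}
    (hq : q < p) {B : Finset Node} (hB : B ⊆ stencilNodes n) :
    (colorBoundary (fun u => decide (A.owner u = q)) B).card ≤ 2 * A.activeDegree B := by
  set X := B.filter fun u => A.owner u = q ∧ ∃ v ∈ B, Arc u v ∧ A.owner v ≠ q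
  set Y := B.filter fun u => A.owner u ≠ q ∧ ∃ v ∈ B, Arc u v ∧ A.owner v = q
  have hsub : colorBoundary (fun u => decide (A.owner u = q)) B ⊆ X ∪ Y := by
    intro u hu
    obtain ⟨h1, v, hv, h2, h3⟩ := Finset.mem_filter.1 hu
    rw [ne_eq, decide_eq_decide] at h3
    simp only [X, Y, Finset.mem_union, Finset.mem_filter]
    by_cases h4 : A.owner u = q
    · exact Or.inl ⟨h1, h4, v, hv, h2, by tauto⟩
    · exact Or.inr ⟨h1, h4, v, hv, h2, by tauto⟩
  have hX := hA.card_sent_le B X hq hB (Finset.filter_subset _ _)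
    fun u hu => (Finset.mem_filter.1 hu).2
  have hY := hA.card_received_le B Y hq hB (Finset.filter_subset _ _)
    fun u hu => (Finset.mem_filter.1 hu).2
  have := (Finset.card_le_card hsub).trans (Finset.card_union_le X Y)
  omega

/-- A processor that dominates a box dominates all larger boxes around it, as long as little
communication takes place during their evaluation. -/
theorem Evaluates.dominates_of_dominates (hA : A.Evaluates (stencilNodes n) Arc) {m J q : ℕ}
    (hm : 0 < m) (hn : n = m * 2 ^ J) (hq : q < p) {η : ℝ} (hη0 : η ≤ 1 / 20) {u : Node}
    (hu : u ∈ stencilNodes n)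
    (h0 : (1 - 2 * η) * (m : ℝ) ^ 3 ≤ ((boxOf m u).filter fun v => A.owner v = q).card)
    (hwin : ∀ j, 1 ≤ j → j ≤ J →
      10 * (A.activeDegree (boxOf (m * 2 ^ j) u) : ℝ) ≤ η * ((m * 2 ^ j : ℕ) : ℝ) ^ 2) :
    ∀ j ≤ J, (1 - 2 * η) * ((m * 2 ^ j : ℕ) : ℝ) ^ 3 ≤
      ((boxOf (m * 2 ^ j) u).filter fun v => A.owner v = q).card := by
  intro j
  induction j with
  | zero => intro _; simpa using h0
  | succ j ih =>
    intro hj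
    have ih := ih (by omega)
    have hpos : 0 < m * 2 ^ j := by positivity
    have hr : m * 2 ^ (j + 1) = 2 * (m * 2 ^ j) := by ring
    have hdvd : m * 2 ^ (j + 1) ∣ n := hn ▸ Nat.mul_dvd_mul_left m (pow_dvd_pow 2 hj)
    have hsub := boxOf_subset_stencilNodes (by positivity) hdvd hu
    have hbd := hA.card_colorBoundary_owner_le hq hsub
    have hw := hwin (j + 1) (by omega) hj
    have hbd' : ((colorBoundary (fun v => decide (A.owner v = q))
        (boxOf (m * 2 ^ (j + 1)) u)).card : ℝ) ≤ 2 * A.activeDegree (boxOf (m * 2 ^ (j + 1)) u) := by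
      exact_mod_cast hbd
    have hcb : 5 * ((colorBoundary (fun v => decide (A.owner v = q))
        (boxOf (m * 2 ^ (j + 1)) u)).card : ℝ) ≤ η * ((m * 2 ^ (j + 1) : ℕ) : ℝ) ^ 2 := by linarith
    -- The box of half the side already provides a fraction (1 - 2η)/8 of the new volume, which
    -- exceeds 2η since η ≤ 1/20; so the alternative "almost empty" is impossible.
    refine (color_small_or_large (fun v => A.owner v = q) hcb).resolve_left fun hsmall => ?_
    have hmono : ((boxOf (m * 2 ^ j) u).filter fun v => A.owner v = q).card ≤
        ((boxOf (m * 2 ^ (j + 1)) u).filter fun v => A.owner v = q).card := by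
      rw [hr]
      exact Finset.card_le_card (Finset.filter_subset_filter _ (boxOf_subset_boxOf_two_mul hpos u))
    have hmono' : (((boxOf (m * 2 ^ j) u).filter fun v => A.owner v = q).card : ℝ) ≤
        ((boxOf (m * 2 ^ (j + 1)) u).filter fun v => A.owner v = q).card := by exact_mod_cast hmono
    have h3 := ih.trans (hmono'.trans hsmall)
    rw [hr] at h3
    push_cast at h3
    have h4 : (0 : ℝ) < ((m : ℝ) * 2 ^ j) ^ 3 := by positivity
    have h5 : (2 * ((m : ℝ) * 2 ^ j)) ^ 3 = 8 * ((m : ℝ) * 2 ^ j) ^ 3 := by ring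
    rw [h5] at h3
    nlinarith

theorem sum_half_pow_le (J : ℕ) : ∑ j ∈ Finset.Icc 1 J, (1 / 2 : ℝ) ^ j ≤ 1 := by
  have h : ∀ J : ℕ, ∑ j ∈ Finset.Icc 1 J, (1 / 2 : ℝ) ^ j = 1 - (1 / 2) ^ J := by
    intro J
    induction J with
    | zero => simp
    | succ J ih => rw [Finset.sum_Icc_succ_top (by omega), ih]; ring
  rw [h]
  have : (0 : ℝ) ≤ (1 / 2) ^ J := by positivity
  linarith

/-- Union bound over scales: the first summand, divided by η, bounds the number of nodes whose box
of side `m` may lack a dominating owner, the second the number of nodes that have a larger dyadic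
box with too much communication. If both together miss some node, the owner dominating its smallest
box dominates the whole array. -/
theorem Evaluates.totalDegree_lower_bound (hA : A.Evaluates (stencilNodes n) Arc) {m J : ℕ}
    (hm : 0 < m) (hn : n = m * 2 ^ J) {η : ℝ} (hη : 0 < η) (hη0 : η ≤ 1 / 20)
    (hload : ∀ q < p,
      (((stencilNodes n).filter fun v => A.owner v = q).card : ℝ) < (1 - 2 * η) * (n : ℝ) ^ 3) :
    η * (n : ℝ) ^ 3 ≤ 5 * m * p * A.totalDegree p + 20 * n ^ 2 * A.totalDegree p / m := by
  have hmR : (0 : ℝ) < m := by exact_mod_cast hm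
  set D : ℝ := (A.totalDegree p : ℝ) with hD
  have hD0 : 0 ≤ D := Nat.cast_nonneg _
  set N := stencilNodes n
  set bad0 := N.filter fun u =>
    η * (m : ℝ) ^ 2 < 5 * ((colorBoundary A.owner (boxOf m u)).card : ℝ) with hbad0
  let bad : ℕ → Finset Node := fun j => N.filter fun u =>
    η * ((m * 2 ^ j : ℕ) : ℝ) ^ 2 < 10 * (A.activeDegree (boxOf (m * 2 ^ j) u) : ℝ)
  have h0 : (bad0.card : ℝ) * η ≤ 5 * m * p * D := by
    have h1 := card_filter_lt_mul_le N
      (fun u => 5 * ((colorBoundary A.owner (boxOf m u)).card : ℝ)) (fun _ _ => by positivity)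
      (η * (m : ℝ) ^ 2)
    rw [← Finset.mul_sum] at h1
    have h2 : ((∑ u ∈ N, (colorBoundary A.owner (boxOf m u)).card : ℕ) : ℝ) ≤
        (m ^ 3 * (p * A.totalDegree p) : ℕ) :=
      Nat.cast_le.2 (hA.sum_card_colorBoundary_le hm (hn ▸ dvd_mul_right _ _))
    push_cast at h2
    have h3 : (bad0.card : ℝ) * η * m ^ 2 ≤ 5 * m * p * D * m ^ 2 := by
      calc _ = (bad0.card : ℝ) * (η * m ^ 2) := by ring
        _ ≤ _ := h1
        _ ≤ 5 * (m ^ 3 * (p * D)) := by gcongr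
        _ = _ := by ring
    exact le_of_mul_le_mul_right h3 (by positivity)
  have hj : ∀ j ≤ J, ((bad j).card : ℝ) * η ≤ 20 * n ^ 2 * D / m * (1 / 2) ^ j := by
    intro j hjJ
    have h1 := card_filter_lt_mul_le N
      (fun u => 10 * (A.activeDegree (boxOf (m * 2 ^ j) u) : ℝ)) (fun _ _ => by positivity)
      (η * ((m * 2 ^ j : ℕ) : ℝ) ^ 2)
    rw [← Finset.mul_sum] at h1
    have h2 : ((∑ u ∈ N, A.activeDegree (boxOf (m * 2 ^ j) u) : ℕ) : ℝ) ≤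
        (2 * (m * 2 ^ j) * n ^ 2 * A.totalDegree p : ℕ) :=
      Nat.cast_le.2 (hA.sum_activeDegree_le (by positivity)
        (hn ▸ Nat.mul_dvd_mul_left m (pow_dvd_pow 2 hjJ)))
    push_cast at h1 h2
    have h3 : ((bad j).card : ℝ) * η * ((m : ℝ) * 2 ^ j) ^ 2 ≤
        20 * n ^ 2 * D / m * (1 / 2) ^ j * ((m : ℝ) * 2 ^ j) ^ 2 := by
      calc _ = ((bad j).card : ℝ) * (η * ((m : ℝ) * 2 ^ j) ^ 2) := by ring
        _ ≤ _ := by simpa only [bad, Nat.cast_mul, Nat.cast_pow, Nat.cast_ofNat] using h1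
        _ ≤ 10 * (2 * (m * 2 ^ j) * n ^ 2 * D) := by gcongr
        _ = _ := by rw [one_div_pow]; field_simp; ring
    exact le_of_mul_le_mul_right h3 (by positivity)
  by_contra! hcon
  set Bad := bad0 ∪ (Finset.Icc 1 J).biUnion bad
  have hBad : (Bad.card : ℝ) * η < (n : ℝ) ^ 3 * η := by
    have h1 : (Bad.card : ℝ) ≤ bad0.card + ∑ j ∈ Finset.Icc 1 J, ((bad j).card : ℝ) := by
      have := (Finset.card_union_le bad0 ((Finset.Icc 1 J).biUnion bad)).trans
        (Nat.add_le_add_left Finset.card_biUnion_le _)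
      exact_mod_cast this
    calc (Bad.card : ℝ) * η ≤ (bad0.card + ∑ j ∈ Finset.Icc 1 J, ((bad j).card : ℝ)) * η := by
          gcongr
      _ = bad0.card * η + ∑ j ∈ Finset.Icc 1 J, ((bad j).card : ℝ) * η := by
          rw [add_mul, Finset.sum_mul]
      _ ≤ 5 * m * p * D + ∑ j ∈ Finset.Icc 1 J, 20 * n ^ 2 * D / m * (1 / 2) ^ j :=
          add_le_add h0 (Finset.sum_le_sum fun j hjm => hj j (Finset.mem_Icc.1 hjm).2)
      _ ≤ 5 * m * p * D + 20 * n ^ 2 * D / m * 1 := by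
          rw [← Finset.mul_sum]
          gcongr
          exact sum_half_pow_le J
      _ < _ := by linarith
  have hlt : Bad.card < N.card := by
    rw [card_stencilNodes]
    exact_mod_cast lt_of_mul_lt_mul_right hBad hη.le
  obtain ⟨u, huN, huB⟩ := Finset.exists_mem_notMem_of_card_lt_card hlt
  simp only [Bad, Finset.mem_union, Finset.mem_biUnion, not_or, not_exists, not_and] at huB
  obtain ⟨hu0, huj⟩ := huB
  have hu0' : 5 * ((colorBoundary A.owner (boxOf m u)).card : ℝ) ≤ η * (m : ℝ) ^ 2 := by
    by_contra! h
    exact hu0 (Finset.mem_filter.2 ⟨huN, h⟩)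
  obtain ⟨w, hw, hdom⟩ := exists_dominating_color hm hu0'
  have hwN := boxOf_subset_stencilNodes hm (hn ▸ dvd_mul_right _ _) huN hw
  have hq := hA.owner_lt w hwN
  have hfin := hA.dominates_of_dominates hm hn hq hη0 huN
    (le_trans (by gcongr; linarith) hdom) (fun j h1 h2 => by
      by_contra! h
      exact huj j (Finset.mem_Icc.2 ⟨h1, h2⟩) (Finset.mem_filter.2 ⟨huN, h⟩)) J le_rfl
  rw [← hn] at hfin
  refine absurd (hload _ hq) (not_lt.2 (hfin.trans ?_))
  exact_mod_cast Finset.card_le_card (Finset.filter_subset_filter _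
    (boxOf_subset_stencilNodes (by rw [hn]; positivity) dvd_rfl huN))

end StaticAlg

/-- Lower bound for the communication complexity of the `(n,2)`-stencil in the class `𝒞₂`. -/
theorem exists_stencil_lower_bound {ε : ℝ} (hε : ε < 1) : ∃ c : ℝ, 0 < c ∧
    ∀ n p : ℕ, IsPowTwo n → IsPowTwo p → 1 < p → p ≤ n ^ 2 → ∀ σ : ℝ, 0 ≤ σ →
      ∀ B : StaticAlg Node p, InClass ε n B → c * ((n : ℝ) ^ 2 / Real.sqrt p) ≤ B.H p σ := by
  -- The bound (1 - ε)/4 makes 1 - 2η > ε, so that dominating the array violates the load condition.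
  set η := min (1 / 20) ((1 - ε) / 4) with hηdef
  have hη : 0 < η := lt_min (by norm_num) (by linarith)
  have hη1 : η ≤ 1 / 20 := min_le_left _ _
  have hη2 : η ≤ (1 - ε) / 4 := min_le_right _ _
  -- 30 = 5 · 2 + 20, from the two terms of `totalDegree_lower_bound` after m·P ≤ 2N·√P and N²/m ≤
  -- N·√P.
  refine ⟨η / 30, by positivity, ?_⟩
  rintro n p ⟨L, rfl⟩ hp2 hp1 hpn σ hσ B ⟨hE, hload⟩
  obtain ⟨b, rfl⟩ := hp2
  have hbL : b ≤ 2 * L := by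
    rw [← pow_mul] at hpn
    have := (Nat.pow_le_pow_iff_right (by norm_num : 1 < 2)).1 hpn
    omega
  -- The smallest boxes have side m = 2^(L - ⌊b/2⌋), which is n/√p up to a factor √2 and balances
  -- the two terms.
  have hn : (2 : ℕ) ^ L = 2 ^ (L - b / 2) * 2 ^ (b / 2) := by
    rw [← pow_add]; congr 1; omega
  have hmain := hE.totalDegree_lower_bound (by positivity) hn hη hη1 (fun q hq => by
    have h1 := hload (2 ^ b) ⟨b, rfl⟩ hp1 le_rfl q hq
    simp only [StaticAlg.load, StaticAlg.block_self (pow_pos (by norm_num : 0 < 2) b)] at h1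
    refine h1.trans_lt ?_
    have : (0 : ℝ) < ((2 ^ L : ℕ) : ℝ) ^ 3 := by positivity
    nlinarith)
  refine le_trans ?_ (hE.totalDegree_le_H hσ)
  set D : ℝ := (B.totalDegree (2 ^ b) : ℝ)
  have hD0 : 0 ≤ D := Nat.cast_nonneg _
  set m : ℝ := ((2 ^ (L - b / 2) : ℕ) : ℝ) with hm
  set N : ℝ := ((2 ^ L : ℕ) : ℝ) with hN
  set P : ℝ := ((2 ^ b : ℕ) : ℝ) with hP
  have hm0 : 0 < m := by positivity
  have hN0 : 0 < N := by positivity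
  have hP0 : 0 < P := by positivity
  have hs0 : 0 < Real.sqrt P := Real.sqrt_pos.2 hP0
  have hsq : Real.sqrt P * Real.sqrt P = P := Real.mul_self_sqrt hP0.le
  have e1 : N ^ 2 ≤ m ^ 2 * P := by
    rw [hN, hm, hP]; norm_cast
    rw [← pow_mul, ← pow_mul, ← pow_add]
    exact Nat.pow_le_pow_right (by norm_num) (by omega)
  have e2 : m ^ 2 * P ≤ 2 * N ^ 2 := by
    rw [hN, hm, hP]; norm_cast
    rw [← pow_mul, ← pow_mul, ← pow_add, ← pow_succ']
    exact Nat.pow_le_pow_right (by norm_num) (by omega)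
  have e3 : N ≤ m * Real.sqrt P := by
    refine le_of_sq_le_sq ?_ (by positivity)
    rw [mul_pow, sq (Real.sqrt P), hsq]; exact e1
  have e4 : m * Real.sqrt P ≤ 2 * N := by
    refine le_of_sq_le_sq ?_ (by positivity)
    rw [mul_pow, sq (Real.sqrt P), hsq]; nlinarith
  have e5 : m * P ≤ 2 * N * Real.sqrt P := by
    calc m * P = m * Real.sqrt P * Real.sqrt P := by rw [mul_assoc, hsq]
      _ ≤ _ := by gcongr
  have e6 : N ^ 2 / m ≤ N * Real.sqrt P := by
    rw [div_le_iff₀ hm0]; nlinarith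
  have e7 : η * N ^ 3 ≤ 30 * N * Real.sqrt P * D := by
    calc η * N ^ 3 ≤ 5 * m * P * D + 20 * N ^ 2 * D / m := hmain
      _ = 5 * (m * P) * D + 20 * (N ^ 2 / m) * D := by ring
      _ ≤ 5 * (2 * N * Real.sqrt P) * D + 20 * (N * Real.sqrt P) * D := by gcongr
      _ = _ := by ring
  have e8 : η * N ^ 2 ≤ 30 * Real.sqrt P * D := by
    refine le_of_mul_le_mul_left ?_ hN0
    linarith
  rw [div_mul_div_comm, div_le_iff₀ (by positivity)]
  linarith

end NetObl

namespace NetObl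

namespace OctTet

/-! ### Geometry of the polyhedra -/

/-- The parameters of the algorithm are powers of two. -/
structure Params (n k L e : ℕ) : Prop where
  hn : n = 2 ^ L
  hk : k = 2 ^ e
  he : 1 ≤ e

/-- The four coordinates whose quotients form `cell`. On the array the shift makes the natural
subtractions exact, and along arcs all four are nondecreasing. -/
def cx (n : ℕ) (u : Node) : ℕ := 3 * n / 2 + u.2.2 + u.1
def cy (n : ℕ) (u : Node) : ℕ := 3 * n / 2 + u.2.2 - u.1
def cz (n : ℕ) (u : Node) : ℕ := 3 * n / 2 + u.2.2 + u.2.1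
def ct (n : ℕ) (u : Node) : ℕ := 3 * n / 2 + u.2.2 - u.2.1

theorem cell_eq (n k i : ℕ) (u : Node) : cell n k i u =
    (cx n u / side n k i, cy n u / side n k i, cz n u / side n k i, ct n u / side n k i) := rfl

theorem coord_sums {n : ℕ} {u : Node} (hu : u ∈ stencilNodes n) :
    cx n u + cy n u = 2 * (3 * n / 2 + u.2.2) ∧ cz n u + ct n u = 2 * (3 * n / 2 + u.2.2) := by
  rw [mem_stencilNodes] at hu
  simp only [cx, cy, cz, ct]
  omega

theorem coord_lt {n : ℕ} {u : Node} (hu : u ∈ stencilNodes n) :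
    cx n u < 4 * n ∧ cy n u < 4 * n ∧ cz n u < 4 * n ∧ ct n u < 4 * n := by
  rw [mem_stencilNodes] at hu
  simp only [cx, cy, cz, ct]
  omega

theorem side_pos (n k i : ℕ) : 0 < side n k i := by simp [side]

variable {n k L e : ℕ}

namespace Params

theorem pos (hP : Params n k L e) : 0 < n := by rw [hP.hn]; positivity

theorem one_lt_k (hP : Params n k L e) : 1 < k := by
  rw [hP.hk]; exact Nat.one_lt_two_pow (by have := hP.he; omega)

/-- The truncated subtraction in the exponent plays the role of `max 1`, so the last, shorter level
needs no separate treatment. -/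
theorem side_eq (hP : Params n k L e) (i : ℕ) : side n k i = 2 ^ (L - e * i) := by
  rw [side, hP.hn, hP.hk, ← pow_mul]
  rcases le_or_gt (e * i) L with h | h
  · rw [Nat.pow_div h (by norm_num)]
    exact max_eq_right Nat.one_le_two_pow
  · rw [Nat.div_eq_of_lt (Nat.pow_lt_pow_right (by norm_num) h), Nat.sub_eq_zero_of_le h.le]
    rfl

theorem side_zero (hP : Params n k L e) : side n k 0 = n := by
  rw [hP.side_eq, mul_zero, Nat.sub_zero, hP.hn]

theorem fan_eq (hP : Params n k L e) (i : ℕ) :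
    fan n k i = 2 ^ ((L - e * i) - (L - e * (i + 1))) := by
  rw [fan, hP.side_eq, hP.side_eq, Nat.pow_div (by rw [mul_add]; omega) (by norm_num)]

theorem side_eq_mul (hP : Params n k L e) (i : ℕ) :
    side n k i = side n k (i + 1) * fan n k i := by
  rw [hP.fan_eq, hP.side_eq, hP.side_eq, ← pow_add]
  congr 1
  rw [mul_add]; omega

theorem fan_pos (hP : Params n k L e) (i : ℕ) : 0 < fan n k i := by
  rw [hP.fan_eq]; positivity

theorem fan_le (hP : Params n k L e) (i : ℕ) : fan n k i ≤ k := by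
  rw [hP.fan_eq, hP.hk]
  exact Nat.pow_le_pow_right (by norm_num) (by rw [mul_add]; omega)

theorem lt_depth_iff (hP : Params n k L e) {i : ℕ} : i < depth n k ↔ e * i < L := by
  rw [depth, Nat.lt_clog_iff_pow_lt hP.one_lt_k, hP.hn, hP.hk, ← pow_mul,
    Nat.pow_lt_pow_iff_right (by norm_num)]

theorem side_depth (hP : Params n k L e) : side n k (depth n k) = 1 := by
  have := (hP.lt_depth_iff (i := depth n k)).not.1 (lt_irrefl _)
  rw [hP.side_eq, Nat.sub_eq_zero_of_le (by omega), pow_zero]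

theorem two_dvd_fan (hP : Params n k L e) {i : ℕ} (hi : i < depth n k) : 2 ∣ fan n k i := by
  have := hP.lt_depth_iff.1 hi
  have he := hP.he
  rw [hP.fan_eq]
  exact dvd_pow_self 2 (by rw [mul_add]; omega)

theorem two_dvd_side (hP : Params n k L e) {i : ℕ} (hi : i < depth n k) : 2 ∣ side n k i := by
  have := hP.lt_depth_iff.1 hi
  rw [hP.side_eq]
  exact dvd_pow_self 2 (by omega)

theorem cell_succ_div (hP : Params n k L e) (i : ℕ) (u : Node) :
    (cell n k (i + 1) u).1 / fan n k i = (cell n k i u).1 ∧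
    (cell n k (i + 1) u).2.1 / fan n k i = (cell n k i u).2.1 ∧
    (cell n k (i + 1) u).2.2.1 / fan n k i = (cell n k i u).2.2.1 ∧
    (cell n k (i + 1) u).2.2.2 / fan n k i = (cell n k i u).2.2.2 := by
  simp only [cell_eq, Nat.div_div_eq_div_mul, ← hP.side_eq_mul, and_self]

theorem cell_congr_succ (hP : Params n k L e) {i : ℕ} {u v : Node}
    (h : cell n k (i + 1) u = cell n k (i + 1) v) : cell n k i u = cell n k i v := by
  obtain ⟨h1, h2, h3, h4⟩ := hP.cell_succ_div i u
  obtain ⟨g1, g2, g3, g4⟩ := hP.cell_succ_div i v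
  rw [h] at h1 h2 h3 h4
  exact Prod.ext (h1.symm.trans g1) (Prod.ext (h2.symm.trans g2)
    (Prod.ext (h3.symm.trans g3) (h4.symm.trans g4)))

theorem cell_congr (hP : Params n k L e) {i j : ℕ} (hij : i ≤ j) {u v : Node}
    (h : cell n k j u = cell n k j v) : cell n k i u = cell n k i v := by
  induction j, hij using Nat.le_induction with
  | base => exact h
  | succ j _ ih => exact ih (hP.cell_congr_succ h)

/-- Each entry is `fan` times the parent's entry plus a remainder below `fan`. So the subtraction in
`stripe` is exact, and four remainders add up to at most 4(`fan` - 1). -/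
theorem cellSum_succ (hP : Params n k L e) (i : ℕ) (u : Node) :
    cellSum (cell n k (i + 1) u) = fan n k i * cellSum (cell n k i u) + stripe n k i u ∧
      stripe n k i u + 4 ≤ 4 * fan n k i := by
  obtain ⟨h1, h2, h3, h4⟩ := hP.cell_succ_div i u
  rw [stripe]
  generalize cell n k (i + 1) u = c at *
  generalize cell n k i u = d at *
  obtain ⟨a, b, c, f⟩ := c
  obtain ⟨a', b', c', f'⟩ := d
  have hκ := hP.fan_pos i
  generalize fan n k i = κ at *
  simp only [cellSum] at *
  subst h1 h2 h3 h4
  have d1 := Nat.div_add_mod a κ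
  have d2 := Nat.div_add_mod b κ
  have d3 := Nat.div_add_mod c κ
  have d4 := Nat.div_add_mod f κ
  have e1 := Nat.mod_lt a hκ
  have e2 := Nat.mod_lt b hκ
  have e3 := Nat.mod_lt c hκ
  have e4 := Nat.mod_lt f hκ
  simp only [mul_add]
  omega

end Params

/-- Both pairs of coordinates have the same sum, and a sum of two quotients is the quotient of the
sum or one less. -/
theorem isPoly_cell (n k i : ℕ) {u : Node} (hu : u ∈ stencilNodes n) : IsPoly (cell n k i u) := by
  have h := coord_sums hu
  have hs := side_pos n k i
  have key : ∀ x y s : ℕ, 0 < s → x / s + y / s ≤ (x + y) / s ∧ (x + y) / s ≤ x / s + y / s + 1 := by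
    intro x y s hs
    rw [Nat.add_div hs]
    split_ifs <;> omega
  have h1 := key (cx n u) (cy n u) _ hs
  have h2 := key (cz n u) (ct n u) _ hs
  rw [h.1] at h1
  rw [h.2] at h2
  simp only [IsPoly, cell_eq]
  omega

theorem isOct_of_side_eq_one {i : ℕ} (h1 : side n k i = 1) {u : Node} (hu : u ∈ stencilNodes n) :
    IsOct (cell n k i u) := by
  have h := coord_sums hu
  simp only [IsOct, cell_eq, h1, Nat.div_one]
  omega

/-- The kind of a polyhedron is thus determined by its stripe, so within a stripe all segments have
equal size. -/
theorem isOct_iff {c : Cell} (hc : IsPoly c) : IsOct c ↔ 2 ∣ cellSum c := by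
  simp only [IsOct, IsPoly, cellSum] at *
  omega

/-- No node lies in a tetrahedron of side 1, so the halving in `segSize` never yields 0 for an
inhabited polyhedron. -/
theorem segSize_pos (n k i : ℕ) {u : Node} (hu : u ∈ stencilNodes n) :
    0 < segSize n k i (cell n k i u) := by
  have hs := side_pos n k i
  rw [segSize]
  split_ifs with h
  · positivity
  · have : side n k i ≠ 1 := fun h1 => h (isOct_of_side_eq_one h1 hu)
    have h2 : 2 ≤ side n k i := by omega
    have : 2 * 2 ≤ side n k i * side n k i := Nat.mul_le_mul h2 h2
    rw [sq]; omega

/-- The factor 3 instead of 2 absorbs the rounding when the square is odd. -/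
theorem side_sq_le (n k i : ℕ) {u : Node} (hu : u ∈ stencilNodes n) :
    side n k i ^ 2 ≤ 3 * segSize n k i (cell n k i u) := by
  have := segSize_pos n k i hu
  rw [segSize] at *
  split_ifs at * <;> omega

theorem segSize_le (n k i : ℕ) (c : Cell) : segSize n k i c ≤ side n k i ^ 2 := by
  rw [segSize]
  split_ifs <;> omega

/-- All nodes of a polyhedron of side 1 are equal. -/
theorem eq_of_cell_eq_of_side_eq_one {i : ℕ} (h1 : side n k i = 1) {u v : Node}
    (hu : u ∈ stencilNodes n) (hv : v ∈ stencilNodes n) (h : cell n k i u = cell n k i v) :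
    u = v := by
  simp only [cell_eq, h1, Nat.div_one, Prod.mk.injEq] at h
  rw [mem_stencilNodes] at hu hv
  simp only [cx, cy, cz, ct] at h
  exact Prod.ext (by omega) (Prod.ext (by omega) (by omega))

theorem mul_add_inj {M a b a' b' : ℕ} (hb : b < M) (hb' : b' < M)
    (h : a * M + b = a' * M + b') : a = a' ∧ b = b' := by
  have h1 : a = a' := by
    have e1 : (a * M + b) / M = a := by
      rw [mul_comm, Nat.mul_add_div (by omega), Nat.div_eq_of_lt hb, add_zero]
    have e2 : (a' * M + b') / M = a' := by
      rw [mul_comm, Nat.mul_add_div (by omega), Nat.div_eq_of_lt hb', add_zero]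
    rw [← e1, h, e2]
  subst h1
  exact ⟨rfl, by omega⟩

theorem cellKey_injective (n k i : ℕ) {u v : Node} (hu : u ∈ stencilNodes n)
    (hv : v ∈ stencilNodes n) (h : cellKey n (cell n k i u) = cellKey n (cell n k i v)) :
    cell n k i u = cell n k i v := by
  have key : ∀ {w : Node}, w ∈ stencilNodes n → (cell n k i w).2.1 < 4 * n ∧
      (cell n k i w).2.2.1 < 4 * n ∧ (cell n k i w).2.2.2 < 4 * n := by
    intro w hw
    have := coord_lt hw
    simp only [cell_eq]
    exact ⟨(Nat.div_le_self _ _).trans_lt this.2.1, (Nat.div_le_self _ _).trans_lt this.2.2.1,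
      (Nat.div_le_self _ _).trans_lt this.2.2.2⟩
  obtain ⟨a1, a2, a3⟩ := key hu
  obtain ⟨b1, b2, b3⟩ := key hv
  rw [cellKey, cellKey] at h
  obtain ⟨h, h4⟩ := mul_add_inj a3 b3 h
  obtain ⟨h, h3⟩ := mul_add_inj a2 b2 h
  obtain ⟨h1, h2⟩ := mul_add_inj a1 b1 h
  exact Prod.ext h1 (Prod.ext h2 (Prod.ext h3 h4))

theorem nodeKey_injOn (n : ℕ) : Set.InjOn (nodeKey n) (stencilNodes n : Set Node) := by
  intro u hu v hv h
  have hu' := mem_stencilNodes.1 (Finset.mem_coe.1 hu)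
  have hv' := mem_stencilNodes.1 (Finset.mem_coe.1 hv)
  rw [nodeKey, nodeKey] at h
  obtain ⟨h, h1⟩ := mul_add_inj hu'.1 hv'.1 h
  obtain ⟨h3, h2⟩ := mul_add_inj hu'.2.1 hv'.2.1 h
  exact Prod.ext h1 (Prod.ext h2 h3)

theorem rank_lt_card {α : Type} (f : α → ℕ) {X : Finset α} {a : α} (ha : a ∈ X) :
    rank f X a < X.card := by
  refine Finset.card_lt_card ⟨Finset.filter_subset _ _, fun h => ?_⟩
  exact lt_irrefl _ (Finset.mem_filter.1 (h ha)).2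

theorem rank_lt_rank {α : Type} {f : α → ℕ} {X : Finset α} {a b : α} (ha : a ∈ X)
    (h : f a < f b) : rank f X a < rank f X b := by
  refine Finset.card_lt_card ⟨fun c hc => ?_, fun h' => ?_⟩
  · obtain ⟨h1, h2⟩ := Finset.mem_filter.1 hc
    exact Finset.mem_filter.2 ⟨h1, h2.trans h⟩
  · exact lt_irrefl _ (Finset.mem_filter.1 (h' (Finset.mem_filter.2 ⟨ha, h⟩))).2

theorem key_eq_of_rank_eq {α : Type} {f : α → ℕ} {X : Finset α} {a b : α} (ha : a ∈ X)
    (hb : b ∈ X) (h : rank f X a = rank f X b) : f a = f b := by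
  rcases lt_trichotomy (f a) (f b) with h1 | h1 | h1
  · exact absurd h (rank_lt_rank ha h1).ne
  · exact h1
  · exact absurd h (rank_lt_rank hb h1).ne'

/-! ### Polyhedra of one stripe -/

theorem Params.cell_mem_siblings (hP : Params n k L e) (i : ℕ) {u : Node}
    (hu : u ∈ stencilNodes n) : cell n k (i + 1) u ∈ siblings n k i u := by
  obtain ⟨h1, h2, h3, h4⟩ := hP.cell_succ_div i u
  have hκ := hP.fan_pos i
  have key : ∀ a b : ℕ, a / fan n k i = b →
      a ∈ Finset.Ico (fan n k i * b) (fan n k i * b + fan n k i) := by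
    rintro a b rfl
    have d1 := Nat.div_add_mod a (fan n k i)
    have e1 := Nat.mod_lt a hκ
    rw [Finset.mem_Ico]
    omega
  simp only [siblings, Finset.mem_filter, Finset.mem_product]
  exact ⟨⟨key _ _ h1, key _ _ h2, key _ _ h3, key _ _ h4⟩, isPoly_cell n k _ hu, trivial⟩

theorem Params.siblings_congr (hP : Params n k L e) {i : ℕ} {u v : Node}
    (h : cell n k i u = cell n k i v) (h' : stripe n k i u = stripe n k i v) :
    siblings n k i u = siblings n k i v := by
  have h1 := (hP.cellSum_succ i u).1
  have h2 := (hP.cellSum_succ i v).1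
  simp only [siblings, h, h1, h2, h']

/-- The part `a ∈ [κ A, κ A + κ)` of the decompositions `P = a + b` with `b ∈ [κ B, κ B + κ)`. -/
def splits (κ A B P : ℕ) : Finset ℕ :=
  (Finset.Ico (κ * A) (κ * A + κ)).filter fun a => κ * B + a ≤ P ∧ P < κ * B + κ + a

/-- As a function of `P`, the number of splittings has a triangular profile: it is bounded by a
plateau, a rising and a falling flank. -/
theorem card_splits_le (κ A B P : ℕ) : (splits κ A B P).card ≤ κ ∧
    (splits κ A B P).card ≤ P + 1 - κ * (A + B) ∧
    (splits κ A B P).card ≤ κ * (A + B) + 2 * κ - 1 - P := by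
  refine ⟨?_, ?_, ?_⟩
  · exact (Finset.card_filter_le _ _).trans (by simp)
  · have : splits κ A B P ⊆ Finset.Ico (κ * A) (P + 1 - κ * B) := by
      intro a ha
      simp only [splits, Finset.mem_filter, Finset.mem_Ico] at ha ⊢
      omega
    refine (Finset.card_le_card this).trans ?_
    rw [Nat.card_Ico, mul_add]; omega
  · have : splits κ A B P ⊆ Finset.Ico (max (κ * A) (P + 1 - κ * B - κ)) (κ * A + κ) := by
      intro a ha
      simp only [splits, Finset.mem_filter, Finset.mem_Ico] at ha ⊢
      omega
    rcases (splits κ A B P).eq_empty_or_nonempty with h | ⟨a, ha⟩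
    · simp [h]
    refine (Finset.card_le_card this).trans ?_
    simp only [splits, Finset.mem_filter, Finset.mem_Ico] at ha
    rw [Nat.card_Ico, mul_add]; omega

theorem card_le_card_splits_mul (κ : ℕ) (d : Cell) (P Q : ℕ) (T : Finset Cell)
    (hT : ∀ c ∈ T, (c.1 ∈ Finset.Ico (κ * d.1) (κ * d.1 + κ) ∧
      c.2.1 ∈ Finset.Ico (κ * d.2.1) (κ * d.2.1 + κ) ∧
      c.2.2.1 ∈ Finset.Ico (κ * d.2.2.1) (κ * d.2.2.1 + κ) ∧
      c.2.2.2 ∈ Finset.Ico (κ * d.2.2.2) (κ * d.2.2.2 + κ)) ∧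
      c.1 + c.2.1 = P ∧ c.2.2.1 + c.2.2.2 = Q) :
    T.card ≤ (splits κ d.1 d.2.1 P).card * (splits κ d.2.2.1 d.2.2.2 Q).card := by
  rw [← Finset.card_product]
  refine Finset.card_le_card_of_injOn (fun c => (c.1, c.2.2.1)) ?_ ?_
  · intro c hc
    have := hT c (Finset.mem_coe.1 hc)
    simp only [Finset.mem_Ico] at this
    simp only [Finset.coe_product, Set.mem_prod, Finset.mem_coe, splits, Finset.mem_filter,
      Finset.mem_Ico]
    omega
  · intro c hc c' hc' h
    have h1 := (hT c (Finset.mem_coe.1 hc)).2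
    have h2 := (hT c' (Finset.mem_coe.1 hc')).2
    simp only [Prod.mk.injEq] at h
    exact Prod.ext h.1 (Prod.ext (by omega) (Prod.ext h.2 (by omega)))

theorem four_mul_le_sq {a b s : ℕ} (h : 0 < a → 0 < b → a + b ≤ s) : 4 * (a * b) ≤ s * s := by
  rcases Nat.eq_zero_or_pos a with rfl | ha
  · simp
  rcases Nat.eq_zero_or_pos b with rfl | hb
  · simp
  have h := Nat.mul_le_mul (h ha hb) (h ha hb)
  zify at h ⊢
  nlinarith [sq_nonneg ((a : ℤ) - b)]

/-- The number of polyhedra in a stripe; the four bounds concern stripes of octahedra or tetrahedra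
in octahedra or tetrahedra. -/
theorem card_siblings_le (i : ℕ) (u : Node) (hd : IsPoly (cell n k i u))
    (hκ2 : 2 ≤ fan n k i) :
    (2 ∣ cellSum (cell n k (i + 1) u) →
      (siblings n k i u).card ≤ fan n k i * fan n k i ∧
      (¬ IsOct (cell n k i u) → 4 * (siblings n k i u).card ≤ fan n k i * fan n k i)) ∧
    (¬ 2 ∣ cellSum (cell n k (i + 1) u) →
      (siblings n k i u).card ≤ 2 * (fan n k i * fan n k i) ∧
      (¬ IsOct (cell n k i u) → (siblings n k i u).card ≤ fan n k i * fan n k i)) := by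
  have hbox : ∀ c ∈ siblings n k i u,
      (c.1 ∈ Finset.Ico (fan n k i * (cell n k i u).1) (fan n k i * (cell n k i u).1 + fan n k i) ∧
      c.2.1 ∈ Finset.Ico (fan n k i * (cell n k i u).2.1)
        (fan n k i * (cell n k i u).2.1 + fan n k i) ∧
      c.2.2.1 ∈ Finset.Ico (fan n k i * (cell n k i u).2.2.1)
        (fan n k i * (cell n k i u).2.2.1 + fan n k i) ∧
      c.2.2.2 ∈ Finset.Ico (fan n k i * (cell n k i u).2.2.2)
        (fan n k i * (cell n k i u).2.2.2 + fan n k i)) ∧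
      IsPoly c ∧ cellSum c = cellSum (cell n k (i + 1) u) := by
    intro c hc
    simpa only [siblings, Finset.mem_filter, Finset.mem_product] using hc
  generalize cellSum (cell n k (i + 1) u) = S at *
  generalize siblings n k i u = T at *
  generalize fan n k i = κ at *
  generalize cell n k i u = d at *
  have hκA : ∀ x y : ℕ, x = y + 1 → κ * x = κ * y + κ := by rintro x y rfl; ring
  simp only [IsPoly, cellSum, IsOct] at *
  constructor
  · rintro ⟨P, rfl⟩
    have h1 := card_le_card_splits_mul κ d P P T fun c hc => by
      have := (hbox c hc).2
      exact ⟨(hbox c hc).1, by omega, by omega⟩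
    obtain ⟨a1, a2, a3⟩ := card_splits_le κ d.1 d.2.1 P
    obtain ⟨b1, b2, b3⟩ := card_splits_le κ d.2.2.1 d.2.2.2 P
    refine ⟨h1.trans (Nat.mul_le_mul a1 b1), fun hne => ?_⟩
    refine (Nat.mul_le_mul_left 4 h1).trans (four_mul_le_sq fun ha hb => ?_)
    -- For a tetrahedral parent the two pair sums differ by one. The rising flank of one profile
    -- then meets the falling flank of the other, and the two counts add up to at most κ.
    rcases Nat.lt_or_gt_of_ne hne with h | h
    · have := hκA (d.2.2.1 + d.2.2.2) (d.1 + d.2.1) (by omega)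
      omega
    · have := hκA (d.1 + d.2.1) (d.2.2.1 + d.2.2.2) (by omega)
      omega
  · intro hodd
    obtain ⟨P, rfl⟩ : ∃ P, S = 2 * P + 1 := ⟨S / 2, by omega⟩
    have hsplit := Finset.card_filter_add_card_filter_not (s := T) (fun c : Cell => c.1 + c.2.1 = P)
    have h1 := card_le_card_splits_mul κ d P (P + 1) (T.filter fun c : Cell => c.1 + c.2.1 = P)
      fun c hc => by
        obtain ⟨hc, hcP⟩ := Finset.mem_filter.1 hc
        have := (hbox c hc).2
        exact ⟨(hbox c hc).1, by omega, by omega⟩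
    have h2 := card_le_card_splits_mul κ d (P + 1) P (T.filter fun c : Cell => ¬ c.1 + c.2.1 = P)
      fun c hc => by
        obtain ⟨hc, hcP⟩ := Finset.mem_filter.1 hc
        have := (hbox c hc).2
        exact ⟨(hbox c hc).1, by omega, by omega⟩
    obtain ⟨a1, a2, a3⟩ := card_splits_le κ d.1 d.2.1 P
    obtain ⟨b1, b2, b3⟩ := card_splits_le κ d.2.2.1 d.2.2.2 P
    obtain ⟨a1', a2', a3'⟩ := card_splits_le κ d.1 d.2.1 (P + 1)
    obtain ⟨b1', b2', b3'⟩ := card_splits_le κ d.2.2.1 d.2.2.2 (P + 1)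
    refine ⟨?_, fun hne => ?_⟩
    · have := Nat.mul_le_mul a1 b1'
      have := Nat.mul_le_mul a1' b1
      omega
    -- The targets `P` and `P + 1` shift the flanks by one, hence κ + 1; since κ ≥ 2, (κ + 1)² ≤ 2κ²
    -- + 1, and integrality removes the 1.
    · have hq : ∀ x y : ℕ, (0 < x → 0 < y → x + y ≤ κ + 1) → 2 * (x * y) ≤ κ * κ := by
        intro x y h
        have h4 := four_mul_le_sq h
        have : (κ + 1) * (κ + 1) ≤ 2 * (κ * κ) + 1 := by nlinarith
        omega
      have e1 : 2 * ((splits κ d.1 d.2.1 P).card * (splits κ d.2.2.1 d.2.2.2 (P + 1)).card) ≤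
          κ * κ := by
        refine hq _ _ fun ha hb => ?_
        rcases Nat.lt_or_gt_of_ne hne with h | h
        · have := hκA (d.2.2.1 + d.2.2.2) (d.1 + d.2.1) (by omega)
          omega
        · have := hκA (d.1 + d.2.1) (d.2.2.1 + d.2.2.2) (by omega)
          omega
      have e2 : 2 * ((splits κ d.1 d.2.1 (P + 1)).card * (splits κ d.2.2.1 d.2.2.2 P).card) ≤
          κ * κ := by
        refine hq _ _ fun ha hb => ?_
        rcases Nat.lt_or_gt_of_ne hne with h | h
        · have := hκA (d.2.2.1 + d.2.2.2) (d.1 + d.2.1) (by omega)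
          omega
        · have := hκA (d.1 + d.2.1) (d.2.2.1 + d.2.2.2) (by omega)
          omega
      omega

namespace Params

theorem two_le_fan (hP : Params n k L e) {i : ℕ} (hi : i < depth n k) : 2 ≤ fan n k i :=
  Nat.le_of_dvd (hP.fan_pos i) (hP.two_dvd_fan hi)

/-- The segments of the polyhedra of a stripe fit into the segment of their parent. -/
theorem card_siblings_mul_segSize_le (hP : Params n k L e) {i : ℕ} (hi : i < depth n k) {u : Node}
    (hu : u ∈ stencilNodes n) :
    (siblings n k i u).card * segSize n k (i + 1) (cell n k (i + 1) u) ≤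
      segSize n k i (cell n k i u) := by
  obtain ⟨he, ho⟩ := card_siblings_le i u (isPoly_cell n k i hu) (hP.two_le_fan hi)
  have hoct := isOct_iff (isPoly_cell n k (i + 1) hu)
  have hside : side n k i ^ 2 = fan n k i * fan n k i * side n k (i + 1) ^ 2 := by
    rw [hP.side_eq_mul]; ring
  rw [← hoct] at he ho
  rw [segSize, segSize, hside]
  set c := (siblings n k i u).card
  set K := fan n k i * fan n k i
  set s := side n k (i + 1) ^ 2
  have hs2 : 2 * (s / 2) ≤ s := Nat.mul_div_le _ _
  by_cases h1 : IsOct (cell n k (i + 1) u) <;> by_cases h2 : IsOct (cell n k i u)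
  · simp only [h1, h2, if_true]
    exact Nat.mul_le_mul_right _ (he h1).1
  · simp only [h1, h2, if_true, if_false]
    rw [Nat.le_div_iff_mul_le (by norm_num)]
    have := (he h1).2 h2
    calc c * s * 2 ≤ 4 * c * s := by linarith [Nat.zero_le (c * s)]
      _ ≤ K * s := Nat.mul_le_mul_right _ this
  · simp only [h1, h2, if_true, if_false]
    have := (ho h1).1
    calc c * (s / 2) ≤ 2 * K * (s / 2) := Nat.mul_le_mul_right _ this
      _ = K * (2 * (s / 2)) := by ring
      _ ≤ K * s := Nat.mul_le_mul_left _ hs2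
  · simp only [h1, h2, if_false]
    rw [Nat.le_div_iff_mul_le (by norm_num)]
    have := (ho h1).2 h2
    calc c * (s / 2) * 2 = c * (2 * (s / 2)) := by ring
      _ ≤ K * s := Nat.mul_le_mul this hs2

/-! ### Segments of virtual processors -/

theorem base_congr (hP : Params n k L e) {i : ℕ} : ∀ {u v : Node},
    cell n k i u = cell n k i v → base n k i u = base n k i v := by
  induction i with
  | zero => intro u v _; rfl
  | succ i ih =>
    intro u v h
    have hc := hP.cell_congr_succ h
    have hst : stripe n k i u = stripe n k i v := by rw [stripe, stripe, h, hc]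
    rw [base, base, ih hc, hP.siblings_congr hc hst, h]

theorem base_succ_add_segSize_le (hP : Params n k L e) {i : ℕ} (hi : i < depth n k) {u : Node}
    (hu : u ∈ stencilNodes n) :
    base n k (i + 1) u + segSize n k (i + 1) (cell n k (i + 1) u) ≤
      base n k i u + segSize n k i (cell n k i u) := by
  have h1 := hP.card_siblings_mul_segSize_le hi hu
  have h2 := rank_lt_card (cellKey n) (hP.cell_mem_siblings i hu)
  have h3 := Nat.mul_le_mul_right (segSize n k (i + 1) (cell n k (i + 1) u)) h2
  rw [Nat.succ_mul] at h3
  rw [base]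
  omega

theorem base_le_base_succ (n k i : ℕ) (u : Node) : base n k i u ≤ base n k (i + 1) u := by
  rw [base]; omega

theorem base_add_segSize_le (hP : Params n k L e) {i : ℕ} (hi : i ≤ depth n k) {u : Node}
    (hu : u ∈ stencilNodes n) : base n k i u + segSize n k i (cell n k i u) ≤ n ^ 2 := by
  induction i with
  | zero =>
    rw [base, zero_add]
    exact (segSize_le _ _ _ _).trans (by rw [hP.side_zero])
  | succ i ih => exact (hP.base_succ_add_segSize_le hi hu).trans (ih (by omega))

/-- Alignment propagates from the parent: its segment size is a multiple of the child's, and the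
child is offset by a multiple of its own size. Alignment is what makes the labels of the supersteps
admissible. -/
theorem segSize_dvd_base (hP : Params n k L e) {i : ℕ} (hi : i ≤ depth n k) {u : Node}
    (hu : u ∈ stencilNodes n) : segSize n k i (cell n k i u) ∣ base n k i u := by
  induction i with
  | zero => exact dvd_zero _
  | succ i ih =>
    have h1 := ih (by omega)
    obtain ⟨f, hf⟩ := hP.two_dvd_fan hi
    obtain ⟨t, ht⟩ := hP.two_dvd_side hi
    rw [base]
    refine dvd_add (dvd_trans ?_ h1) (Dvd.intro_left _ rfl)
    have hside : side n k i ^ 2 = 2 * (2 * (f * f) * side n k (i + 1) ^ 2) := by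
      rw [hP.side_eq_mul, hf]; ring
    have hfull : side n k (i + 1) ^ 2 ∣ segSize n k i (cell n k i u) := by
      rw [segSize, hside]
      split_ifs
      · exact ⟨2 * (2 * (f * f)), by ring⟩
      · rw [Nat.mul_div_cancel_left _ (by norm_num)]
        exact Dvd.intro_left _ rfl
    rcases Nat.lt_or_ge (i + 1) (depth n k) with hlt | hge
    · refine dvd_trans ?_ hfull
      obtain ⟨t', ht'⟩ := hP.two_dvd_side hlt
      rw [segSize]
      split_ifs
      · exact dvd_rfl
      · exact Nat.div_dvd_of_dvd ⟨t' * (2 * t'), by rw [ht']; ring⟩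
    · have hD : i + 1 = depth n k := by omega
      have h1 : side n k (i + 1) = 1 := hD ▸ hP.side_depth
      rw [segSize, if_pos (isOct_of_side_eq_one h1 hu)]
      exact hfull

/-- A segment of a polyhedron of side `s` lies in one of the aligned blocks of `s ^ 2` VPs. -/
theorem div_side_sq_eq (hP : Params n k L e) {i : ℕ} (hi : i < depth n k) {u : Node}
    (hu : u ∈ stencilNodes n) {r : ℕ} (h1 : base n k i u ≤ r)
    (h2 : r < base n k i u + segSize n k i (cell n k i u)) :
    r / side n k i ^ 2 = base n k i u / side n k i ^ 2 := by
  obtain ⟨b, hb⟩ := hP.segSize_dvd_base hi.le hu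
  have hpos := segSize_pos n k i hu
  obtain ⟨c, hc⟩ : segSize n k i (cell n k i u) ∣ side n k i ^ 2 := by
    obtain ⟨t, ht⟩ := hP.two_dvd_side hi
    rw [segSize]
    split_ifs
    · exact dvd_rfl
    · exact Nat.div_dvd_of_dvd ⟨t * (2 * t), by rw [ht]; ring⟩
  rw [hc, ← Nat.div_div_eq_div_mul, ← Nat.div_div_eq_div_mul, hb,
    Nat.mul_div_cancel_left _ hpos]
  congr 1
  rw [Nat.div_eq_iff hpos]
  rw [hb] at h1 h2
  rw [mul_comm b]
  omega

theorem base_le_base (n k : ℕ) (u : Node) {i j : ℕ} (hij : i ≤ j) :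
    base n k i u ≤ base n k j u := by
  induction j, hij using Nat.le_induction with
  | base => rfl
  | succ j _ ih => exact ih.trans (base_le_base_succ n k j u)

theorem path_succ (n k i : ℕ) (u : Node) : path n k (i + 1) u = path n k i u ++ [stripe n k i u] := by
  simp [path, List.range_succ]

theorem length_path (n k i : ℕ) (u : Node) : (path n k i u).length = i := by simp [path]

/-- Polyhedra that are evaluated at the same time have disjoint segments. -/
theorem cell_eq_of_mem_segment (hP : Params n k L e) {i : ℕ} (hi : i ≤ depth n k) {u v : Node}
    (hu : u ∈ stencilNodes n) (hv : v ∈ stencilNodes n) (h0 : cell n k 0 u = cell n k 0 v)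
    (hp : path n k i u = path n k i v) {r : ℕ} (hu1 : base n k i u ≤ r)
    (hu2 : r < base n k i u + segSize n k i (cell n k i u)) (hv1 : base n k i v ≤ r)
    (hv2 : r < base n k i v + segSize n k i (cell n k i v)) : cell n k i u = cell n k i v := by
  induction i with
  | zero => exact h0
  | succ i ih =>
    rw [path_succ, path_succ] at hp
    obtain ⟨hp, hst⟩ := List.append_inj' hp rfl
    simp only [List.cons.injEq, and_true] at hst
    -- Segments are nested, so `r` also lies in the segments of both parents, and these coincide by
    -- induction.
    have hc := ih (by omega) hp ((base_le_base_succ n k i u).trans hu1)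
      (hu2.trans_le (hP.base_succ_add_segSize_le hi hu)) ((base_le_base_succ n k i v).trans hv1)
      (hv2.trans_le (hP.base_succ_add_segSize_le hi hv))
    have hsib := hP.siblings_congr hc hst
    have hsum : cellSum (cell n k (i + 1) u) = cellSum (cell n k (i + 1) v) := by
      rw [(hP.cellSum_succ i u).1, (hP.cellSum_succ i v).1, hc, hst]
    have hseg : segSize n k (i + 1) (cell n k (i + 1) u) =
        segSize n k (i + 1) (cell n k (i + 1) v) := by
      simp only [segSize, isOct_iff (isPoly_cell n k (i + 1) hu),
        isOct_iff (isPoly_cell n k (i + 1) hv), hsum]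
    have hmu := hP.cell_mem_siblings i hu
    have hmv := hP.cell_mem_siblings i hv
    rw [base, hP.base_congr hc, hsib, hseg] at hu1 hu2
    rw [base] at hv1 hv2
    rw [hsib] at hmu
    refine cellKey_injective n k (i + 1) hu hv (key_eq_of_rank_eq hmu hmv ?_)
    set B := base n k i v
    set w := segSize n k (i + 1) (cell n k (i + 1) v)
    set a := rank (cellKey n) (siblings n k i v) (cell n k (i + 1) u)
    set b := rank (cellKey n) (siblings n k i v) (cell n k (i + 1) v)
    rcases lt_trichotomy a b with h | h | h
    · have := Nat.mul_le_mul_right w h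
      rw [Nat.succ_mul] at this
      omega
    · exact h
    · have := Nat.mul_le_mul_right w h
      rw [Nat.succ_mul] at this
      omega

end Params

end OctTet

end NetObl

namespace NetObl

namespace OctTet

/-! ### The schedule -/

theorem append_cons_lt_append_cons (P : List ℕ) {a b : ℕ} (h : a < b) (x y : List ℕ) :
    P ++ a :: x < P ++ b :: y :=
  List.append_left_lt (List.cons_lt_cons_iff.2 (Or.inl h))

theorem lt_append_cons (P : List ℕ) (a : ℕ) (x : List ℕ) : P < P ++ a :: x := by
  conv_lhs => rw [← List.append_nil P]
  exact List.append_left_lt (List.nil_lt_cons _ _)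

theorem mem_phases_succ {n k m : ℕ} {ρ τ : List ℕ} : τ ∈ phases n k (m + 1) ρ ↔
    ∃ r < 4 * fan n k ρ.length - 2, τ = ρ ++ [r] ∨
      r < 4 * fan n k ρ.length - 3 ∧ τ ∈ phases n k m (ρ ++ [r]) := by
  simp only [phases, List.mem_flatMap, List.mem_range, List.mem_cons]
  refine exists_congr fun r => and_congr_right fun _ => or_congr_right ?_
  split_ifs with h <;> simp [h]

theorem exists_eq_append_of_mem_phases {n k m : ℕ} {ρ τ : List ℕ} (h : τ ∈ phases n k m ρ) :
    ∃ a x, τ = ρ ++ a :: x ∧ x.length < m := by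
  induction m generalizing ρ with
  | zero => simp [phases] at h
  | succ m ih =>
    obtain ⟨r, -, rfl | ⟨-, h⟩⟩ := mem_phases_succ.1 h
    · exact ⟨r, [], rfl, by simp⟩
    · obtain ⟨a, x, rfl, hx⟩ := ih h
      exact ⟨r, a :: x, by simp, by simp; omega⟩

/-- Execution order is the lexicographic order of the index lists, prefixes first. Strictness makes
`idxOf` monotone, so every later question about timing becomes a comparison of lists. -/
theorem pairwise_phases (n k m : ℕ) (ρ : List ℕ) : (phases n k m ρ).Pairwise (· < ·) := by
  induction m generalizing ρ with
  | zero => simp [phases]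
  | succ m ih =>
    have hblock : ∀ r τ, τ ∈ ((ρ ++ [r]) ::
        (if r < 4 * fan n k ρ.length - 3 then phases n k m (ρ ++ [r]) else [])) →
        ∃ x, τ = ρ ++ r :: x := by
      intro r τ h
      rcases List.mem_cons.1 h with rfl | h
      · exact ⟨[], rfl⟩
      · split_ifs at h
        · obtain ⟨a, x, rfl, -⟩ := exists_eq_append_of_mem_phases h
          exact ⟨a :: x, by simp⟩
        · simp at h
    rw [phases, List.pairwise_flatMap]
    refine ⟨fun r _ => ?_, ?_⟩
    · rw [List.pairwise_cons]
      split_ifs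
      · refine ⟨fun τ hτ => ?_, ih _⟩
        obtain ⟨a, x, rfl, -⟩ := exists_eq_append_of_mem_phases hτ
        exact lt_append_cons _ _ _
      · simp
    · refine List.pairwise_lt_range.imp fun {r r'} hr x hx y hy => ?_
      obtain ⟨x, rfl⟩ := hblock _ _ hx
      obtain ⟨y, rfl⟩ := hblock _ _ hy
      exact append_cons_lt_append_cons _ hr _ _

/-- The order in which supersteps are executed. -/
def Precedes (a b : Cell × List ℕ) : Prop :=
  stages.idxOf a.1 < stages.idxOf b.1 ∨ a.1 = b.1 ∧ a.2 < b.2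

theorem precedes_asymm {a b : Cell × List ℕ} (h : Precedes a b) : ¬ Precedes b a := by
  rintro (h' | ⟨h1, h2⟩) <;> rcases h with h | ⟨h3, h4⟩
  · omega
  · rw [h3] at h'; omega
  · rw [h1] at h; omega
  · exact lt_asymm h2 h4

theorem pairwise_schedule (n k : ℕ) : (schedule n k).Pairwise Precedes := by
  rw [schedule, List.pairwise_flatMap]
  refine ⟨fun g _ => ?_, ?_⟩
  · rw [List.pairwise_map, List.pairwise_cons]
    refine ⟨fun τ hτ => ?_, (pairwise_phases n k _ _).imp fun h => Or.inr ⟨rfl, h⟩⟩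
    obtain ⟨a, x, rfl, -⟩ := exists_eq_append_of_mem_phases hτ
    exact Or.inr ⟨rfl, List.nil_lt_cons _ _⟩
  · have hst : stages.Pairwise fun a b => stages.idxOf a < stages.idxOf b := by decide
    refine hst.imp fun {g g'} h x hx y hy => ?_
    obtain ⟨x, -, rfl⟩ := List.mem_map.1 hx
    obtain ⟨y, -, rfl⟩ := List.mem_map.1 hy
    exact Or.inl h

theorem idxOf_lt_idxOf {n k : ℕ} {a b : Cell × List ℕ} (ha : a ∈ schedule n k)
    (hb : b ∈ schedule n k) (h : Precedes a b) :
    (schedule n k).idxOf a < (schedule n k).idxOf b := by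
  have hp := List.pairwise_iff_getElem.1 (pairwise_schedule n k)
  have ha' := List.idxOf_lt_length_of_mem ha
  have hb' := List.idxOf_lt_length_of_mem hb
  rcases lt_trichotomy ((schedule n k).idxOf a) ((schedule n k).idxOf b) with h1 | h1 | h1
  · exact h1
  · have e1 := List.getElem_idxOf ha'
    have e2 := List.getElem_idxOf hb'
    simp only [h1] at e1
    rw [← e1, e2] at h
    exact absurd h (precedes_asymm h)
  · have := hp _ _ hb' ha' h1
    rw [List.getElem_idxOf, List.getElem_idxOf] at this
    exact absurd h (precedes_asymm this)

theorem nodup_schedule (n k : ℕ) : (schedule n k).Nodup :=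
  (pairwise_schedule n k).imp fun h heq => by
    rw [heq] at h; exact precedes_asymm h h

theorem mem_schedule {n k : ℕ} {a : Cell × List ℕ} : a ∈ schedule n k ↔
    a.1 ∈ stages ∧ (a.2 = [] ∨ a.2 ∈ phases n k (depth n k) []) := by
  obtain ⟨g, ρ⟩ := a
  simp only [schedule, List.mem_flatMap, List.mem_map, List.mem_cons, Prod.mk.injEq]
  constructor
  · rintro ⟨g, hg, ρ, hρ, rfl, rfl⟩
    exact ⟨hg, hρ⟩
  · rintro ⟨hg, hρ⟩
    exact ⟨g, hg, ρ, hρ, rfl, rfl⟩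

theorem length_le_depth {n k : ℕ} {a : Cell × List ℕ} (h : a ∈ schedule n k) :
    a.2.length ≤ depth n k := by
  rcases (mem_schedule.1 h).2 with h | h
  · simp [h]
  · obtain ⟨a, x, h1, h2⟩ := exists_eq_append_of_mem_phases h
    rw [h1]; simpa using h2

theorem cell_zero_mem_stages {n k L e : ℕ} (hP : Params n k L e) {u : Node}
    (hu : u ∈ stencilNodes n) : cell n k 0 u ∈ stages := by
  have hn := hP.pos
  have hpoly := isPoly_cell n k 0 hu
  rw [cell_eq, hP.side_zero] at *
  rw [mem_stencilNodes] at hu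
  have key : ∀ a < n, ((3 * n / 2 + u.2.2 + a) / n, (3 * n / 2 + u.2.2 - a) / n) ∈
      ([(1, 1), (2, 0), (2, 1), (2, 2), (3, 1)] : List (ℕ × ℕ)) := by
    intro a ha
    have h1 := Nat.div_add_mod (3 * n / 2 + u.2.2 + a) n
    have h2 := Nat.mod_lt (3 * n / 2 + u.2.2 + a) hn
    have h3 := Nat.div_add_mod (3 * n / 2 + u.2.2 - a) n
    have h4 := Nat.mod_lt (3 * n / 2 + u.2.2 - a) hn
    generalize (3 * n / 2 + u.2.2 + a) / n = A at *
    generalize (3 * n / 2 + u.2.2 - a) / n = B at *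
    have hA : A < 4 := by
      by_contra! h
      have := Nat.mul_le_mul_left n h
      omega
    have hB : B < 4 := by
      by_contra! h
      have := Nat.mul_le_mul_left n h
      omega
    interval_cases A <;> interval_cases B <;> first | decide | (exfalso; omega)
  have hx := key _ hu.1
  have hz := key _ hu.2.1
  have hfin : ∀ p ∈ ([(1, 1), (2, 0), (2, 1), (2, 2), (3, 1)] : List (ℕ × ℕ)),
      ∀ q ∈ ([(1, 1), (2, 0), (2, 1), (2, 2), (3, 1)] : List (ℕ × ℕ)),
      IsPoly (p.1, p.2, q.1, q.2) → (p.1, p.2, q.1, q.2) ∈ stages := by decide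
  exact hfin _ hx _ hz hpoly

theorem stages_idxOf_lt : ∀ a ∈ stages, ∀ b ∈ stages, cellSum a < cellSum b →
    stages.idxOf a < stages.idxOf b := by decide

section

variable {n k L e : ℕ} (hP : Params n k L e)
include hP

/-- This is the superstep that starts the phase of the polyhedron of level `j + i + 1` containing
`u`. -/
theorem Params.path_mem_phases (u : Node) (m j i : ℕ) (hi : i < m) :
    path n k (j + i + 1) u ∈ phases n k m (path n k j u) := by
  induction m generalizing i j with
  | zero => omega
  | succ m ih =>
    have hst := (hP.cellSum_succ j u).2
    refine mem_phases_succ.2 ⟨stripe n k j u, by rw [length_path]; omega, ?_⟩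
    rcases i with _ | i
    · exact Or.inl (path_succ n k j u)
    · refine Or.inr ⟨by rw [length_path]; omega, ?_⟩
      rw [← path_succ]
      have := ih (j + 1) i (by omega)
      rwa [show j + 1 + i + 1 = j + (i + 1) + 1 by ring] at this

/-- This is the superstep that collects the results of the phase of `u`. Its last index can be 4
`fan` - 3, the one that only collects. -/
theorem Params.path_append_mem_phases (u : Node) (m j i : ℕ) (hi : i < m) :
    path n k (j + i) u ++ [stripe n k (j + i) u + 1] ∈ phases n k m (path n k j u) := by
  induction m generalizing i j with
  | zero => omega
  | succ m ih =>
    have hst := (hP.cellSum_succ j u).2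
    rcases i with _ | i
    · exact mem_phases_succ.2 ⟨stripe n k j u + 1, by rw [length_path]; omega, Or.inl rfl⟩
    · refine mem_phases_succ.2 ⟨stripe n k j u, by rw [length_path]; omega,
        Or.inr ⟨by rw [length_path]; omega, ?_⟩⟩
      rw [← path_succ]
      have := ih (j + 1) i (by omega)
      rwa [show j + 1 + i = j + (i + 1) by ring] at this

theorem Params.path_mem_schedule {u : Node} (hu : u ∈ stencilNodes n) {i : ℕ}
    (hi : i ≤ depth n k) : (cell n k 0 u, path n k i u) ∈ schedule n k := by
  refine mem_schedule.2 ⟨cell_zero_mem_stages hP hu, ?_⟩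
  rcases i with _ | i
  · exact Or.inl rfl
  · have := hP.path_mem_phases u (depth n k) 0 i hi
    rw [zero_add] at this
    exact Or.inr this

theorem Params.path_append_mem_schedule {u : Node} (hu : u ∈ stencilNodes n) {i : ℕ}
    (hi : i < depth n k) :
    (cell n k 0 u, path n k i u ++ [stripe n k i u + 1]) ∈ schedule n k := by
  refine mem_schedule.2 ⟨cell_zero_mem_stages hP hu, ?_⟩
  have := hP.path_append_mem_phases u (depth n k) 0 i hi
  rw [zero_add] at this
  exact Or.inr this

end

/-! ### Messages -/

theorem mem_deliver {n k : ℕ} {a : Cell × List ℕ} {m : Msg Node} : m ∈ deliver n k a ↔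
    ∃ u ∈ stencilNodes n, ∃ v ∈ stencilNodes n, Arc u v ∧ cell n k 0 v = a.1 ∧
      path n k a.2.length v = a.2 ∧ ¬ InBody n k a.2.length (cell n k a.2.length v) u ∧
      m = ⟨source n k a.2.length u v, inHolder n k a.2.length v u, some u⟩ := by
  simp only [deliver, Finset.mem_image, Finset.mem_filter, Finset.mem_product]
  constructor
  · rintro ⟨w, ⟨⟨hu, hv⟩, h1, h2, h3, h4⟩, rfl⟩
    exact ⟨w.1, hu, w.2, hv, h1, h2, h3, h4, rfl⟩
  · rintro ⟨u, hu, v, hv, h1, h2, h3, h4, rfl⟩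
    exact ⟨(u, v), ⟨⟨hu, hv⟩, h1, h2, h3, h4⟩, rfl⟩

theorem mem_outputs {n k i : ℕ} {u : Node} : u ∈ outputs n k i (cell n k i u) ↔
    u ∈ stencilNodes n ∧ 1 ≤ u.2.2 ∧ ∃ v ∈ stencilNodes n, Arc u v ∧ cell n k i v ≠ cell n k i u := by
  rw [outputs, Finset.mem_filter]
  simp only [InBody, and_true]

theorem mem_collect {n k : ℕ} {a : Cell × List ℕ} {m : Msg Node} : m ∈ collect n k a ↔
    ∃ i, ∃ u ∈ stencilNodes n, a = (cell n k 0 u, path n k i u ++ [stripe n k i u + 1]) ∧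
      u ∈ outputs n k i (cell n k i u) ∧
      m = ⟨outHolder n k (i + 1) u, outHolder n k i u, some u⟩ := by
  obtain ⟨g, ρ⟩ := a
  simp only [collect, Finset.mem_image, Finset.mem_filter, Prod.mk.injEq]
  constructor
  · rintro ⟨u, ⟨hu, h1, h2, h3⟩, rfl⟩
    exact ⟨ρ.length - 1, u, hu, ⟨h1.symm, h2.symm⟩, h3, rfl⟩
  · rintro ⟨i, u, hu, ⟨rfl, rfl⟩, h3, rfl⟩
    have : (path n k i u ++ [stripe n k i u + 1]).length - 1 = i := by
      simp [Params.length_path]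
    rw [this]
    exact ⟨u, ⟨hu, rfl, rfl, h3⟩, rfl⟩

theorem alg_msgs_idxOf {n k : ℕ} {a : Cell × List ℕ} (ha : a ∈ schedule n k) :
    (alg n k).msgs ((schedule n k).idxOf a) =
      (deliver n k a ∪ collect n k a).val + dummies n (labelOf n k a.2) := by
  have h := List.idxOf_lt_length_of_mem ha
  simp only [alg, List.getD_eq_getElem _ _ h, List.getElem_idxOf]

theorem alg_label_idxOf {n k : ℕ} {a : Cell × List ℕ} (ha : a ∈ schedule n k) :
    (alg n k).label ((schedule n k).idxOf a) = labelOf n k a.2 := by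
  have h := List.idxOf_lt_length_of_mem ha
  simp only [alg, List.getD_eq_getElem _ _ h, List.getElem_idxOf]

theorem exists_eq_idxOf {n k s : ℕ} (hs : s < (alg n k).len) :
    ∃ a ∈ schedule n k, s = (schedule n k).idxOf a := by
  have hs : s < (schedule n k).length := hs
  exact ⟨(schedule n k)[s], List.getElem_mem _, ((nodup_schedule n k).idxOf_getElem s hs).symm⟩

theorem inHolder_mem (n k i : ℕ) {v : Node} (hv : v ∈ stencilNodes n) (u : Node) :
    base n k i v ≤ inHolder n k i v u ∧
      inHolder n k i v u < base n k i v + segSize n k i (cell n k i v) := by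
  have := Nat.mod_lt (rank (nodeKey n) (inputs n k i (cell n k i v)) u) (segSize_pos n k i hv)
  rw [inHolder]; omega

theorem outHolder_mem (n k i : ℕ) {u : Node} (hu : u ∈ stencilNodes n) :
    base n k i u ≤ outHolder n k i u ∧
      outHolder n k i u < base n k i u + segSize n k i (cell n k i u) := by
  have := Nat.mod_lt (rank (nodeKey n) (outputs n k i (cell n k i u)) u) (segSize_pos n k i hu)
  rw [outHolder]; omega

theorem inputVP_lt {n : ℕ} {u : Node} (hu : u ∈ stencilNodes n) : inputVP n u < n ^ 2 := by
  rw [mem_stencilNodes] at hu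
  rw [inputVP]
  have := Nat.mul_le_mul_left n hu.2.1
  rw [Nat.mul_succ] at this
  rw [sq]; omega

/-- No coordinate decreases along an arc, hence no quotient does; if the polyhedron changes, one of
them grows. This is why evaluation by increasing `cellSum` is possible. -/
theorem cellSum_lt_of_arc {n k : ℕ} {u v : Node} (hu : u ∈ stencilNodes n) (huv : Arc u v) {i : ℕ}
    (hne : cell n k i u ≠ cell n k i v) : cellSum (cell n k i u) < cellSum (cell n k i v) := by
  rw [mem_stencilNodes] at hu
  obtain ⟨h1, h2, h3⟩ := huv
  have hx : cx n u / side n k i ≤ cx n v / side n k i :=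
    Nat.div_le_div_right (by simp only [cx]; omega)
  have hy : cy n u / side n k i ≤ cy n v / side n k i :=
    Nat.div_le_div_right (by simp only [cy]; omega)
  have hz : cz n u / side n k i ≤ cz n v / side n k i :=
    Nat.div_le_div_right (by simp only [cz]; omega)
  have ht : ct n u / side n k i ≤ ct n v / side n k i :=
    Nat.div_le_div_right (by simp only [ct]; omega)
  simp only [cell_eq, ne_eq, Prod.mk.injEq] at hne
  simp only [cell_eq, cellSum]
  omega

section

variable {n k L e : ℕ} (hP : Params n k L e)
include hP

theorem Params.segSize_depth {u : Node} (hu : u ∈ stencilNodes n) :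
    segSize n k (depth n k) (cell n k (depth n k) u) = 1 := by
  rw [segSize, if_pos (isOct_of_side_eq_one hP.side_depth hu), hP.side_depth, one_pow]

theorem Params.inHolder_depth {v : Node} (hv : v ∈ stencilNodes n) (u : Node) :
    inHolder n k (depth n k) v u = base n k (depth n k) v := by
  rw [inHolder, hP.segSize_depth hv, Nat.mod_one, add_zero]

theorem Params.outHolder_depth {u : Node} (hu : u ∈ stencilNodes n) :
    outHolder n k (depth n k) u = base n k (depth n k) u := by
  rw [outHolder, hP.segSize_depth hu, Nat.mod_one, add_zero]

/-- A value that leaves a polyhedron also leaves the smaller one inside it, so outputs can be handed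
up level by level. -/
theorem Params.outputs_succ {i : ℕ} {u : Node} (h : u ∈ outputs n k i (cell n k i u)) :
    u ∈ outputs n k (i + 1) (cell n k (i + 1) u) := by
  obtain ⟨h1, h2, v, hv, h3, h4⟩ := mem_outputs.1 h
  exact mem_outputs.2 ⟨h1, h2, v, hv, h3, fun h => h4 (hP.cell_congr_succ h)⟩

theorem Params.holder_lt {i r : ℕ} (hi : i ≤ depth n k) {u : Node} (hu : u ∈ stencilNodes n)
    (hr : r < base n k i u + segSize n k i (cell n k i u)) : r < n ^ 2 :=
  hr.trans_le (hP.base_add_segSize_le hi hu)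

/-! ### The algorithm is legal -/

theorem Params.labelOf_eq {ρ : List ℕ} (hρ : ρ.length ≤ depth n k) :
    labelOf n k ρ = 2 * (e * (ρ.length - 1)) := by
  have h : e * (ρ.length - 1) ≤ L := by
    rcases Nat.eq_zero_or_pos ρ.length with h0 | h0
    · simp [h0]
    · exact (hP.lt_depth_iff.1 (by omega)).le
  rw [labelOf, hP.side_eq]
  nth_rewrite 1 [hP.hn]
  rw [Nat.pow_div (by omega) (by norm_num), Nat.log_pow (by norm_num)]
  congr 1; omega

theorem Params.labelOf_lt {ρ : List ℕ} (hρ : ρ.length ≤ depth n k) :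
    labelOf n k ρ < lg (n ^ 2) := by
  rw [hP.labelOf_eq hρ, lg, hP.hn, ← pow_mul, Nat.log_pow (by norm_num)]
  rcases Nat.eq_zero_or_pos ρ.length with h0 | h0
  · simp [h0]
  · have := hP.lt_depth_iff.1 (show ρ.length - 1 < depth n k by omega)
    omega

theorem Params.div_two_pow_labelOf {ρ : List ℕ} {i : ℕ} (hi : i < depth n k)
    (hρ : ρ.length = i + 1) : n ^ 2 / 2 ^ labelOf n k ρ = side n k i ^ 2 := by
  have h := hP.lt_depth_iff.1 hi
  rw [hP.labelOf_eq (by omega), hρ, Nat.add_sub_cancel, hP.side_eq]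
  nth_rewrite 1 [hP.hn]
  rw [← pow_mul, ← pow_mul, Nat.pow_div (by omega) (by norm_num)]
  congr 1; omega

/-- The two ends of a message of level `i + 1` lie in the segment of the parent. -/
theorem Params.source_mem_segment {i : ℕ} (hi : i < depth n k) {u v : Node}
    (hu : u ∈ stencilNodes n) (hv : v ∈ stencilNodes n) :
    base n k i v ≤ source n k (i + 1) u v ∧
      source n k (i + 1) u v < base n k i v + segSize n k i (cell n k i v) := by
  rw [source]
  split_ifs with h
  · have h1 := outHolder_mem n k (i + 1) hu
    have h2 := hP.base_succ_add_segSize_le hi hu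
    have h3 := Params.base_le_base_succ n k i u
    rw [hP.base_congr h.2, h.2] at h2
    rw [hP.base_congr h.2] at h3
    omega
  · exact inHolder_mem n k i hv u

theorem Params.source_lt {i : ℕ} (hi : i ≤ depth n k) {u v : Node}
    (hu : u ∈ stencilNodes n) (hv : v ∈ stencilNodes n) : source n k i u v < n ^ 2 := by
  rcases i with _ | i
  · rw [source]
    split_ifs
    · exact inputVP_lt hu
    · exact hP.holder_lt hi hu (outHolder_mem n k 0 hu).2
  · exact hP.holder_lt (by omega) hv (hP.source_mem_segment hi hu hv).2

theorem Params.deliver_legal {a : Cell × List ℕ} (ha : a ∈ schedule n k) {m : Msg Node}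
    (hm : m ∈ deliver n k a) : (m.src < n ^ 2 ∧ m.dst < n ^ 2) ∧
      m.src / (n ^ 2 / 2 ^ labelOf n k a.2) = m.dst / (n ^ 2 / 2 ^ labelOf n k a.2) := by
  have hlen := length_le_depth ha
  obtain ⟨u, hu, v, hv, -, -, -, -, rfl⟩ := mem_deliver.1 hm
  have hsrc := hP.source_lt hlen hu hv
  have hdst := hP.holder_lt hlen hv (inHolder_mem n k _ hv u).2
  refine ⟨⟨hsrc, hdst⟩, ?_⟩
  dsimp only
  rcases hl : a.2.length with _ | i
  · rw [hl] at hsrc hdst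
    rw [hP.labelOf_eq hlen, hl]
    simp only [Nat.zero_sub, mul_zero, pow_zero, Nat.div_one]
    rw [Nat.div_eq_of_lt hsrc, Nat.div_eq_of_lt hdst]
  · have hi : i < depth n k := by omega
    rw [hP.div_two_pow_labelOf hi hl]
    have h1 := hP.source_mem_segment hi hu hv
    have h2 := inHolder_mem n k (i + 1) hv u
    have h3 := hP.base_succ_add_segSize_le hi hv
    have h4 := Params.base_le_base_succ n k i v
    exact (hP.div_side_sq_eq hi hv h1.1 h1.2).trans
      (hP.div_side_sq_eq hi hv (by omega) (by omega)).symm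

theorem Params.collect_legal {a : Cell × List ℕ} (ha : a ∈ schedule n k) {m : Msg Node}
    (hm : m ∈ collect n k a) : (m.src < n ^ 2 ∧ m.dst < n ^ 2) ∧
      m.src / (n ^ 2 / 2 ^ labelOf n k a.2) = m.dst / (n ^ 2 / 2 ^ labelOf n k a.2) := by
  have hlen := length_le_depth ha
  obtain ⟨i, u, hu, rfl, -, rfl⟩ := mem_collect.1 hm
  have hl : (path n k i u ++ [stripe n k i u + 1]).length = i + 1 := by
    simp [Params.length_path]
  have hi : i < depth n k := by
    dsimp only at hlen; omega
  have h1 := outHolder_mem n k (i + 1) hu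
  have h2 := outHolder_mem n k i hu
  have h3 := hP.base_succ_add_segSize_le hi hu
  have h4 := Params.base_le_base_succ n k i u
  refine ⟨⟨hP.holder_lt hi hu h1.2, hP.holder_lt hi.le hu h2.2⟩, ?_⟩
  dsimp only
  rw [hP.div_two_pow_labelOf hi hl]
  exact (hP.div_side_sq_eq hi hu (by omega) (by omega)).trans
    (hP.div_side_sq_eq hi hu h2.1 h2.2).symm

theorem Params.dummies_legal {l : ℕ} (hl : l < lg (n ^ 2)) {m : Msg Node}
    (hm : m ∈ dummies n l) : (m.src < n ^ 2 ∧ m.dst < n ^ 2) ∧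
      m.src / (n ^ 2 / 2 ^ l) = m.dst / (n ^ 2 / 2 ^ l) := by
  simp only [dummies, Multiset.mem_map, Multiset.mem_range] at hm
  obtain ⟨r, hr, rfl⟩ := hm
  have hn2 : n ^ 2 = 2 ^ (L * 2) := by rw [hP.hn, ← pow_mul]
  have hbit : n ^ 2 / 2 ^ (l + 1) < n ^ 2 :=
    Nat.div_lt_self (by have := hP.pos; positivity) (Nat.one_lt_two_pow (by omega))
  dsimp only
  refine ⟨⟨hr, ?_⟩, ?_⟩
  · rw [hn2] at hr hbit ⊢
    exact Nat.xor_lt_two_pow hr hbit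
  · rcases Nat.eq_zero_or_pos L with h0 | h0
    -- For n = 1 there is a single VP; the flipped bit is 1/2 = 0 and the dummy goes to its own
    -- sender.
    · rw [h0, zero_mul, pow_zero] at hn2
      rw [hn2] at hr hbit ⊢
      have h1 : r = 0 := by omega
      have h2 : 1 / 2 ^ (l + 1) = 0 := Nat.div_eq_of_lt (Nat.one_lt_two_pow (by omega))
      rw [h1, h2]; rfl
    · rw [lg, hn2, Nat.log_pow (by norm_num)] at hl
      have hl2 : l + 1 ≤ L * 2 := by omega
      rw [hn2, Nat.pow_div hl2 (by norm_num), Nat.pow_div (by omega) (by norm_num),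
        ← Nat.shiftRight_eq_div_pow, ← Nat.shiftRight_eq_div_pow, Nat.shiftRight_xor_distrib]
      have : 2 ^ (L * 2 - (l + 1)) >>> (L * 2 - l) = 0 := by
        rw [Nat.shiftRight_eq_div_pow]
        exact Nat.div_eq_of_lt (Nat.pow_lt_pow_right (by norm_num) (by omega))
      rw [this, Nat.xor_zero]

/-- The inputs of a polyhedron are available once the superstep that delivers them is over. -/
theorem Params.knows_input {u v : Node} (hu : u ∈ stencilNodes n) (hv : v ∈ stencilNodes n)
    (huv : Arc u v) {i : ℕ} (hi : i ≤ depth n k) (hb : ¬ InBody n k i (cell n k i v) u) {s : ℕ}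
    (hs : (schedule n k).idxOf (cell n k 0 v, path n k i v) < s) :
    (alg n k).Knows (inHolder n k i v u) s u := by
  refine Or.inr ⟨_, hs, ⟨source n k i u v, inHolder n k i v u, some u⟩, ?_, rfl, rfl⟩
  rw [alg_msgs_idxOf (hP.path_mem_schedule hv hi)]
  refine Multiset.mem_add.2 (Or.inl (Finset.mem_union_left _ (mem_deliver.2 ?_)))
  simp only [Params.length_path]
  exact ⟨u, hu, v, hv, huv, rfl, rfl, hb, rfl⟩

/-- The outputs of a polyhedron are available at its segment once they have been collected. -/
theorem Params.knows_output {u : Node} {i : ℕ} (hi : i ≤ depth n k)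
    (hu : u ∈ outputs n k i (cell n k i u)) {s : ℕ}
    (hs : (schedule n k).idxOf (cell n k 0 u,
      if i < depth n k then path n k i u ++ [stripe n k i u + 1] else path n k i u) < s) :
    (alg n k).Knows (outHolder n k i u) s u := by
  obtain ⟨hun, hu1, -⟩ := mem_outputs.1 hu
  split_ifs at hs with h
  · refine Or.inr ⟨_, hs, ⟨outHolder n k (i + 1) u, outHolder n k i u, some u⟩, ?_, rfl, rfl⟩
    rw [alg_msgs_idxOf (hP.path_append_mem_schedule hun h)]
    exact Multiset.mem_add.2 (Or.inl (Finset.mem_union_right _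
      (mem_collect.2 ⟨i, u, hun, rfl, hu, rfl⟩)))
  · obtain rfl : i = depth n k := by omega
    refine Or.inl ⟨?_, ?_⟩
    · rw [hP.outHolder_depth hun]
      simp only [alg]
      rw [if_neg (by omega)]
    · simp only [alg]
      rw [if_neg (by omega)]
      omega

theorem Params.stripe_lt_of_arc {u v : Node} (hu : u ∈ stencilNodes n) (huv : Arc u v) {i : ℕ}
    (h : cell n k i u = cell n k i v) (hne : cell n k (i + 1) u ≠ cell n k (i + 1) v) :
    stripe n k i u < stripe n k i v := by
  have h1 := cellSum_lt_of_arc hu huv hne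
  rw [(hP.cellSum_succ i u).1, (hP.cellSum_succ i v).1, h] at h1
  omega

theorem Params.path_congr {u v : Node} {i : ℕ} (h : cell n k i u = cell n k i v) :
    path n k i u = path n k i v := by
  induction i with
  | zero => rfl
  | succ i ih =>
    have hc := hP.cell_congr_succ h
    rw [path_succ, path_succ, ih hc, stripe, stripe, h, hc]

/-- An operand from outside is at level 0 an original input or the output of an earlier stage. Below
level 0 it comes from an earlier stripe of the same parent, where it has been collected, or it is an
input of the parent, delivered when the parent started. -/
theorem Params.knows_source {u v : Node} (hu : u ∈ stencilNodes n) (hv : v ∈ stencilNodes n)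
    (huv : Arc u v) {i : ℕ} (hi : i ≤ depth n k) (hb : ¬ InBody n k i (cell n k i v) u) :
    (alg n k).Knows (source n k i u v)
      ((schedule n k).idxOf (cell n k 0 v, path n k i v)) u := by
  have hvs := hP.path_mem_schedule hv hi
  rcases i with _ | i
  · rw [source]
    split_ifs with h0
    · exact Or.inl ⟨by simp only [alg, h0, if_true], by simp only [alg, h0, if_true]; omega⟩
    · have hne : cell n k 0 u ≠ cell n k 0 v := fun h => hb ⟨by omega, h⟩
      refine hP.knows_output (Nat.zero_le _)
        (mem_outputs.2 ⟨hu, by omega, v, hv, huv, hne.symm⟩)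
        (idxOf_lt_idxOf ?_ hvs (Or.inl (stages_idxOf_lt _ (cell_zero_mem_stages hP hu) _
          (cell_zero_mem_stages hP hv) (cellSum_lt_of_arc hu huv hne))))
      split_ifs with h
      · exact hP.path_append_mem_schedule hu h
      · exact hP.path_mem_schedule hu (Nat.zero_le _)
  · rw [source]
    split_ifs with h
    · have hne : cell n k (i + 1) u ≠ cell n k (i + 1) v := fun h' => hb ⟨h.1, h'⟩
      have hc0 := hP.cell_congr (Nat.zero_le i) h.2
      have hst := hP.stripe_lt_of_arc hu huv h.2 hne
      refine hP.knows_output hi (mem_outputs.2 ⟨hu, h.1, v, hv, huv, hne.symm⟩)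
        (idxOf_lt_idxOf ?_ hvs (Or.inr ⟨hc0, ?_⟩))
      · split_ifs with h
        · exact hP.path_append_mem_schedule hu h
        · exact hP.path_mem_schedule hu hi
      · dsimp only
        rw [path_succ, path_succ, hP.path_congr h.2]
        split_ifs
        · rw [List.append_assoc]
          exact append_cons_lt_append_cons _ hst _ _
        · exact append_cons_lt_append_cons _ hst _ _
    · refine hP.knows_input hu hv huv (by omega) h
        (idxOf_lt_idxOf (hP.path_mem_schedule hv (by omega)) hvs (Or.inr ⟨rfl, ?_⟩))
      dsimp only
      rw [path_succ]
      exact lt_append_cons _ _ _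

theorem Params.knows_collected {u : Node} {i : ℕ} (hi : i < depth n k)
    (hu : u ∈ outputs n k i (cell n k i u)) :
    (alg n k).Knows (outHolder n k (i + 1) u)
      ((schedule n k).idxOf (cell n k 0 u, path n k i u ++ [stripe n k i u + 1])) u := by
  have hun := (mem_outputs.1 hu).1
  refine hP.knows_output hi (hP.outputs_succ hu)
    (idxOf_lt_idxOf ?_ (hP.path_append_mem_schedule hun hi) (Or.inr ⟨rfl, ?_⟩))
  · split_ifs with h
    · exact hP.path_append_mem_schedule hun h
    · exact hP.path_mem_schedule hun hi
  · dsimp only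
    rw [path_succ]
    split_ifs
    · rw [List.append_assoc]
      exact append_cons_lt_append_cons _ (Nat.lt_succ_self _) _ _
    · exact append_cons_lt_append_cons _ (Nat.lt_succ_self _) _ _

theorem Params.time_lt_len {u : Node} (hu : u ∈ stencilNodes n) :
    (alg n k).time u < (alg n k).len := by
  have hlen := List.idxOf_lt_length_of_mem (hP.path_mem_schedule hu (Nat.zero_le _))
  simp only [alg]
  split_ifs with h
  · omega
  · have hD : 0 < depth n k := by
      rw [hP.lt_depth_iff, mul_zero]
      by_contra hL
      have h1 : n = 1 := by rw [hP.hn, show L = 0 by omega, pow_zero]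
      rw [mem_stencilNodes] at hu
      omega
    -- The `+ 1` in `time` needs a further superstep, and the collecting one on the last level
    -- provides it.
    obtain ⟨i, hi⟩ : ∃ i, depth n k = i + 1 := ⟨depth n k - 1, by omega⟩
    have hmem := hP.path_append_mem_schedule hu (i := i) (by omega)
    have h1 := List.idxOf_lt_length_of_mem hmem
    have h2 := idxOf_lt_idxOf (hP.path_mem_schedule hu (i := i + 1) (by omega)) hmem
      (Or.inr ⟨rfl, by
        dsimp only
        rw [path_succ]
        exact append_cons_lt_append_cons _ (Nat.lt_succ_self _) _ _⟩)
    rw [hi]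
    omega

theorem alg_evaluates : (alg n k).Evaluates (stencilNodes n) Arc where
  label_lt s hs := by
    obtain ⟨a, ha, rfl⟩ := exists_eq_idxOf hs
    rw [alg_label_idxOf ha]
    exact hP.labelOf_lt (length_le_depth ha)
  range s hs m hm := by
    obtain ⟨a, ha, rfl⟩ := exists_eq_idxOf hs
    rw [alg_msgs_idxOf ha, Multiset.mem_add, Finset.mem_val, Finset.mem_union] at hm
    rcases hm with (hm | hm) | hm
    · exact (hP.deliver_legal ha hm).1
    · exact (hP.collect_legal ha hm).1
    · exact (hP.dummies_legal (hP.labelOf_lt (length_le_depth ha)) hm).1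
  cluster s hs m hm := by
    obtain ⟨a, ha, rfl⟩ := exists_eq_idxOf hs
    rw [alg_label_idxOf ha]
    rw [alg_msgs_idxOf ha, Multiset.mem_add, Finset.mem_val, Finset.mem_union] at hm
    rcases hm with (hm | hm) | hm
    · exact (hP.deliver_legal ha hm).2
    · exact (hP.collect_legal ha hm).2
    · exact (hP.dummies_legal (hP.labelOf_lt (length_le_depth ha)) hm).2
  owner_lt u hu := by
    simp only [alg]
    split_ifs
    · exact inputVP_lt hu
    · exact hP.holder_lt le_rfl hu (by have := segSize_pos n k (depth n k) hu; omega)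
  time_lt u hu := hP.time_lt_len hu
  operands v hv u hu huv := by
    have hv0 : v.2.2 ≠ 0 := by have := huv.1; omega
    have hb : ¬ InBody n k (depth n k) (cell n k (depth n k) v) u := by
      rintro ⟨-, h⟩
      rw [eq_of_cell_eq_of_side_eq_one hP.side_depth hu hv h] at huv
      have := huv.1
      omega
    have h := hP.knows_input hu hv huv le_rfl hb (Nat.lt_succ_self _)
    rw [hP.inHolder_depth hv] at h
    have h1 : (alg n k).owner v = base n k (depth n k) v := by simp only [alg, hv0, if_false]
    have h2 : (alg n k).time v =
        (schedule n k).idxOf (cell n k 0 v, path n k (depth n k) v) + 1 := by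
      simp only [alg, hv0, if_false]
    rw [h1, h2]
    exact h
  sends s hs m hm w hw := by
    obtain ⟨a, ha, rfl⟩ := exists_eq_idxOf hs
    rw [alg_msgs_idxOf ha, Multiset.mem_add, Finset.mem_val, Finset.mem_union] at hm
    have hlen := length_le_depth ha
    rcases hm with (hm | hm) | hm
    · obtain ⟨u, hu, v, hv, huv, h1, h2, h3, rfl⟩ := mem_deliver.1 hm
      obtain rfl : u = w := Option.some.inj hw
      have := hP.knows_source hu hv huv hlen h3
      rw [h1, h2] at this
      exact ⟨hu, this⟩
    · obtain ⟨i, u, hu, rfl, h1, rfl⟩ := mem_collect.1 hm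
      obtain rfl : u = w := Option.some.inj hw
      refine ⟨hu, hP.knows_collected ?_ h1⟩
      simp only [List.length_append, Params.length_path, List.length_singleton] at hlen
      omega
    · simp only [dummies, Multiset.mem_map] at hm
      obtain ⟨r, -, rfl⟩ := hm
      simp at hw

end

end OctTet

end NetObl

namespace NetObl

namespace OctTet

/-! ### Inputs and outputs of a polyhedron -/

theorem card_le_of_coords {n : ℕ} (T : Finset Node) (hT : T ⊆ stencilNodes n) (f : Node → ℕ × ℕ × ℕ)
    (hf : Set.InjOn f (stencilNodes n : Set Node)) (a b c l₁ l₂ l₃ : ℕ)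
    (h : ∀ u ∈ T, (a ≤ (f u).1 ∧ (f u).1 < a + l₁) ∧ (b ≤ (f u).2.1 ∧ (f u).2.1 < b + l₂) ∧
      c ≤ (f u).2.2 ∧ (f u).2.2 < c + l₃) : T.card ≤ l₁ * (l₂ * l₃) := by
  have : T.card ≤ (Finset.Ico a (a + l₁) ×ˢ Finset.Ico b (b + l₂) ×ˢ Finset.Ico c (c + l₃)).card := by
    refine Finset.card_le_card_of_injOn f ?_ (hf.mono fun u hu => Finset.mem_coe.2 (hT hu))
    intro u hu
    simpa only [Finset.coe_product, Finset.coe_Ico, Set.mem_prod, Set.mem_Ico] using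
      h u (Finset.mem_coe.1 hu)
  simpa [Finset.card_product] using this

/-- The first two coordinates determine time and i₀, the third then i₁. The shift by 2 allows
windows that start 2 below a polyhedron without truncated subtraction. -/
theorem injOn_xyz (n : ℕ) : Set.InjOn (fun u : Node => (cx n u + 2, cy n u + 2, cz n u + 2))
    (stencilNodes n : Set Node) := by
  intro u hu v hv h
  have hu := mem_stencilNodes.1 (Finset.mem_coe.1 hu)
  have hv := mem_stencilNodes.1 (Finset.mem_coe.1 hv)
  simp only [cx, cy, cz, Prod.mk.injEq] at h
  exact Prod.ext (by omega) (Prod.ext (by omega) (by omega))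

theorem injOn_xyt (n : ℕ) : Set.InjOn (fun u : Node => (cx n u + 2, cy n u + 2, ct n u + 2))
    (stencilNodes n : Set Node) := by
  intro u hu v hv h
  have hu := mem_stencilNodes.1 (Finset.mem_coe.1 hu)
  have hv := mem_stencilNodes.1 (Finset.mem_coe.1 hv)
  simp only [cx, cy, ct, Prod.mk.injEq] at h
  exact Prod.ext (by omega) (Prod.ext (by omega) (by omega))

theorem injOn_xz (n : ℕ) : Set.InjOn (fun u : Node => (u.2.2, cx n u + 2, cz n u + 2))
    (stencilNodes n : Set Node) := by
  intro u hu v hv h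
  simp only [cx, cz, Prod.mk.injEq] at h
  exact Prod.ext (by omega) (Prod.ext (by omega) (by omega))

/-- The number of nodes close to the boundary of a polyhedron of side `s`. -/
theorem card_shell_le {n s a b c d a' b' c' d' : ℕ} (hs : 0 < s) (T : Finset Node)
    (hT : T ⊆ stencilNodes n)
    (hbox : ∀ u ∈ T, (a ≤ cx n u + 2 ∧ cx n u + 2 < a + (s + 2)) ∧
      (b ≤ cy n u + 2 ∧ cy n u + 2 < b + (s + 2)) ∧ (c ≤ cz n u + 2 ∧ cz n u + 2 < c + (s + 2)) ∧
      (d ≤ ct n u + 2 ∧ ct n u + 2 < d + (s + 2)))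
    (hshell : ∀ u ∈ T, u.2.2 = 0 ∨ (a' ≤ cx n u + 2 ∧ cx n u + 2 < a' + 2) ∨
      (b' ≤ cy n u + 2 ∧ cy n u + 2 < b' + 2) ∨ (c' ≤ cz n u + 2 ∧ cz n u + 2 < c' + 2) ∨
      (d' ≤ ct n u + 2 ∧ ct n u + 2 < d' + 2)) : T.card ≤ 81 * s ^ 2 := by
  let T0 := T.filter fun u => u.2.2 = 0
  let T1 := T.filter fun u => a' ≤ cx n u + 2 ∧ cx n u + 2 < a' + 2
  let T2 := T.filter fun u => b' ≤ cy n u + 2 ∧ cy n u + 2 < b' + 2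
  let T3 := T.filter fun u => c' ≤ cz n u + 2 ∧ cz n u + 2 < c' + 2
  let T4 := T.filter fun u => d' ≤ ct n u + 2 ∧ ct n u + 2 < d' + 2
  have hsub : T ⊆ T0 ∪ (T1 ∪ (T2 ∪ (T3 ∪ T4))) := by
    intro u hu
    have := hshell u hu
    simp only [T0, T1, T2, T3, T4, Finset.mem_union, Finset.mem_filter, hu, true_and]
    exact this
  have h0 : T0.card ≤ 1 * ((s + 2) * (s + 2)) :=
    card_le_of_coords T0 ((Finset.filter_subset _ _).trans hT) _ (injOn_xz n) 0 a c 1 (s + 2) (s + 2)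
      fun u hu => by
        obtain ⟨h1, h2⟩ := Finset.mem_filter.1 hu
        have := hbox u h1
        dsimp only
        omega
  have h1 : T1.card ≤ 2 * ((s + 2) * (s + 2)) :=
    card_le_of_coords T1 ((Finset.filter_subset _ _).trans hT) _ (injOn_xyz n) a' b c 2 (s + 2)
      (s + 2) fun u hu => by
        obtain ⟨h1, h2⟩ := Finset.mem_filter.1 hu
        have := hbox u h1
        exact ⟨h2, this.2.1, this.2.2.1⟩
  have h2 : T2.card ≤ (s + 2) * (2 * (s + 2)) :=
    card_le_of_coords T2 ((Finset.filter_subset _ _).trans hT) _ (injOn_xyz n) a b' c (s + 2) 2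
      (s + 2) fun u hu => by
        obtain ⟨h1, h2⟩ := Finset.mem_filter.1 hu
        have := hbox u h1
        exact ⟨this.1, h2, this.2.2.1⟩
  have h3 : T3.card ≤ (s + 2) * ((s + 2) * 2) :=
    card_le_of_coords T3 ((Finset.filter_subset _ _).trans hT) _ (injOn_xyz n) a b c' (s + 2)
      (s + 2) 2 fun u hu => by
        obtain ⟨h1, h2⟩ := Finset.mem_filter.1 hu
        have := hbox u h1
        exact ⟨this.1, this.2.1, h2⟩
  have h4 : T4.card ≤ (s + 2) * ((s + 2) * 2) :=
    card_le_of_coords T4 ((Finset.filter_subset _ _).trans hT) _ (injOn_xyt n) a b d' (s + 2)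
      (s + 2) 2 fun u hu => by
        obtain ⟨h1, h2⟩ := Finset.mem_filter.1 hu
        have := hbox u h1
        exact ⟨this.1, this.2.1, h2⟩
  have hu := Finset.card_le_card hsub
  have u1 := Finset.card_union_le T0 (T1 ∪ (T2 ∪ (T3 ∪ T4)))
  have u2 := Finset.card_union_le T1 (T2 ∪ (T3 ∪ T4))
  have u3 := Finset.card_union_le T2 (T3 ∪ T4)
  have u4 := Finset.card_union_le T3 T4
  -- The five parts have total thickness 1 + 2 + 2 + 2 + 2 = 9, whence 81.
  have hss : (s + 2) * (s + 2) ≤ 9 * s ^ 2 := by nlinarith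
  nlinarith

theorem coord_arc {n : ℕ} {u v : Node} (hu : u ∈ stencilNodes n) (h : Arc u v) :
    (cx n u ≤ cx n v ∧ cx n v ≤ cx n u + 2) ∧ (cy n u ≤ cy n v ∧ cy n v ≤ cy n u + 2) ∧
    (cz n u ≤ cz n v ∧ cz n v ≤ cz n u + 2) ∧ (ct n u ≤ ct n v ∧ ct n v ≤ ct n u + 2) := by
  rw [mem_stencilNodes] at hu
  obtain ⟨h1, h2, h3⟩ := h
  simp only [cx, cy, cz, ct]
  omega

theorem mul_div_bounds (x : ℕ) {s : ℕ} (hs : 0 < s) : x / s * s ≤ x ∧ x < x / s * s + s :=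
  ⟨Nat.div_mul_le_self x s, Nat.lt_div_mul_add hs⟩

theorem div_eq_of_bounds {x s A : ℕ} (hs : 0 < s) (h1 : A * s ≤ x) (h2 : x < A * s + s) :
    x / s = A := by
  rw [Nat.div_eq_iff hs]; omega

/-- An arc raises each coordinate by at most 2. An input of positive time is outside the polyhedron,
so one of its coordinates lies in the two layers below the lower face; for outputs the two layers
below the upper face play this role. -/
theorem card_inputs_le (n k i : ℕ) (c : Cell) : (inputs n k i c).card ≤ 81 * side n k i ^ 2 := by
  have hs := side_pos n k i
  have hcell : ∀ u ∈ inputs n k i c, u ∈ stencilNodes n ∧ ¬ InBody n k i c u ∧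
      ∃ v ∈ stencilNodes n, Arc u v ∧ cell n k i v = c := by
    intro u hu
    rwa [inputs, Finset.mem_filter] at hu
  have hb : ∀ u ∈ inputs n k i c,
      (c.1 * side n k i ≤ cx n u + 2 ∧ cx n u + 2 < c.1 * side n k i + (side n k i + 2)) ∧
      (c.2.1 * side n k i ≤ cy n u + 2 ∧ cy n u + 2 < c.2.1 * side n k i + (side n k i + 2)) ∧
      (c.2.2.1 * side n k i ≤ cz n u + 2 ∧ cz n u + 2 < c.2.2.1 * side n k i + (side n k i + 2)) ∧
      (c.2.2.2 * side n k i ≤ ct n u + 2 ∧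
        ct n u + 2 < c.2.2.2 * side n k i + (side n k i + 2)) := by
    intro u hu
    obtain ⟨hun, -, v, -, huv, rfl⟩ := hcell u hu
    have := coord_arc hun huv
    have e1 := mul_div_bounds (cx n v) hs
    have e2 := mul_div_bounds (cy n v) hs
    have e3 := mul_div_bounds (cz n v) hs
    have e4 := mul_div_bounds (ct n v) hs
    simp only [cell_eq]
    omega
  refine card_shell_le (a' := c.1 * side n k i) (b' := c.2.1 * side n k i)
    (c' := c.2.2.1 * side n k i) (d' := c.2.2.2 * side n k i) hs _ (Finset.filter_subset _ _) hb ?_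
  intro u hu
  have hbu := hb u hu
  by_contra! hcon
  obtain ⟨hun, hnot, v, -, huv, hv⟩ := hcell u hu
  have hle := coord_arc hun huv
  refine hnot ⟨by omega, ?_⟩
  have f1 := mul_div_bounds (cx n v) hs
  have f2 := mul_div_bounds (cy n v) hs
  have f3 := mul_div_bounds (cz n v) hs
  have f4 := mul_div_bounds (ct n v) hs
  subst hv
  simp only [cell_eq] at hbu hcon ⊢
  obtain ⟨-, c1, c2, c3, c4⟩ := hcon
  rw [div_eq_of_bounds hs (A := cx n v / side n k i) (x := cx n u) (by omega) (by omega),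
    div_eq_of_bounds hs (A := cy n v / side n k i) (x := cy n u) (by omega) (by omega),
    div_eq_of_bounds hs (A := cz n v / side n k i) (x := cz n u) (by omega) (by omega),
    div_eq_of_bounds hs (A := ct n v / side n k i) (x := ct n u) (by omega) (by omega)]

theorem card_outputs_le (n k i : ℕ) (c : Cell) : (outputs n k i c).card ≤ 81 * side n k i ^ 2 := by
  have hs := side_pos n k i
  have hcell : ∀ u ∈ outputs n k i c, u ∈ stencilNodes n ∧ cell n k i u = c ∧
      ∃ v ∈ stencilNodes n, Arc u v ∧ cell n k i v ≠ c := by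
    intro u hu
    rw [outputs, Finset.mem_filter] at hu
    exact ⟨hu.1, hu.2.1.2, hu.2.2⟩
  refine card_shell_le (a := c.1 * side n k i) (b := c.2.1 * side n k i)
    (c := c.2.2.1 * side n k i) (d := c.2.2.2 * side n k i)
    (a' := c.1 * side n k i + side n k i) (b' := c.2.1 * side n k i + side n k i)
    (c' := c.2.2.1 * side n k i + side n k i) (d' := c.2.2.2 * side n k i + side n k i)
    hs _ (Finset.filter_subset _ _) ?_ ?_
  · intro u hu
    obtain ⟨-, rfl, -⟩ := hcell u hu
    have e1 := mul_div_bounds (cx n u) hs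
    have e2 := mul_div_bounds (cy n u) hs
    have e3 := mul_div_bounds (cz n u) hs
    have e4 := mul_div_bounds (ct n u) hs
    simp only [cell_eq]
    omega
  · intro u hu
    obtain ⟨hun, rfl, v, -, huv, hne⟩ := hcell u hu
    have hle := coord_arc hun huv
    have e1 := mul_div_bounds (cx n u) hs
    have e2 := mul_div_bounds (cy n u) hs
    have e3 := mul_div_bounds (cz n u) hs
    have e4 := mul_div_bounds (ct n u) hs
    by_contra! hcon
    refine hne ?_
    simp only [cell_eq] at hcon ⊢
    obtain ⟨-, c1, c2, c3, c4⟩ := hcon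
    rw [div_eq_of_bounds hs (A := cx n u / side n k i) (x := cx n v) (by omega) (by omega),
      div_eq_of_bounds hs (A := cy n u / side n k i) (x := cy n v) (by omega) (by omega),
      div_eq_of_bounds hs (A := cz n u / side n k i) (x := cz n v) (by omega) (by omega),
      div_eq_of_bounds hs (A := ct n u / side n k i) (x := ct n v) (by omega) (by omega)]

/-- An even cyclic distribution of few nodes gives few nodes to each holder. -/
theorem card_rank_mod_le {n w C : ℕ} {X : Finset Node} (hX : X ⊆ stencilNodes n) (hw : 0 < w)
    (hC : X.card ≤ C * w) (r : ℕ) (T : Finset Node)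
    (hT : ∀ u ∈ T, u ∈ X ∧ rank (nodeKey n) X u % w = r) : T.card ≤ C := by
  have : T.card ≤ (Finset.range C).card := by
    refine Finset.card_le_card_of_injOn (fun u => rank (nodeKey n) X u / w) ?_ ?_
    · intro u hu
      have h := rank_lt_card (nodeKey n) (hT u (Finset.mem_coe.1 hu)).1
      rw [Finset.coe_range, Set.mem_Iio]
      exact (Nat.div_lt_iff_lt_mul hw).2 (h.trans_le hC)
    · intro u hu v hv h
      obtain ⟨hu1, hu2⟩ := hT u (Finset.mem_coe.1 hu)
      obtain ⟨hv1, hv2⟩ := hT v (Finset.mem_coe.1 hv)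
      dsimp only at h
      have h1 := Nat.div_add_mod (rank (nodeKey n) X u) w
      have h2 := Nat.div_add_mod (rank (nodeKey n) X v) w
      rw [h, hu2, ← hv2, h2] at h1
      exact nodeKey_injOn n (Finset.mem_coe.2 (hX hu1)) (Finset.mem_coe.2 (hX hv1))
        (key_eq_of_rank_eq hu1 hv1 h1.symm)
  simpa using this

/-! ### Messages of a single virtual processor -/

section

variable {n k L e : ℕ} (hP : Params n k L e)
include hP

/-- Polyhedra evaluated at the same time have disjoint segments, so all these nodes are inputs of
one polyhedron; 243 = 81 · 3 by `card_inputs_le` and `side_sq_le`. -/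
theorem Params.card_inHolder_fiber_le {i : ℕ} (hi : i ≤ depth n k) (g : Cell) (ρ : List ℕ) (r : ℕ)
    (T : Finset Node) (hT : ∀ u ∈ T, ∃ v ∈ stencilNodes n, cell n k 0 v = g ∧ path n k i v = ρ ∧
      u ∈ inputs n k i (cell n k i v) ∧ inHolder n k i v u = r) : T.card ≤ 243 := by
  rcases T.eq_empty_or_nonempty with rfl | ⟨u₀, hu₀⟩
  · simp
  obtain ⟨v₀, hv₀, h0, hp, -, hr⟩ := hT u₀ hu₀
  have hmem₀ := inHolder_mem n k i hv₀ u₀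
  refine card_rank_mod_le (X := inputs n k i (cell n k i v₀)) (Finset.filter_subset _ _)
    (segSize_pos n k i hv₀) ?_ (r - base n k i v₀) T ?_
  · have := card_inputs_le n k i (cell n k i v₀)
    have := side_sq_le n k i hv₀
    omega
  · intro u hu
    obtain ⟨v, hv, h0', hp', hin, hr'⟩ := hT u hu
    have hmem := inHolder_mem n k i hv u
    have hc : cell n k i v = cell n k i v₀ :=
      hP.cell_eq_of_mem_segment hi hv hv₀ (h0'.trans h0.symm) (hp'.trans hp.symm)
        (hr' ▸ hmem.1) (hr' ▸ hmem.2) (hr ▸ hmem₀.1) (hr ▸ hmem₀.2)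
    refine ⟨hc ▸ hin, ?_⟩
    rw [inHolder, hP.base_congr hc, hc] at hr'
    omega

theorem Params.card_outHolder_fiber_le {i : ℕ} (hi : i ≤ depth n k) (g : Cell) (ρ : List ℕ)
    (r : ℕ) (T : Finset Node) (hT : ∀ u ∈ T, cell n k 0 u = g ∧ path n k i u = ρ ∧
      u ∈ outputs n k i (cell n k i u) ∧ outHolder n k i u = r) : T.card ≤ 243 := by
  rcases T.eq_empty_or_nonempty with rfl | ⟨u₀, hu₀⟩
  · simp
  obtain ⟨h0, hp, hout, hr⟩ := hT u₀ hu₀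
  have hu₀n := (mem_outputs.1 hout).1
  have hmem₀ := outHolder_mem n k i hu₀n
  refine card_rank_mod_le (X := outputs n k i (cell n k i u₀)) (Finset.filter_subset _ _)
    (segSize_pos n k i hu₀n) ?_ (r - base n k i u₀) T ?_
  · have := card_outputs_le n k i (cell n k i u₀)
    have := side_sq_le n k i hu₀n
    omega
  · intro u hu
    obtain ⟨h0', hp', hin, hr'⟩ := hT u hu
    have hun := (mem_outputs.1 hin).1
    have hmem := outHolder_mem n k i hun
    have hc : cell n k i u = cell n k i u₀ :=
      hP.cell_eq_of_mem_segment hi hun hu₀n (h0'.trans h0.symm) (hp'.trans hp.symm)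
        (hr' ▸ hmem.1) (hr' ▸ hmem.2) (hr ▸ hmem₀.1) (hr ▸ hmem₀.2)
    refine ⟨hc ▸ hin, ?_⟩
    rw [outHolder, hP.base_congr hc, hc] at hr'
    omega

/-- Each of the four quotients grows by at most 2, even for side 1. So only nine stripes of a parent
can supply operands to a given stripe. -/
theorem Params.stripe_le_of_arc {u v : Node} (hu : u ∈ stencilNodes n) (huv : Arc u v) {i : ℕ}
    (h : cell n k i u = cell n k i v) : stripe n k i u ≤ stripe n k i v ∧
      stripe n k i v ≤ stripe n k i u + 8 := by
  have h1 := (hP.cellSum_succ i u).1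
  have h2 := (hP.cellSum_succ i v).1
  rw [h] at h1
  have hle := coord_arc hu huv
  have hs := side_pos n k (i + 1)
  have key : ∀ x y : ℕ, x ≤ y ∧ y ≤ x + 2 → x / side n k (i + 1) ≤ y / side n k (i + 1) ∧
      y / side n k (i + 1) ≤ x / side n k (i + 1) + 2 := by
    intro x y hxy
    refine ⟨Nat.div_le_div_right hxy.1, ?_⟩
    calc y / side n k (i + 1) ≤ (x + 2 * side n k (i + 1)) / side n k (i + 1) :=
          Nat.div_le_div_right (by omega)
      _ = _ := Nat.add_mul_div_right _ _ hs
  have k1 := key _ _ hle.1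
  have k2 := key _ _ hle.2.1
  have k3 := key _ _ hle.2.2.1
  have k4 := key _ _ hle.2.2.2
  simp only [cell_eq, cellSum] at h1 h2
  omega

/-- A processor sends the values of few nodes when the inputs of polyhedra are delivered. -/
theorem Params.card_source_fiber_le (a : Cell × List ℕ) (ha : a.2.length ≤ depth n k) (r : ℕ)
    (T : Finset Node) (hT : ∀ u ∈ T, u ∈ stencilNodes n ∧ ∃ v ∈ stencilNodes n, Arc u v ∧
      cell n k 0 v = a.1 ∧ path n k a.2.length v = a.2 ∧
      ¬ InBody n k a.2.length (cell n k a.2.length v) u ∧ source n k a.2.length u v = r) :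
    T.card ≤ 4132 := by
  classical
  obtain ⟨g, ρ⟩ := a
  dsimp only at hT ha
  rcases hl : ρ.length with _ | i
  · rw [hl] at hT
    have h1 : (T.filter fun u => u.2.2 = 0).card ≤ 1 := by
      refine Finset.card_le_one.2 fun u hu v hv => ?_
      obtain ⟨hu, hu0⟩ := Finset.mem_filter.1 hu
      obtain ⟨hv, hv0⟩ := Finset.mem_filter.1 hv
      obtain ⟨hun, _, _, _, _, _, _, hur⟩ := hT u hu
      obtain ⟨hvn, _, _, _, _, _, _, hvr⟩ := hT v hv
      rw [source, if_pos hu0, inputVP] at hur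
      rw [source, if_pos hv0, inputVP] at hvr
      rw [mem_stencilNodes] at hun hvn
      have := mul_add_inj (M := n) (a := u.2.1) (b := u.1) (a' := v.2.1) (b' := v.1) hun.1 hvn.1
        (by rw [mul_comm u.2.1, mul_comm v.2.1]; omega)
      exact Prod.ext this.2 (Prod.ext this.1 (hu0.trans hv0.symm))
    -- Outputs of all 17 stages may reside at `r`, besides one input of time 0: 1 + 17 · 243 = 4132.
    have h2 : (T.filter fun u => ¬ u.2.2 = 0).card ≤ 243 * stages.toFinset.card := by
      refine Finset.card_le_mul_card_image_of_maps_to (f := cell n k 0) ?_ _ ?_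
      · intro u hu
        exact List.mem_toFinset.2 (cell_zero_mem_stages hP (hT u (Finset.mem_filter.1 hu).1).1)
      · intro c _
        refine hP.card_outHolder_fiber_le (Nat.zero_le _) c [] r _ fun u hu => ?_
        obtain ⟨hu, huc⟩ := Finset.mem_filter.1 hu
        obtain ⟨hu, hu0⟩ := Finset.mem_filter.1 hu
        obtain ⟨hun, v, hv, huv, -, -, hb, hr⟩ := hT u hu
        rw [source, if_neg hu0] at hr
        exact ⟨huc, rfl, mem_outputs.2 ⟨hun, by omega, v, hv, huv,
          fun h => hb ⟨by omega, h.symm⟩⟩, hr⟩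
    have h3 : stages.toFinset.card = 17 := by decide
    have := Finset.card_filter_add_card_filter_not (s := T) (fun u : Node => u.2.2 = 0)
    omega
  · rw [hl] at hT ha
    obtain ⟨ρ', t, rfl⟩ : ∃ ρ' t, ρ = ρ' ++ [t] := by
      rcases List.eq_nil_or_concat' ρ with rfl | ⟨ρ', t, rfl⟩
      · simp at hl
      · exact ⟨ρ', t, rfl⟩
    have hpath : ∀ v, path n k (i + 1) v = ρ' ++ [t] → path n k i v = ρ' ∧ stripe n k i v = t := by
      intro v hv
      rw [Params.path_succ] at hv
      obtain ⟨h1, h2⟩ := List.append_inj' hv rfl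
      exact ⟨h1, by simpa using h2⟩
    let Q : Node → Prop := fun u => ∃ v ∈ stencilNodes n, cell n k 0 v = g ∧ path n k i v = ρ' ∧
      u ∈ inputs n k i (cell n k i v) ∧ inHolder n k i v u = r
    have h1 : (T.filter Q).card ≤ 243 :=
      hP.card_inHolder_fiber_le (by omega) g ρ' r _ fun u hu => (Finset.mem_filter.1 hu).2
    have hrest : ∀ u ∈ T, ¬ Q u → cell n k 0 u = g ∧ path n k i u = ρ' ∧
        u ∈ outputs n k (i + 1) (cell n k (i + 1) u) ∧ outHolder n k (i + 1) u = r ∧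
        t - 8 ≤ stripe n k i u ∧ stripe n k i u ≤ t := by
      intro u hu hQ
      obtain ⟨hun, v, hv, huv, h0, hp, hb, hr⟩ := hT u hu
      obtain ⟨hp, hst⟩ := hpath v hp
      rw [source] at hr
      split_ifs at hr with hbody
      · have := hP.stripe_le_of_arc hun huv hbody.2
        refine ⟨(hP.cell_congr (Nat.zero_le i) hbody.2).trans h0,
          (hP.path_congr hbody.2).trans hp, mem_outputs.2 ⟨hun, hbody.1, v, hv, huv, fun h => ?_⟩,
          hr, by omega, by omega⟩
        exact hb ⟨hbody.1, h.symm⟩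
      · refine absurd ⟨v, hv, h0, hp, ?_, hr⟩ hQ
        rw [inputs, Finset.mem_filter]
        exact ⟨hun, hbody, v, hv, huv, rfl⟩
    -- Values not relayed from the parent's inputs come from the stripes t - 8, …, t; the total 243
    -- + 9 · 243 stays below 4132.
    have h2 : (T.filter fun u => ¬ Q u).card ≤ 243 * (Finset.Icc (t - 8) t).card := by
      refine Finset.card_le_mul_card_image_of_maps_to (f := stripe n k i) ?_ _ ?_
      · intro u hu
        obtain ⟨hu, hQ⟩ := Finset.mem_filter.1 hu
        exact Finset.mem_Icc.2 (hrest u hu hQ).2.2.2.2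
      · intro s _
        refine hP.card_outHolder_fiber_le ha g (ρ' ++ [s]) r _ fun u hu => ?_
        obtain ⟨hu, hs⟩ := Finset.mem_filter.1 hu
        obtain ⟨hu, hQ⟩ := Finset.mem_filter.1 hu
        obtain ⟨h0, hp, ho, hr, -⟩ := hrest u hu hQ
        exact ⟨h0, by rw [Params.path_succ, hp, hs], ho, hr⟩
    rw [Nat.card_Icc] at h2
    have := Finset.card_filter_add_card_filter_not (s := T) Q
    omega

end

theorem card_successors_le (u : Node) (S : Finset Node) (hS : ∀ v ∈ S, Arc u v) : S.card ≤ 9 := by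
  have : S ⊆ Finset.Icc (u.1 - 1) (u.1 + 1) ×ˢ Finset.Icc (u.2.1 - 1) (u.2.1 + 1) ×ˢ
      {u.2.2 + 1} := by
    intro v hv
    obtain ⟨h1, h2, h3⟩ := hS v hv
    simp only [Finset.mem_product, Finset.mem_Icc, Finset.mem_singleton]
    omega
  refine (Finset.card_le_card this).trans ?_
  rw [Finset.card_product, Finset.card_product, Nat.card_Icc, Nat.card_Icc, Finset.card_singleton,
    mul_one]
  calc _ ≤ 3 * 3 := Nat.mul_le_mul (by omega) (by omega)
    _ = 9 := rfl

/-- A delivery is determined by the value `u` and a successor `v`, so each value accounts for at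
most nine messages. -/
theorem card_filter_deliver_le {n k C : ℕ} (a : Cell × List ℕ) (P : Msg Node → Prop)
    [DecidablePred P]
    (h : ∀ T : Finset Node, (∀ u ∈ T, u ∈ stencilNodes n ∧ ∃ v ∈ stencilNodes n, Arc u v ∧
      cell n k 0 v = a.1 ∧ path n k a.2.length v = a.2 ∧
      ¬ InBody n k a.2.length (cell n k a.2.length v) u ∧
      P ⟨source n k a.2.length u v, inHolder n k a.2.length v u, some u⟩) → T.card ≤ C) :
    ((deliver n k a).filter P).card ≤ 9 * C := by
  set M := (deliver n k a).filter P with hM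
  have hval : ∀ m ∈ M, ∃ u ∈ stencilNodes n, ∃ v ∈ stencilNodes n, Arc u v ∧
      cell n k 0 v = a.1 ∧ path n k a.2.length v = a.2 ∧
      ¬ InBody n k a.2.length (cell n k a.2.length v) u ∧
      P ⟨source n k a.2.length u v, inHolder n k a.2.length v u, some u⟩ ∧
      m = ⟨source n k a.2.length u v, inHolder n k a.2.length v u, some u⟩ := by
    intro m hm
    obtain ⟨h1, h2⟩ := Finset.mem_filter.1 hm
    obtain ⟨u, hu, v, hv, g1, g2, g3, g4, rfl⟩ := mem_deliver.1 h1
    exact ⟨u, hu, v, hv, g1, g2, g3, g4, h2, rfl⟩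
  have h1 : (M.image fun m => m.val.getD default).card ≤ C := by
    refine h _ fun u hu => ?_
    obtain ⟨m, hm, rfl⟩ := Finset.mem_image.1 hu
    obtain ⟨u, hun, v, hv, g1, g2, g3, g4, g5, rfl⟩ := hval m hm
    exact ⟨hun, v, hv, g1, g2, g3, g4, g5⟩
  refine (Finset.card_le_mul_card_image (f := fun m : Msg Node => m.val.getD default) M 9
    fun u _ => ?_).trans (Nat.mul_le_mul_left 9 h1)
  refine (Finset.card_le_card (t := ((stencilNodes n).filter fun v => Arc u v).image fun v =>
    (⟨source n k a.2.length u v, inHolder n k a.2.length v u, some u⟩ : Msg Node)) ?_).trans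
    (Finset.card_image_le.trans (card_successors_le u _ fun v hv => (Finset.mem_filter.1 hv).2))
  intro m hm
  obtain ⟨hm, hmu⟩ := Finset.mem_filter.1 hm
  obtain ⟨u', hu, v, hv, g1, g2, g3, g4, g5, rfl⟩ := hval m hm
  obtain rfl : u' = u := hmu
  exact Finset.mem_image.2 ⟨v, Finset.mem_filter.2 ⟨hv, g1⟩, rfl⟩

theorem card_filter_collect_le {n k C : ℕ} (a : Cell × List ℕ) (P : Msg Node → Prop)
    [DecidablePred P]
    (h : ∀ T : Finset Node, (∀ u ∈ T, ∃ i, a = (cell n k 0 u, path n k i u ++ [stripe n k i u + 1])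
      ∧ u ∈ outputs n k i (cell n k i u) ∧
      P ⟨outHolder n k (i + 1) u, outHolder n k i u, some u⟩) → T.card ≤ C) :
    ((collect n k a).filter P).card ≤ C := by
  set M := (collect n k a).filter P with hM
  have hval : ∀ m ∈ M, ∃ i, ∃ u,
      a = (cell n k 0 u, path n k i u ++ [stripe n k i u + 1]) ∧
      u ∈ outputs n k i (cell n k i u) ∧
      P ⟨outHolder n k (i + 1) u, outHolder n k i u, some u⟩ ∧
      m = ⟨outHolder n k (i + 1) u, outHolder n k i u, some u⟩ := by
    intro m hm
    obtain ⟨h1, h2⟩ := Finset.mem_filter.1 hm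
    obtain ⟨i, u, -, g1, g2, rfl⟩ := mem_collect.1 h1
    exact ⟨i, u, g1, g2, h2, rfl⟩
  have hinj : Set.InjOn (fun m : Msg Node => m.val.getD default) (M : Set (Msg Node)) := by
    intro m hm m' hm' heq
    obtain ⟨i, u, g1, -, -, rfl⟩ := hval m (Finset.mem_coe.1 hm)
    obtain ⟨j, v, g1', -, -, rfl⟩ := hval m' (Finset.mem_coe.1 hm')
    obtain rfl : u = v := heq
    have hl := congrArg (fun b : Cell × List ℕ => b.2.length) (g1.symm.trans g1')
    simp only [List.length_append, Params.length_path, List.length_singleton] at hl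
    obtain rfl : i = j := by omega
    rfl
  rw [← Finset.card_image_of_injOn hinj]
  refine h _ fun u hu => ?_
  obtain ⟨m, hm, rfl⟩ := Finset.mem_image.1 hu
  obtain ⟨i, u, g1, g2, g3, rfl⟩ := hval m hm
  exact ⟨i, g1, g2, g3⟩

theorem card_filter_src_dummies_le (n l r : ℕ) :
    ((dummies n l).filter fun m => m.src = r).card ≤ 1 := by
  rw [dummies, Multiset.filter_map, Multiset.card_map]
  have : ((Finset.range (n ^ 2)).filter fun x => x = r).card ≤ 1 :=
    Finset.card_le_one.2 fun x hx y hy =>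
      (Finset.mem_filter.1 hx).2.trans (Finset.mem_filter.1 hy).2.symm
  exact this

theorem card_filter_dst_dummies_le (n l r : ℕ) :
    ((dummies n l).filter fun m => m.dst = r).card ≤ 1 := by
  rw [dummies, Multiset.filter_map, Multiset.card_map]
  have : ((Finset.range (n ^ 2)).filter fun x => x ^^^ (n ^ 2 / 2 ^ (l + 1)) = r).card ≤ 1 :=
    Finset.card_le_one.2 fun x hx y hy => Nat.xor_left_inj.1
      ((Finset.mem_filter.1 hx).2.trans (Finset.mem_filter.1 hy).2.symm)
  exact this

theorem card_filter_msgs_le {n k C D : ℕ} {a : Cell × List ℕ} (ha : a ∈ schedule n k)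
    (P : Msg Node → Prop) [DecidablePred P] (h1 : ((deliver n k a).filter P).card ≤ C)
    (h2 : ((collect n k a).filter P).card ≤ D)
    (h3 : ((dummies n (labelOf n k a.2)).filter P).card ≤ 1) :
    (((alg n k).msgs ((schedule n k).idxOf a)).filter P).card ≤ C + D + 1 := by
  rw [alg_msgs_idxOf ha, Multiset.filter_add, Multiset.card_add]
  have : (((deliver n k a ∪ collect n k a).val).filter P).card ≤ C + D := by
    change (((deliver n k a ∪ collect n k a)).filter P).card ≤ C + D
    rw [Finset.filter_union]
    exact (Finset.card_union_le _ _).trans (add_le_add h1 h2)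
  omega

/-- A bound on the number of messages that a virtual processor sends or receives in a superstep. -/
def msgBound : ℕ := 37432

section

variable {n k L e : ℕ} (hP : Params n k L e)
include hP

theorem Params.card_filter_src_le {a : Cell × List ℕ} (ha : a ∈ schedule n k) (r : ℕ) :
    (((alg n k).msgs ((schedule n k).idxOf a)).filter fun m => m.src = r).card ≤ msgBound := by
  have hlen := length_le_depth ha
  -- Deliveries, collections and one dummy: 9 · 4132 + 243 + 1 = `msgBound`.
  refine card_filter_msgs_le (C := 9 * 4132) (D := 243) ha _ ?_ ?_
    (card_filter_src_dummies_le _ _ _)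
  · exact card_filter_deliver_le a _ fun T hT => hP.card_source_fiber_le a hlen r T hT
  · refine card_filter_collect_le a _ fun T hT => ?_
    obtain ⟨g, ρ⟩ := a
    rcases List.eq_nil_or_concat' ρ with rfl | ⟨ρ', t, rfl⟩
    · rcases T.eq_empty_or_nonempty with rfl | ⟨u, hu⟩
      · simp
      · obtain ⟨i, h, -⟩ := hT u hu
        simp at h
    have key : ∀ u ∈ T, cell n k 0 u = g ∧ path n k (ρ'.length + 1) u = ρ' ++ [t - 1] ∧
        u ∈ outputs n k (ρ'.length + 1) (cell n k (ρ'.length + 1) u) ∧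
        outHolder n k (ρ'.length + 1) u = r := by
      intro u hu
      obtain ⟨i, h, h1, h2⟩ := hT u hu
      obtain ⟨rfl, h'⟩ := Prod.mk.inj h
      obtain ⟨h3, h4⟩ := List.append_inj' h' rfl
      simp only [List.cons.injEq, and_true] at h4
      subst h3
      rw [Params.length_path, Params.path_succ, h4]
      exact ⟨rfl, rfl, hP.outputs_succ h1, h2⟩
    refine hP.card_outHolder_fiber_le ?_ g (ρ' ++ [t - 1]) r T key
    simpa using hlen

theorem Params.card_filter_dst_le {a : Cell × List ℕ} (ha : a ∈ schedule n k) (r : ℕ) :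
    (((alg n k).msgs ((schedule n k).idxOf a)).filter fun m => m.dst = r).card ≤ msgBound := by
  have hlen := length_le_depth ha
  refine (card_filter_msgs_le (C := 9 * 243) (D := 243) ha _ ?_ ?_
    (card_filter_dst_dummies_le _ _ _)).trans (by norm_num [msgBound])
  · refine card_filter_deliver_le a _ fun T hT => hP.card_inHolder_fiber_le hlen a.1 a.2 r T ?_
    intro u hu
    obtain ⟨hun, v, hv, huv, h0, hp, hb, hr⟩ := hT u hu
    refine ⟨v, hv, h0, hp, ?_, hr⟩
    rw [inputs, Finset.mem_filter]
    exact ⟨hun, hb, v, hv, huv, rfl⟩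
  · refine card_filter_collect_le a _ fun T hT => ?_
    obtain ⟨g, ρ⟩ := a
    refine hP.card_outHolder_fiber_le (i := ρ.length - 1) (by dsimp only at hlen; omega) g
      ρ.dropLast r T ?_
    intro u hu
    obtain ⟨i, h, h1, h2⟩ := hT u hu
    obtain ⟨rfl, rfl⟩ := Prod.mk.inj h
    simp only [List.length_append, Params.length_path, List.length_singleton, Nat.add_sub_cancel,
      List.dropLast_concat]
    exact ⟨trivial, trivial, h1, h2⟩

end

end OctTet

end NetObl

namespace NetObl

/-! ### Degrees of the supersteps and number of supersteps -/

/-- Used with `I` the block of VPs simulated by one processor of a folding. -/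
theorem Multiset.card_filter_le_mul {α : Type*} (M : Multiset α) (f : α → ℕ) (P : α → Prop)
    [DecidablePred P] (I : Finset ℕ) (c : ℕ) (hP : ∀ a, P a → f a ∈ I)
    (hc : ∀ r ∈ I, (M.filter fun a => f a = r).card ≤ c) : (M.filter P).card ≤ I.card * c := by
  refine le_trans ?_ (Finset.sum_le_card_nsmul I _ c hc)
  clear hc
  induction M using Multiset.induction with
  | empty => simp
  | cons a M ih =>
    simp only [← Multiset.countP_eq_card_filter, Multiset.countP_cons] at ih ⊢
    rw [Finset.sum_add_distrib]
    refine add_le_add ih ?_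
    split_ifs with h
    · rw [Finset.sum_ite_eq, if_pos (hP a h)]
    · exact Nat.zero_le _

namespace OctTet

variable {n k L e : ℕ}

theorem exists_mul_eq_of_le {p : ℕ} (hP : Params n k L e) (hp : IsPowTwo p) (hpn : p ≤ n ^ 2) :
    0 < p ∧ n ^ 2 / p * p = n ^ 2 := by
  obtain ⟨b, rfl⟩ := hp
  refine ⟨by positivity, Nat.div_mul_cancel ?_⟩
  rw [hP.hn, ← pow_mul] at hpn ⊢
  exact pow_dvd_pow 2 ((Nat.pow_le_pow_iff_right (by norm_num)).1 hpn)

theorem mem_Ico_of_div_eq {r w j : ℕ} (hw : 0 < w) (h : r / w = j) :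
    r ∈ Finset.Ico (j * w) (j * w + w) := by
  subst h
  have := mul_div_bounds r hw
  exact Finset.mem_Ico.2 this

theorem degree_alg_le (hP : Params n k L e) {p : ℕ} (hp : IsPowTwo p) (hpn : p ≤ n ^ 2) {s : ℕ}
    (hs : s < (alg n k).len) : (alg n k).degree p s ≤ n ^ 2 / p * msgBound := by
  obtain ⟨hp0, hdiv⟩ := exists_mul_eq_of_le hP hp hpn
  have hw : 0 < n ^ 2 / p := Nat.div_pos hpn hp0
  obtain ⟨a, ha, rfl⟩ := exists_eq_idxOf hs
  refine Finset.sup_le fun j _ => max_le ?_ ?_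
  · have := Multiset.card_filter_le_mul ((alg n k).msgs ((schedule n k).idxOf a)) Msg.src
      (fun m => StaticAlg.block (n ^ 2) p m.src = j ∧ StaticAlg.block (n ^ 2) p m.dst ≠ j)
      (Finset.Ico (j * (n ^ 2 / p)) (j * (n ^ 2 / p) + n ^ 2 / p)) msgBound
      (fun m hm => mem_Ico_of_div_eq hw hm.1) fun r _ => hP.card_filter_src_le ha r
    rwa [Nat.card_Ico, Nat.add_sub_cancel_left] at this
  · have := Multiset.card_filter_le_mul ((alg n k).msgs ((schedule n k).idxOf a)) Msg.dst
      (fun m => StaticAlg.block (n ^ 2) p m.dst = j ∧ StaticAlg.block (n ^ 2) p m.src ≠ j)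
      (Finset.Ico (j * (n ^ 2 / p)) (j * (n ^ 2 / p) + n ^ 2 / p)) msgBound
      (fun m hm => mem_Ico_of_div_eq hw hm.1) fun r _ => hP.card_filter_dst_le ha r
    rwa [Nat.card_Ico, Nat.add_sub_cancel_left] at this

/-- The dummy messages give every superstep its full degree. -/
theorem le_degree_alg (hP : Params n k L e) {s j : ℕ} (hs : s < (alg n k).len)
    (hj : (alg n k).label s < j) (hjL : j ≤ 2 * L) :
    n ^ 2 / 2 ^ j ≤ (alg n k).degree (2 ^ j) s := by
  obtain ⟨a, ha, rfl⟩ := exists_eq_idxOf hs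
  rw [alg_label_idxOf ha] at hj
  refine le_trans ?_ (StaticAlg.sent_le_degree _ (pow_pos (by norm_num : 0 < 2) j) _)
  rw [StaticAlg.sent, alg_msgs_idxOf ha, Multiset.filter_add, Multiset.card_add]
  refine le_trans ?_ (Nat.le_add_left _ _)
  rw [dummies, Multiset.filter_map, Multiset.card_map]
  set l := labelOf n k a.2
  have hn2 : n ^ 2 = 2 ^ (2 * L) := by rw [hP.hn, ← pow_mul, mul_comm]
  have hw : n ^ 2 / 2 ^ j = 2 ^ (2 * L - j) := by rw [hn2, Nat.pow_div hjL (by norm_num)]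
  have hbit : n ^ 2 / 2 ^ (l + 1) = 2 ^ (2 * L - (l + 1)) := by
    rw [hn2, Nat.pow_div (by omega) (by norm_num)]
  -- Processor 0 is the witness: as l < j, the flipped bit is among the j leading ones, so every
  -- dummy of its VPs leaves the block.
  have hsub : Finset.range (n ^ 2 / 2 ^ j) ⊆ (Finset.range (n ^ 2)).filter fun r =>
      StaticAlg.block (n ^ 2) (2 ^ j) r = 0 ∧
        StaticAlg.block (n ^ 2) (2 ^ j) (r ^^^ (n ^ 2 / 2 ^ (l + 1))) ≠ 0 := by
    intro r hr
    rw [Finset.mem_range] at hr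
    have h0 : r / (n ^ 2 / 2 ^ j) = 0 := Nat.div_eq_of_lt hr
    refine Finset.mem_filter.2 ⟨Finset.mem_range.2 (hr.trans_le (Nat.div_le_self _ _)), h0, ?_⟩
    rw [StaticAlg.block, hbit]
    rw [hw] at h0 ⊢
    rw [← Nat.shiftRight_eq_div_pow] at h0 ⊢
    rw [Nat.shiftRight_xor_distrib, h0, Nat.zero_xor, Nat.shiftRight_eq_div_pow,
      Nat.pow_div (by omega) (by norm_num)]
    positivity
  have := Finset.card_le_card hsub
  rw [Finset.card_range] at this
  exact this

/-- On both foldings the cumulative degree is the number of supersteps times the block size, up to a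
factor between 1 and `msgBound`. -/
theorem alg_isWise (hP : Params n k L e) (hL : 0 < L) :
    (alg n k).IsWise (1 / msgBound) (n ^ 2) := by
  intro j hj1 hj
  have hn2 : n ^ 2 = 2 ^ (2 * L) := by rw [hP.hn, ← pow_mul, mul_comm]
  have hjL : j ≤ 2 * L := by
    rw [lg, hn2, Nat.log_pow (by norm_num)] at hj
    omega
  have hdvd : 2 ^ j ∣ n ^ 2 := hn2 ▸ pow_dvd_pow 2 hjL
  have hw : ((n ^ 2 / 2 ^ j : ℕ) : ℝ) = (n ^ 2 : ℕ) / 2 ^ j := by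
    rw [Nat.cast_div hdvd (by positivity)]; push_cast; rfl
  have hup : ∀ i, ((alg n k).F i (n ^ 2) : ℝ) ≤ msgBound * ((alg n k).steps i).card := by
    intro i
    have : (alg n k).F i (n ^ 2) ≤ ((alg n k).steps i).card • msgBound := by
      refine Finset.sum_le_card_nsmul _ _ _ fun s hs => ?_
      have hs := Finset.mem_range.1 (Finset.mem_filter.1 hs).1
      have := degree_alg_le hP ⟨2 * L, hn2⟩ le_rfl hs
      rwa [Nat.div_self (by have := hP.pos; positivity), one_mul] at this
    rw [smul_eq_mul, mul_comm] at this
    exact_mod_cast this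
  have hlow : ∀ i < j, ((n ^ 2 / 2 ^ j : ℕ) : ℝ) * ((alg n k).steps i).card ≤
      (alg n k).F i (2 ^ j) := by
    intro i hij
    have : ((alg n k).steps i).card • (n ^ 2 / 2 ^ j) ≤ (alg n k).F i (2 ^ j) := by
      refine Finset.card_nsmul_le_sum _ _ _ fun s hs => ?_
      obtain ⟨h1, h2⟩ := Finset.mem_filter.1 hs
      exact le_degree_alg hP (Finset.mem_range.1 h1) (by omega) hjL
    rw [smul_eq_mul, mul_comm] at this
    exact_mod_cast this
  have hb : (0 : ℝ) < msgBound := by norm_num [msgBound]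
  rw [← hw]
  set w : ℝ := ((n ^ 2 / 2 ^ j : ℕ) : ℝ) with hwdef
  have hw0 : 0 ≤ w := Nat.cast_nonneg _
  rw [Finset.mul_sum]
  refine Finset.sum_le_sum fun i hi => ?_
  calc 1 / (msgBound : ℝ) * w * (alg n k).F i (n ^ 2)
      ≤ 1 / (msgBound : ℝ) * w * (msgBound * ((alg n k).steps i).card) := by
        gcongr; exact hup i
    _ = w * ((alg n k).steps i).card := by field_simp
    _ ≤ _ := hlow i (Finset.mem_range.1 hi)

/-! ### Number of supersteps -/

/-- With N_d the count, N_{d+1} ≤ (4k - 2)(1 + N_d). The summand 2 on the left makes the induction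
close. -/
theorem countP_phases_le (hP : Params n k L e) (m d : ℕ) (ρ : List ℕ) :
    (phases n k m ρ).countP (fun τ => decide (τ.length ≤ ρ.length + d)) + 2 ≤
      2 * (4 * k) ^ d := by
  have hk := hP.one_lt_k
  induction d generalizing m ρ with
  | zero =>
    rw [pow_zero, mul_one, List.countP_eq_zero.2]
    intro τ hτ
    obtain ⟨a, x, rfl, -⟩ := exists_eq_append_of_mem_phases hτ
    simp
  | succ d ih =>
    have hpos : 1 ≤ (4 * k) ^ d := Nat.one_le_pow _ _ (by omega)
    rcases m with _ | m
    · simp only [phases, List.countP_nil, pow_succ]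
      nlinarith
    rw [phases, List.countP_flatMap]
    have hsum := List.sum_le_card_nsmul
      ((List.range (4 * fan n k ρ.length - 2)).map
        (List.countP (fun τ => decide (τ.length ≤ ρ.length + (d + 1))) ∘ fun r =>
          (ρ ++ [r]) :: (if r < 4 * fan n k ρ.length - 3 then phases n k m (ρ ++ [r]) else [])))
      (2 * (4 * k) ^ d - 1) (by
        intro x hx
        obtain ⟨r, -, rfl⟩ := List.mem_map.1 hx
        simp only [Function.comp_apply, List.countP_cons]
        have h1 := ih m (ρ ++ [r])
        have hlen : (ρ ++ [r]).length + d = ρ.length + (d + 1) := by simp; omega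
        rw [hlen] at h1
        have h2 : ∀ b : Bool, (if b = true then 1 else 0) ≤ 1 := by decide
        have h3 := h2 (decide ((ρ ++ [r]).length ≤ ρ.length + (d + 1)))
        have h4 : List.countP (fun τ => decide (τ.length ≤ ρ.length + (d + 1)))
            (if r < 4 * fan n k ρ.length - 3 then phases n k m (ρ ++ [r]) else []) ≤
            List.countP (fun τ => decide (τ.length ≤ ρ.length + (d + 1)))
              (phases n k m (ρ ++ [r])) := by
          split_ifs
          · exact le_rfl
          · exact Nat.zero_le _
        omega)
    rw [List.length_map, List.length_range, smul_eq_mul] at hsum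
    refine (Nat.add_le_add_right hsum 2).trans ?_
    have hfan := hP.fan_le ρ.length
    obtain ⟨y, hy⟩ : ∃ y, 2 * (4 * k) ^ d = y + 1 := ⟨2 * (4 * k) ^ d - 1, by omega⟩
    have h1 : (4 * fan n k ρ.length - 2) * (2 * (4 * k) ^ d - 1) ≤ 4 * k * y := by
      rw [hy, Nat.add_sub_cancel]
      exact Nat.mul_le_mul_right _ (by omega)
    have h2 : 2 * (4 * k) ^ (d + 1) = 4 * k * (y + 1) := by rw [← hy, pow_succ]; ring
    rw [h2, mul_add]
    omega

theorem countP_schedule_le (hP : Params n k L e) (d : ℕ) :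
    (schedule n k).countP (fun a => decide (a.2.length ≤ d)) ≤ 34 * (4 * k) ^ d := by
  rw [schedule, List.countP_flatMap]
  have hsum := List.sum_le_card_nsmul
    (stages.map (List.countP (fun a : Cell × List ℕ => decide (a.2.length ≤ d)) ∘ fun g =>
      ([] :: phases n k (depth n k) []).map fun ρ => (g, ρ))) (2 * (4 * k) ^ d) (by
      intro x hx
      obtain ⟨g, -, rfl⟩ := List.mem_map.1 hx
      simp only [Function.comp_apply, List.countP_map, List.countP_cons]
      have h1 := countP_phases_le hP (depth n k) d []
      simp only [List.length_nil, zero_add] at h1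
      have h2 : ∀ b : Bool, (if b = true then 1 else 0) ≤ 1 := by decide
      have h4 := h2 (decide (([] : List ℕ).length ≤ d))
      have h3 : List.countP ((fun a : Cell × List ℕ => decide (a.2.length ≤ d)) ∘ fun ρ => (g, ρ))
          (phases n k (depth n k) []) =
          List.countP (fun τ => decide (τ.length ≤ d)) (phases n k (depth n k) []) := rfl
      rw [h3]
      omega)
  have hlen : stages.length = 17 := by decide
  rw [List.length_map, hlen, smul_eq_mul] at hsum
  omega

theorem sum_card_steps_le (hP : Params n k L e) {b d : ℕ}
    (hd : ∀ ρ : List ℕ, ρ.length ≤ depth n k → labelOf n k ρ < b → ρ.length ≤ d) :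
    ∑ i ∈ Finset.range b, ((alg n k).steps i).card ≤ 34 * (4 * k) ^ d := by
  have h1 : ∑ i ∈ Finset.range b, ((alg n k).steps i).card =
      ((Finset.range (alg n k).len).filter fun s => (alg n k).label s < b).card := by
    rw [Finset.card_eq_sum_card_fiberwise (f := (alg n k).label) (t := Finset.range b)]
    · refine Finset.sum_congr rfl fun i hi => ?_
      rw [StaticAlg.steps, Finset.filter_filter]
      congr 1
      refine Finset.filter_congr fun s _ => ?_
      have := Finset.mem_range.1 hi
      constructor
      · intro h; exact ⟨by omega, h⟩
      · exact fun h => h.2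
    · intro s hs
      exact Finset.mem_coe.2 (Finset.mem_range.2 (Finset.mem_filter.1 (Finset.mem_coe.1 hs)).2)
  rw [h1]
  refine le_trans ?_ (countP_schedule_le hP d)
  rw [List.countP_eq_length_filter]
  refine le_trans ?_ (List.toFinset_card_le _)
  refine le_trans (Finset.card_le_card ?_) (Finset.card_image_le (f := (schedule n k).idxOf))
  intro s hs
  obtain ⟨hs, hsb⟩ := Finset.mem_filter.1 hs
  obtain ⟨a, ha, rfl⟩ := exists_eq_idxOf (Finset.mem_range.1 hs)
  rw [alg_label_idxOf ha] at hsb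
  refine Finset.mem_image.2 ⟨a, List.mem_toFinset.2 (List.mem_filter.2 ⟨ha, ?_⟩), rfl⟩
  exact decide_eq_true (hd _ (length_le_depth ha) hsb)

/-- Labels below `b` occur only on the first `d` levels. In (4k)^d = 4^d · k · k^(d-1), the last
factor is at most the square root of 2^b, and 4^d · k ≤ 4^e · 2^e because d ≤ `depth` ≤ e; this is
the source of the overhead 8^√(log n). -/
theorem sum_card_steps_sqrt_le (hP : Params n k L e) (hL : 0 < L) (hD : depth n k ≤ e) {b : ℕ}
    (hb : 1 ≤ b) : (∑ i ∈ Finset.range b, (((alg n k).steps i).card : ℝ)) ≤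
      34 * 8 ^ e * Real.sqrt ((2 ^ b : ℕ) : ℝ) := by
  set d := min (depth n k) ((b - 1) / (2 * e) + 1) with hd
  have he := hP.he
  have hD1 : 0 < depth n k := hP.lt_depth_iff.2 (by simpa using hL)
  have hd1 : 1 ≤ d := le_min hD1 (Nat.succ_le_succ (Nat.zero_le _))
  have hcount := sum_card_steps_le hP (b := b) (d := d) (by
    intro ρ h1 h2
    refine le_min h1 ?_
    rw [hP.labelOf_eq h1] at h2
    have : ρ.length - 1 ≤ (b - 1) / (2 * e) := by
      rw [Nat.le_div_iff_mul_le (by omega)]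
      have : (ρ.length - 1) * (2 * e) = 2 * (e * (ρ.length - 1)) := by ring
      omega
    omega)
  have hcount' : (∑ i ∈ Finset.range b, (((alg n k).steps i).card : ℝ)) ≤ 34 * (4 * (k : ℝ)) ^ d := by
    exact_mod_cast hcount
  refine hcount'.trans ?_
  rw [mul_assoc]
  refine mul_le_mul_of_nonneg_left ?_ (by norm_num)
  have hsq : (k : ℝ) ^ (d - 1) ≤ Real.sqrt ((2 ^ b : ℕ) : ℝ) := by
    refine Real.le_sqrt_of_sq_le ?_
    rw [hP.hk]
    norm_cast
    rw [← pow_mul, ← pow_mul, ← mul_assoc]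
    refine Nat.pow_le_pow_right (by norm_num) ?_
    have h1 : d - 1 ≤ (b - 1) / (2 * e) := by
      have : d ≤ (b - 1) / (2 * e) + 1 := min_le_right _ _
      omega
    have h2 : (d - 1) * (2 * e) ≤ b - 1 := (Nat.le_div_iff_mul_le (by omega)).1 h1
    calc e * (d - 1) * 2 = (d - 1) * (2 * e) := by ring
      _ ≤ b := by omega
  have h4 : (4 : ℝ) ^ d * k ≤ 8 ^ e := by
    have : 4 ^ d * k ≤ 8 ^ e := by
      rw [hP.hk]
      calc 4 ^ d * 2 ^ e ≤ 4 ^ e * 2 ^ e :=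
            Nat.mul_le_mul_right _ (Nat.pow_le_pow_right (by norm_num) ((min_le_left _ _).trans hD))
        _ = 8 ^ e := by rw [← mul_pow]; norm_num
    exact_mod_cast this
  calc (4 * (k : ℝ)) ^ d = 4 ^ d * k * (k : ℝ) ^ (d - 1) := by
        obtain ⟨d', hd'⟩ : ∃ d', d = d' + 1 := ⟨d - 1, by omega⟩
        rw [hd', Nat.add_sub_cancel, mul_pow, pow_succ (k : ℝ)]; ring
    _ ≤ 8 ^ e * Real.sqrt ((2 ^ b : ℕ) : ℝ) := by gcongr

theorem H_alg_le (hP : Params n k L e) (hL : 0 < L) (hD : depth n k ≤ e) {p : ℕ} (hp : IsPowTwo p)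
    (hp1 : 1 < p) (hpn : p ≤ n ^ 2) {σ C : ℝ} (hσ0 : 0 ≤ σ) (hσ : σ ≤ C * ((n : ℝ) ^ 2 / p)) :
    (alg n k).H p σ ≤ 34 * (msgBound + C) * 8 ^ e * ((n : ℝ) ^ 2 / Real.sqrt p) := by
  obtain ⟨hp0, hdiv⟩ := exists_mul_eq_of_le hP hp hpn
  obtain ⟨b, rfl⟩ := hp
  have hb : 1 ≤ b := by
    by_contra h
    rw [show b = 0 by omega] at hp1
    omega
  have hlg : lg (2 ^ b) = b := by rw [lg, Nat.log_pow (by norm_num)]; omega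
  set P : ℝ := ((2 ^ b : ℕ) : ℝ) with hPdef
  have hP0 : 0 < P := by positivity
  have hw : ((n ^ 2 / 2 ^ b : ℕ) : ℝ) = (n : ℝ) ^ 2 / P := by
    rw [eq_div_iff hP0.ne', hPdef, ← Nat.cast_mul, hdiv, Nat.cast_pow]
  set W : ℝ := (n : ℝ) ^ 2 / P with hW
  have hW0 : 0 ≤ W := by positivity
  have hterm : ∀ i, ((alg n k).F i (2 ^ b) : ℝ) ≤ ((alg n k).steps i).card * (W * msgBound) := by
    intro i
    have : (alg n k).F i (2 ^ b) ≤ ((alg n k).steps i).card • (n ^ 2 / 2 ^ b * msgBound) :=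
      Finset.sum_le_card_nsmul _ _ _ fun s hs =>
        degree_alg_le hP ⟨b, rfl⟩ hpn (Finset.mem_range.1 (Finset.mem_filter.1 hs).1)
    rw [smul_eq_mul] at this
    rw [← hw]
    exact_mod_cast this
  have hs0 : 0 < Real.sqrt P := Real.sqrt_pos.2 hP0
  have hss : Real.sqrt P * Real.sqrt P = P := Real.mul_self_sqrt hP0.le
  have hMC : 0 ≤ W * msgBound + σ := by positivity
  rw [StaticAlg.H, hlg]
  calc ∑ i ∈ Finset.range b, (((alg n k).F i (2 ^ b) : ℝ) + ((alg n k).steps i).card * σ)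
      ≤ ∑ i ∈ Finset.range b, (((alg n k).steps i).card : ℝ) * (W * msgBound + σ) := by
        refine Finset.sum_le_sum fun i _ => ?_
        have := hterm i
        linarith
    _ = (∑ i ∈ Finset.range b, (((alg n k).steps i).card : ℝ)) * (W * msgBound + σ) := by
        rw [Finset.sum_mul]
    _ ≤ 34 * 8 ^ e * Real.sqrt P * (W * msgBound + C * W) := by
        refine mul_le_mul (sum_card_steps_sqrt_le hP hL hD hb) (by linarith) hMC (by positivity)
    _ = 34 * (msgBound + C) * 8 ^ e * (Real.sqrt P * W) := by ring
    _ = _ := by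
        congr 1
        rw [hW]
        field_simp
        rw [sq, hss, mul_comm]

end OctTet

end NetObl

namespace NetObl

/-! ### Load balance -/

/-- If both halves of the processing elements evaluate a fraction `δ` of the nodes, then no
processor of a folding evaluates more than a fraction `1 - δ`. -/
theorem StaticAlg.load_le_of_halves {V : Type} {q : ℕ} (A : StaticAlg V (2 * q)) (nodes : Finset V)
    (δ : ℝ) (hlo : δ * nodes.card ≤ ((nodes.filter fun u => A.owner u < q).card : ℝ))
    (hhi : δ * nodes.card ≤ ((nodes.filter fun u => ¬ A.owner u < q).card : ℝ)) {p : ℕ}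
    (hp : 0 < p) (hpq : p ∣ q) (hq : 0 < q) (j : ℕ) :
    (A.load nodes (2 * p) j : ℝ) ≤ (1 - δ) * nodes.card := by
  obtain ⟨w, rfl⟩ := hpq
  have hw : 0 < w := Nat.pos_of_mul_pos_left hq
  have hblock : ∀ r, block (2 * (p * w)) (2 * p) r = r / w := by
    intro r
    rw [block, ← mul_assoc, Nat.mul_div_cancel_left _ (by omega)]
  have hsum := Finset.card_filter_add_card_filter_not (s := nodes) (fun u => A.owner u < p * w)
  have hsum' : ((nodes.filter fun u => A.owner u < p * w).card : ℝ) +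
      ((nodes.filter fun u => ¬ A.owner u < p * w).card : ℝ) = nodes.card := by exact_mod_cast hsum
  rw [load]
  simp only [hblock]
  rcases Nat.lt_or_ge j p with hj | hj
  · have : (nodes.filter fun u => A.owner u / w = j).card ≤
        (nodes.filter fun u => A.owner u < p * w).card := by
      refine Finset.card_le_card fun u hu => ?_
      obtain ⟨h1, h2⟩ := Finset.mem_filter.1 hu
      exact Finset.mem_filter.2 ⟨h1, (Nat.div_lt_iff_lt_mul hw).1 (by omega)⟩
    have : ((nodes.filter fun u => A.owner u / w = j).card : ℝ) ≤
        ((nodes.filter fun u => A.owner u < p * w).card : ℝ) := by exact_mod_cast this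
    linarith
  · have : (nodes.filter fun u => A.owner u / w = j).card ≤
        (nodes.filter fun u => ¬ A.owner u < p * w).card := by
      refine Finset.card_le_card fun u hu => ?_
      obtain ⟨h1, h2⟩ := Finset.mem_filter.1 hu
      exact Finset.mem_filter.2 ⟨h1, fun h => by
        have := (Nat.div_lt_iff_lt_mul hw).2 h
        omega⟩
    have : ((nodes.filter fun u => A.owner u / w = j).card : ℝ) ≤
        ((nodes.filter fun u => ¬ A.owner u < p * w).card : ℝ) := by exact_mod_cast this
    linarith

namespace OctTet

variable {n k L e : ℕ}

theorem cellKey_lt {n : ℕ} {c d : Cell} (h : c.1 < d.1) (h2 : c.2.1 < 4 * n) (h3 : c.2.2.1 < 4 * n)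
    (h4 : c.2.2.2 < 4 * n) : cellKey n c < cellKey n d := by
  rw [cellKey, cellKey]
  set M := 4 * n
  have key : ∀ {x y b b' : ℕ}, x < y → b < M → x * M + b < y * M + b' := by
    intro x y b b' hxy hb
    have := Nat.mul_le_mul_right M (Nat.succ_le_of_lt hxy)
    rw [Nat.succ_mul] at this
    omega
  exact key (key (key h h2) h3) h4

/-- A node of the octahedron `(2, 1, 2, 1)` of level 0, given by a polyhedron of level 1 and a
position in it. Here `n = 32 q t`, the branching factor is `8 q`, and the side of the polyhedra of
level 1 is `4 t`. -/
def innerNode (q t a T c h f g : ℕ) : Node :=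
  (4 * (t * a) + 2 * (t * (8 * q - T)) + f, 4 * (t * c) + 2 * (t * (8 * q - T)) + g,
    2 * (t * T) + h)

/-- The constraints on the parameters of `innerNode`. -/
structure InnerParams (q t a T c h f g : ℕ) : Prop where
  ha : a < 7 * q
  hT : 7 * q ≤ T
  hT' : T < 8 * q
  hc : c < 7 * q
  hh : t ≤ h
  hh' : h < 3 * t
  hf : f < t
  hg : g < t

section

variable {q t a T c h f g : ℕ}

theorem InnerParams.coords (hI : InnerParams q t a T c h f g) (hn : n = 32 * (q * t)) :
    cx n (innerNode q t a T c h f g) = (16 * q + a) * (4 * t) + (h + f) ∧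
    cy n (innerNode q t a T c h f g) = (8 * q + (T - a)) * (4 * t) + (h - f) ∧
    cz n (innerNode q t a T c h f g) = (16 * q + c) * (4 * t) + (h + g) ∧
    ct n (innerNode q t a T c h f g) = (8 * q + (T - c)) * (4 * t) + (h - g) := by
  obtain ⟨ha, hT, hT', hc, hh, hh', hf, hg⟩ := hI
  have e1 : t * (8 * q - T) + t * T = 8 * (q * t) := by
    rw [← mul_add, Nat.sub_add_cancel hT'.le]; ring
  have e2 : t * (T - a) + t * a = t * T := by rw [← mul_add, Nat.sub_add_cancel (by omega)]
  have e3 : t * (T - c) + t * c = t * T := by rw [← mul_add, Nat.sub_add_cancel (by omega)]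
  have r1 : (16 * q + a) * (4 * t) = 64 * (q * t) + 4 * (t * a) := by ring
  have r2 : (8 * q + (T - a)) * (4 * t) = 32 * (q * t) + 4 * (t * (T - a)) := by ring
  have r3 : (16 * q + c) * (4 * t) = 64 * (q * t) + 4 * (t * c) := by ring
  have r4 : (8 * q + (T - c)) * (4 * t) = 32 * (q * t) + 4 * (t * (T - c)) := by ring
  simp only [cx, cy, cz, ct, innerNode]
  rw [r1, r2, r3, r4]
  omega

theorem InnerParams.mem (hI : InnerParams q t a T c h f g) (hn : n = 32 * (q * t)) :
    innerNode q t a T c h f g ∈ stencilNodes n := by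
  obtain ⟨ha, hT, hT', hc, hh, hh', hf, hg⟩ := hI
  have e1 : t * (8 * q - T) + t * T = 8 * (q * t) := by
    rw [← mul_add, Nat.sub_add_cancel hT'.le]; ring
  have e2 : t * a + t ≤ 7 * (q * t) := by
    have := Nat.mul_le_mul_left t ha
    rw [Nat.mul_succ] at this; linarith
  have e3 : t * c + t ≤ 7 * (q * t) := by
    have := Nat.mul_le_mul_left t hc
    rw [Nat.mul_succ] at this; linarith
  have e4 : t * T + t ≤ 8 * (q * t) := by
    have := Nat.mul_le_mul_left t hT'
    rw [Nat.mul_succ] at this; linarith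
  have e5 : 7 * (q * t) ≤ t * T := by
    have := Nat.mul_le_mul_left t hT
    linarith
  have e6 : t ≤ q * t := Nat.le_mul_of_pos_left t (by omega)
  rw [mem_stencilNodes]
  simp only [innerNode]
  omega

/-- Since t ≤ h < 3t and f, g < t, the residues h ± f and h ± g stay within [0, 4t). -/
theorem InnerParams.cell_one (hI : InnerParams q t a T c h f g) (hn : n = 32 * (q * t))
    (hs : side n k 1 = 4 * t) : cell n k 1 (innerNode q t a T c h f g) =
      (16 * q + a, 8 * q + (T - a), 16 * q + c, 8 * q + (T - c)) := by
  obtain ⟨h1, h2, h3, h4⟩ := hI.coords hn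
  obtain ⟨ha, hT, hT', hc, hh, hh', hf, hg⟩ := hI
  have ht : 0 < 4 * t := by omega
  rw [cell_eq, hs, h1, h2, h3, h4, div_eq_of_bounds ht (A := 16 * q + a) (by omega) (by omega),
    div_eq_of_bounds ht (A := 8 * q + (T - a)) (by omega) (by omega),
    div_eq_of_bounds ht (A := 16 * q + c) (by omega) (by omega),
    div_eq_of_bounds ht (A := 8 * q + (T - c)) (by omega) (by omega)]

theorem InnerParams.cell_zero (hI : InnerParams q t a T c h f g) (hP : Params n k L e)
    (hn : n = 32 * (q * t)) (hs : side n k 1 = 4 * t) (hκ : fan n k 0 = 8 * q) :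
    cell n k 0 (innerNode q t a T c h f g) = (2, 1, 2, 1) := by
  obtain ⟨h1, h2, h3, h4⟩ := hP.cell_succ_div 0 (innerNode q t a T c h f g)
  rw [zero_add, hI.cell_one hn hs, hκ] at h1 h2 h3 h4
  dsimp only at h1 h2 h3 h4
  obtain ⟨ha, hT, hT', hc, hh, hh', hf, hg⟩ := hI
  have hq : 0 < 8 * q := by omega
  rw [div_eq_of_bounds hq (A := 2) (by omega) (by omega)] at h1
  rw [div_eq_of_bounds hq (A := 1) (by omega) (by omega)] at h2
  rw [div_eq_of_bounds hq (A := 2) (by omega) (by omega)] at h3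
  rw [div_eq_of_bounds hq (A := 1) (by omega) (by omega)] at h4
  exact Prod.ext h1.symm (Prod.ext h2.symm (Prod.ext h3.symm h4.symm))

theorem InnerParams.mem_siblings_iff (hI : InnerParams q t a T c h f g) (hP : Params n k L e)
    (hn : n = 32 * (q * t)) (hs : side n k 1 = 4 * t) (hκ : fan n k 0 = 8 * q) (d : Cell) :
    d ∈ siblings n k 0 (innerNode q t a T c h f g) ↔
      (16 * q ≤ d.1 ∧ d.1 < 24 * q) ∧ (8 * q ≤ d.2.1 ∧ d.2.1 < 16 * q) ∧
      (16 * q ≤ d.2.2.1 ∧ d.2.2.1 < 24 * q) ∧ (8 * q ≤ d.2.2.2 ∧ d.2.2.2 < 16 * q) ∧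
      d.1 + d.2.1 = 24 * q + T ∧ d.2.2.1 + d.2.2.2 = 24 * q + T := by
  rw [siblings, Finset.mem_filter]
  simp only [zero_add, hI.cell_zero hP hn hs hκ, hI.cell_one hn hs, hκ, Finset.mem_product,
    Finset.mem_Ico, IsPoly, cellSum]
  obtain ⟨ha, hT, hT', hc, hh, hh', hf, hg⟩ := hI
  constructor <;> intro hd <;> omega

theorem InnerParams.injective {a' T' c' h' f' g' : ℕ} (hI : InnerParams q t a T c h f g)
    (hI' : InnerParams q t a' T' c' h' f' g')
    (heq : innerNode q t a T c h f g = innerNode q t a' T' c' h' f' g') :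
    a = a' ∧ T = T' ∧ c = c' ∧ h = h' ∧ f = f' ∧ g = g' := by
  obtain ⟨h1, h2, h3, -⟩ := hI.coords rfl
  obtain ⟨g1, g2, g3, -⟩ := hI'.coords rfl
  rw [heq, g1] at h1
  rw [heq, g2] at h2
  rw [heq, g3] at h3
  obtain ⟨ha, hT, hT', hc, hh, hh', hf, hg⟩ := hI
  obtain ⟨ka, kT, kT', kc, kh, kh', kf, kg⟩ := hI'
  have e1 := mul_add_inj (by omega) (by omega) h1
  have e2 := mul_add_inj (by omega) (by omega) h2
  have e3 := mul_add_inj (by omega) (by omega) h3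
  omega

theorem InnerParams.owner_eq (hI : InnerParams q t a T c h f g) :
    (alg n k).owner (innerNode q t a T c h f g) =
      base n k (depth n k) (innerNode q t a T c h f g) := by
  have : (innerNode q t a T c h f g).2.2 ≠ 0 := by
    obtain ⟨ha, hT, hT', hc, hh, hh', hf, hg⟩ := hI
    simp only [innerNode]
    omega
  simp only [alg, this, if_false]

theorem InnerParams.segSize_one (hI : InnerParams q t a T c h f g) (hn : n = 32 * (q * t))
    (hs : side n k 1 = 4 * t) :
    segSize n k 1 (cell n k 1 (innerNode q t a T c h f g)) = (4 * t) ^ 2 := by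
  rw [hI.cell_one hn hs, segSize, if_pos, hs]
  obtain ⟨ha, hT, hT', hc, hh, hh', hf, hg⟩ := hI
  simp only [IsOct]
  omega

/-- Octahedra whose rank in their stripe is high belong to the upper half of the processors. -/
theorem InnerParams.owner_ge (hI : InnerParams q t a T c h f g) (hP : Params n k L e)
    (hn : n = 32 * (q * t)) (hs : side n k 1 = 4 * t) (hκ : fan n k 0 = 8 * q)
    (hD : 1 ≤ depth n k) (ha6 : 6 * q ≤ a) :
    ¬ (alg n k).owner (innerNode q t a T c h f g) < 512 * (q * t) ^ 2 := by
  rw [hI.owner_eq, not_lt]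
  refine le_trans ?_ (Params.base_le_base n k _ hD)
  have hb : base n k 1 (innerNode q t a T c h f g) =
      0 + rank (cellKey n) (siblings n k 0 (innerNode q t a T c h f g))
        (cell n k 1 (innerNode q t a T c h f g)) *
          segSize n k 1 (cell n k 1 (innerNode q t a T c h f g)) := rfl
  rw [hb, hI.segSize_one hn hs, zero_add]
  -- At least 42q² octahedra with smaller first entry come before, and they occupy 42q² · 16t² =
  -- 672(qt)² VPs; half of the machine is 512(qt)².
  have hrank : (Finset.range (6 * q) ×ˢ Finset.range (7 * q)).card ≤
      rank (cellKey n) (siblings n k 0 (innerNode q t a T c h f g))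
        (cell n k 1 (innerNode q t a T c h f g)) := by
    refine Finset.card_le_card_of_injOn
      (fun x => (16 * q + x.1, 8 * q + (T - x.1), 16 * q + x.2, 8 * q + (T - x.2))) ?_ ?_
    · rintro ⟨x, y⟩ hxy
      rw [Finset.mem_coe, Finset.mem_product, Finset.mem_range, Finset.mem_range] at hxy
      dsimp only at hxy ⊢
      have ht : 0 < t := by have := hI.hf; omega
      have hnq : 32 * q ≤ n := by
        rw [hn]; exact Nat.mul_le_mul_left 32 (Nat.le_mul_of_pos_right q ht)
      have hT := hI.hT
      have hT' := hI.hT'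
      refine Finset.mem_coe.2 (Finset.mem_filter.2 ⟨?_, ?_⟩)
      · rw [hI.mem_siblings_iff hP hn hs hκ]
        dsimp only
        omega
      · rw [hI.cell_one hn hs]
        exact cellKey_lt (by dsimp only; omega) (by dsimp only; omega) (by dsimp only; omega)
          (by dsimp only; omega)
    · rintro ⟨x, y⟩ - ⟨x', y'⟩ - hxy
      simp only [Prod.mk.injEq] at hxy ⊢
      omega
  rw [Finset.card_product, Finset.card_range, Finset.card_range] at hrank
  have := Nat.mul_le_mul_right ((4 * t) ^ 2) hrank
  nlinarith [Nat.zero_le ((q * t) ^ 2)]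

/-- Octahedra whose rank in their stripe is low belong to the lower half of the processors. -/
theorem InnerParams.owner_lt (hI : InnerParams q t a T c h f g) (hP : Params n k L e)
    (hn : n = 32 * (q * t)) (hs : side n k 1 = 4 * t) (hκ : fan n k 0 = 8 * q)
    (hD : 1 ≤ depth n k) (ha6 : a < q) :
    (alg n k).owner (innerNode q t a T c h f g) < 512 * (q * t) ^ 2 := by
  rw [hI.owner_eq]
  have hmem := hI.mem hn
  have hnest : ∀ j, 1 ≤ j → j ≤ depth n k →
      base n k j (innerNode q t a T c h f g) +
        segSize n k j (cell n k j (innerNode q t a T c h f g)) ≤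
      base n k 1 (innerNode q t a T c h f g) +
        segSize n k 1 (cell n k 1 (innerNode q t a T c h f g)) := by
    intro j hj
    induction j, hj using Nat.le_induction with
    | base => exact fun _ => le_rfl
    | succ j _ ih =>
      exact fun hj => (hP.base_succ_add_segSize_le hj hmem).trans (ih (by omega))
  have h1 := hnest _ hD le_rfl
  have h2 := segSize_pos n k (depth n k) hmem
  refine lt_of_lt_of_le (lt_of_lt_of_le (Nat.lt_add_of_pos_right h2) h1) ?_
  have hb : base n k 1 (innerNode q t a T c h f g) =
      0 + rank (cellKey n) (siblings n k 0 (innerNode q t a T c h f g))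
        (cell n k 1 (innerNode q t a T c h f g)) *
          segSize n k 1 (cell n k 1 (innerNode q t a T c h f g)) := rfl
  rw [hb, hI.segSize_one hn hs, zero_add]
  have ht : 0 < t := by have := hI.hf; omega
  have hnq : 32 * q ≤ n := by
    rw [hn]; exact Nat.mul_le_mul_left 32 (Nat.le_mul_of_pos_right q ht)
  have hT := hI.hT
  have hT' := hI.hT'
  -- At most 8q² octahedra come before, so the segment ends by (8q² + 1) · 16t² ≤ 144(qt)².
  have hrank : rank (cellKey n) (siblings n k 0 (innerNode q t a T c h f g))
        (cell n k 1 (innerNode q t a T c h f g)) ≤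
      (Finset.Ico (16 * q) (17 * q) ×ˢ Finset.Ico (16 * q) (24 * q)).card := by
    refine Finset.card_le_card_of_injOn (fun d => (d.1, d.2.2.1)) ?_ ?_
    · intro d hd
      obtain ⟨hd, hlt⟩ := Finset.mem_filter.1 (Finset.mem_coe.1 hd)
      rw [hI.mem_siblings_iff hP hn hs hκ] at hd
      rw [hI.cell_one hn hs] at hlt
      have hc := hI.hc
      have hle : d.1 ≤ 16 * q + a := by
        by_contra! hgt
        refine absurd hlt (not_lt.2 (cellKey_lt hgt ?_ ?_ ?_).le) <;> dsimp only <;> omega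
      rw [Finset.mem_coe, Finset.mem_product, Finset.mem_Ico, Finset.mem_Ico]
      dsimp only
      omega
    · intro d hd d' hd' heq
      have hd := (Finset.mem_filter.1 (Finset.mem_coe.1 hd)).1
      have hd' := (Finset.mem_filter.1 (Finset.mem_coe.1 hd')).1
      rw [hI.mem_siblings_iff hP hn hs hκ] at hd hd'
      simp only [Prod.mk.injEq] at heq
      exact Prod.ext heq.1 (Prod.ext (by omega) (Prod.ext heq.2 (by omega)))
  rw [Finset.card_product, Nat.card_Ico, Nat.card_Ico, show 17 * q - 16 * q = q by omega,
    show 24 * q - 16 * q = 8 * q by omega] at hrank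
  have h3 := Nat.mul_le_mul_right ((4 * t) ^ 2) hrank
  have hq : 1 ≤ q := by omega
  have h4 : t ^ 2 ≤ (q * t) ^ 2 := Nat.pow_le_pow_left (Nat.le_mul_of_pos_left t hq) 2
  nlinarith

end

/-- A set of nodes that contains all inner nodes with a certain range of the first parameter. -/
theorem le_card_of_innerNode {q t a₀ : ℕ} (ha₀ : a₀ + q ≤ 7 * q) (X : Finset Node)
    (hX : ∀ a T c h f g, InnerParams q t a T c h f g → a₀ ≤ a → a < a₀ + q →
      innerNode q t a T c h f g ∈ X) : 14 * (q * t) ^ 3 ≤ X.card := by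
  let D := Finset.Ico a₀ (a₀ + q) ×ˢ Finset.Ico (7 * q) (8 * q) ×ˢ Finset.range (7 * q) ×ˢ
    Finset.Ico t (3 * t) ×ˢ Finset.range t ×ˢ Finset.range t
  have hD : D.card = 14 * (q * t) ^ 3 := by
    simp only [D, Finset.card_product, Nat.card_Ico, Finset.card_range]
    rw [Nat.add_sub_cancel_left, show 8 * q - 7 * q = q by omega, show 3 * t - t = 2 * t by omega]
    ring
  have hpar : ∀ x ∈ D, InnerParams q t x.1 x.2.1 x.2.2.1 x.2.2.2.1 x.2.2.2.2.1 x.2.2.2.2.2 ∧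
      a₀ ≤ x.1 ∧ x.1 < a₀ + q := by
    intro x hx
    simp only [D, Finset.mem_product, Finset.mem_Ico, Finset.mem_range] at hx
    exact ⟨⟨by omega, by omega, by omega, by omega, by omega, by omega, by omega, by omega⟩,
      by omega, by omega⟩
  rw [← hD]
  refine Finset.card_le_card_of_injOn
    (fun x => innerNode q t x.1 x.2.1 x.2.2.1 x.2.2.2.1 x.2.2.2.2.1 x.2.2.2.2.2) ?_ ?_
  · intro x hx
    obtain ⟨h1, h2, h3⟩ := hpar x (Finset.mem_coe.1 hx)
    exact hX _ _ _ _ _ _ h1 h2 h3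
  · intro x hx y hy heq
    obtain ⟨h1, h2, h3, h4, h5, h6⟩ := (hpar x (Finset.mem_coe.1 hx)).1.injective
      (hpar y (Finset.mem_coe.1 hy)).1 heq
    exact Prod.ext h1 (Prod.ext h2 (Prod.ext h3 (Prod.ext h4 (Prod.ext h5 h6))))

/-- Both halves of the virtual processors hold half of the inputs. -/
theorem le_card_half_inputs (m : ℕ) (hn : n = 2 * m) :
    n * m ≤ ((stencilNodes n).filter fun u => (alg n k).owner u < n * m).card ∧
    n * m ≤ ((stencilNodes n).filter fun u => ¬ (alg n k).owner u < n * m).card := by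
  have hown : ∀ x y : ℕ, (alg n k).owner (x, y, 0) = x + n * y := by
    intro x y; simp [alg, inputVP]
  have hinj : ∀ S : Set (ℕ × ℕ), Set.InjOn (fun z : ℕ × ℕ => ((z.1, z.2, 0) : Node)) S := by
    intro S x _ y _ h
    simp only [Prod.mk.injEq, and_true] at h
    exact Prod.ext h.1 h.2
  constructor
  · have : (Finset.range n ×ˢ Finset.range m).card ≤
        ((stencilNodes n).filter fun u => (alg n k).owner u < n * m).card := by
      refine Finset.card_le_card_of_injOn (fun z => (z.1, z.2, 0)) ?_ (hinj _)
      rintro ⟨x, y⟩ hxy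
      rw [Finset.mem_coe, Finset.mem_product, Finset.mem_range, Finset.mem_range] at hxy
      dsimp only at hxy ⊢
      refine Finset.mem_coe.2 (Finset.mem_filter.2 ⟨mem_stencilNodes.2 (by dsimp only; omega), ?_⟩)
      rw [hown]
      have := Nat.mul_le_mul_left n hxy.2
      rw [Nat.mul_succ] at this
      omega
    simpa [Finset.card_product] using this
  · have : (Finset.range n ×ˢ Finset.Ico m (2 * m)).card ≤
        ((stencilNodes n).filter fun u => ¬ (alg n k).owner u < n * m).card := by
      refine Finset.card_le_card_of_injOn (fun z => (z.1, z.2, 0)) ?_ (hinj _)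
      rintro ⟨x, y⟩ hxy
      rw [Finset.mem_coe, Finset.mem_product, Finset.mem_range, Finset.mem_Ico] at hxy
      dsimp only at hxy ⊢
      refine Finset.mem_coe.2 (Finset.mem_filter.2 ⟨mem_stencilNodes.2 (by dsimp only; omega), ?_⟩)
      rw [hown]
      have := Nat.mul_le_mul_left n hxy.2.1
      omega
    rw [Finset.card_product, Finset.card_range, Nat.card_Ico] at this
    rwa [show 2 * m - m = m by omega] at this

/-- For n ≤ 256 the inputs suffice, as each half holds n²/2 ≥ n³/512 of them. Otherwise each half
has 14(qt)³ inner nodes, while n³ = 32768(qt)³ and 14 · 4096 > 32768. -/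
theorem half_loads (hP : Params n k L e) (hL : 0 < L) (he : L ≤ 8 ∨ 3 ≤ e ∧ e + 2 ≤ L) :
    n ^ 3 ≤ 4096 * ((stencilNodes n).filter fun u => (alg n k).owner u < n ^ 2 / 2).card ∧
    n ^ 3 ≤ 4096 * ((stencilNodes n).filter fun u => ¬ (alg n k).owner u < n ^ 2 / 2).card := by
  rcases he with h8 | ⟨h3, h2⟩
  · obtain ⟨m, hm⟩ : ∃ m, n = 2 * m := ⟨2 ^ (L - 1), by
      rw [hP.hn, ← pow_succ']; congr 1; omega⟩
    have hn : n ≤ 256 := by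
      rw [hP.hn]; exact Nat.pow_le_pow_right (n := 2) (by norm_num) h8
    have h := le_card_half_inputs (k := k) m hm
    have hhalf : n ^ 2 / 2 = n * m := by
      rw [sq]; nth_rewrite 2 [hm]
      rw [show n * (2 * m) = 2 * (n * m) by ring, Nat.mul_div_cancel_left _ (by norm_num)]
    rw [hhalf]
    have hcube : n ^ 3 ≤ 4096 * (n * m) := by
      calc n ^ 3 = n * (2 * (n * m)) := by
            rw [show n ^ 3 = n * (n * n) by ring]; nth_rewrite 3 [hm]; ring
        _ ≤ 256 * (2 * (n * m)) := Nat.mul_le_mul_right _ hn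
        _ ≤ _ := by omega
    exact ⟨hcube.trans (Nat.mul_le_mul_left _ h.1), hcube.trans (Nat.mul_le_mul_left _ h.2)⟩
  · set q := 2 ^ (e - 3) with hq
    set t := 2 ^ (L - e - 2) with ht
    have hn : n = 32 * (q * t) := by
      rw [hP.hn, hq, ht, ← pow_add, show (32 : ℕ) = 2 ^ 5 by norm_num, ← pow_add]
      congr 1; omega
    have hs : side n k 1 = 4 * t := by
      rw [hP.side_eq, ht, show (4 : ℕ) = 2 ^ 2 by norm_num, ← pow_add]
      congr 1; omega
    have hκ : fan n k 0 = 8 * q := by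
      rw [hP.fan_eq, hq, show (8 : ℕ) = 2 ^ 3 by norm_num, ← pow_add]
      congr 1; omega
    have hD : 1 ≤ depth n k := hP.lt_depth_iff.2 (by omega)
    have hhalf : n ^ 2 / 2 = 512 * (q * t) ^ 2 := by
      rw [hn, show (32 * (q * t)) ^ 2 = 2 * (512 * (q * t) ^ 2) by ring,
        Nat.mul_div_cancel_left _ (by norm_num)]
    have hcube : n ^ 3 ≤ 4096 * (14 * (q * t) ^ 3) := by
      rw [hn, show (32 * (q * t)) ^ 3 = 32768 * (q * t) ^ 3 by ring]; omega
    rw [hhalf]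
    constructor
    · refine hcube.trans (Nat.mul_le_mul_left _ (le_card_of_innerNode (a₀ := 0) (by omega) _ ?_))
      intro a T c h f g hI _ ha
      exact Finset.mem_filter.2 ⟨hI.mem hn, hI.owner_lt hP hn hs hκ hD (by omega)⟩
    · refine hcube.trans (Nat.mul_le_mul_left _
        (le_card_of_innerNode (a₀ := 6 * q) (by omega) _ ?_))
      intro a T c h f g hI ha _
      exact Finset.mem_filter.2 ⟨hI.mem hn, hI.owner_ge hP hn hs hκ hD ha⟩

theorem load_alg_le (hP : Params n k L e) (hL : 0 < L) (he : L ≤ 8 ∨ 3 ≤ e ∧ e + 2 ≤ L) {p : ℕ}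
    (hp : IsPowTwo p) (hp2 : 2 ≤ p) (hpn : p ≤ n ^ 2) (j : ℕ) :
    ((alg n k).load (stencilNodes n) p j : ℝ) ≤ 4095 / 4096 * (n : ℝ) ^ 3 := by
  obtain ⟨h1, h2⟩ := half_loads (k := k) hP hL he
  obtain ⟨b, rfl⟩ := hp
  have hb : b ≠ 0 := by rintro rfl; omega
  have hn2 : n ^ 2 = 2 * 2 ^ (2 * L - 1) := by
    rw [hP.hn, ← pow_mul, ← pow_succ']; congr 1; omega
  have hbL : b - 1 ≤ 2 * L - 1 := by
    rw [hP.hn, ← pow_mul] at hpn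
    have := (Nat.pow_le_pow_iff_right (by norm_num : 1 < 2)).1 hpn
    omega
  have hpb : 2 ^ b = 2 * 2 ^ (b - 1) := by rw [← pow_succ']; congr 1; omega
  have hcard : ((stencilNodes n).card : ℝ) = (n : ℝ) ^ 3 := by
    rw [card_stencilNodes]; push_cast; rfl
  have h1' : (n : ℝ) ^ 3 ≤
      4096 * ((stencilNodes n).filter fun u => (alg n k).owner u < n ^ 2 / 2).card := by
    exact_mod_cast h1
  have h2' : (n : ℝ) ^ 3 ≤
      4096 * ((stencilNodes n).filter fun u => ¬ (alg n k).owner u < n ^ 2 / 2).card := by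
    exact_mod_cast h2
  -- A variable `N` takes the place of n², so that the index in the type of the algorithm can be
  -- rewritten as an even number.
  have hmain : ∀ (N : ℕ) (A : StaticAlg Node N), N = 2 * 2 ^ (2 * L - 1) →
      (n : ℝ) ^ 3 ≤ 4096 * ((stencilNodes n).filter fun u => A.owner u < N / 2).card →
      (n : ℝ) ^ 3 ≤ 4096 * ((stencilNodes n).filter fun u => ¬ A.owner u < N / 2).card →
      (A.load (stencilNodes n) (2 ^ b) j : ℝ) ≤ 4095 / 4096 * (n : ℝ) ^ 3 := by
    rintro N A rfl g1 g2
    rw [Nat.mul_div_cancel_left _ (by norm_num)] at g1 g2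
    have := A.load_le_of_halves (stencilNodes n) (1 / 4096) (by rw [hcard]; linarith)
      (by rw [hcard]; linarith) (p := 2 ^ (b - 1)) (by positivity) (pow_dvd_pow 2 hbL)
      (by positivity) j
    rw [hcard, ← hpb] at this
    linarith
  exact hmain _ _ hn2 h1' h2'

end OctTet

end NetObl

/-! ### Choice of the branching exponent and assembly of the theorem -/

namespace NetObl

theorem rlog_natCast_two_pow {L : ℕ} (hL : 0 < L) : rlog ((2 ^ L : ℕ) : ℝ) = L := by
  have h1 : (1 : ℝ) ≤ L := by exact_mod_cast hL
  rw [rlog, Nat.cast_pow, Nat.cast_ofNat, Real.logb_pow, Real.logb_self_eq_one one_lt_two,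
    mul_one, max_eq_right h1]

namespace OctTet

/-- The branching exponent of the algorithm. -/
noncomputable def branchExp (n : ℕ) : ℕ := ⌈Real.sqrt (rlog n)⌉₊

theorem sqrt_rlog_le_branchExp (n : ℕ) : Real.sqrt (rlog n) ≤ branchExp n := Nat.le_ceil _

theorem branchExp_lt_sqrt_rlog_add_one (n : ℕ) : (branchExp n : ℝ) < Real.sqrt (rlog n) + 1 :=
  Nat.ceil_lt_add_one (Real.sqrt_nonneg _)

theorem params_branchExp (L : ℕ) :
    Params (2 ^ L) (2 ^ branchExp (2 ^ L)) L (branchExp (2 ^ L)) where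
  hn := rfl
  hk := rfl
  he := Nat.ceil_pos.2 (Real.sqrt_pos.2 (zero_lt_one.trans_le (le_max_left _ _)))

/-- Rounding √(log n) up costs at most one more factor 8. -/
theorem eight_pow_branchExp_le (n : ℕ) :
    (8 : ℝ) ^ branchExp n ≤ 8 * (8 : ℝ) ^ Real.sqrt (rlog n) := by
  have h := Real.rpow_le_rpow_of_exponent_le (x := 8) (by norm_num)
    (branchExp_lt_sqrt_rlog_add_one n).le
  rw [Real.rpow_natCast, Real.rpow_add (by norm_num), Real.rpow_one] at h
  linarith

theorem le_branchExp_mul_self {L : ℕ} (hL : 0 < L) :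
    L ≤ branchExp (2 ^ L) * branchExp (2 ^ L) := by
  have h := sqrt_rlog_le_branchExp (2 ^ L)
  rw [rlog_natCast_two_pow hL, Real.sqrt_le_left (Nat.cast_nonneg _)] at h
  rw [← sq]
  exact_mod_cast h

theorem branchExp_sub_one_sq_lt {L : ℕ} (hL : 0 < L) :
    (branchExp (2 ^ L) - 1) ^ 2 < L := by
  have h := branchExp_lt_sqrt_rlog_add_one (2 ^ L)
  have he := (params_branchExp L).he
  rw [rlog_natCast_two_pow hL, ← sub_lt_iff_lt_add, ← Nat.cast_pred he,
    Real.lt_sqrt (Nat.cast_nonneg _)] at h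
  exact_mod_cast h

/-- The choice of e balances branching and depth: e² ≥ L, so e levels of L/e bits or more exhaust L.
-/
theorem depth_le_branchExp {L : ℕ} (hL : 0 < L) :
    depth (2 ^ L) (2 ^ branchExp (2 ^ L)) ≤ branchExp (2 ^ L) := by
  by_contra! h
  rw [(params_branchExp L).lt_depth_iff] at h
  exact absurd (le_branchExp_mul_self hL) (not_le.2 h)

/-- Beyond L = 8, e² ≥ L gives e ≥ 3 and (e - 1)² < L gives e + 2 ≤ L; then 8 divides k, and 4
divides the side of level 1, as `innerNode` requires. -/
theorem branchExp_bounds {L : ℕ} (hL : 0 < L) :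
    L ≤ 8 ∨ 3 ≤ branchExp (2 ^ L) ∧ branchExp (2 ^ L) + 2 ≤ L := by
  refine or_iff_not_imp_left.2 fun h8 => ?_
  have h1 := le_branchExp_mul_self hL
  have h2 := branchExp_sub_one_sq_lt hL
  have h3 : 3 ≤ branchExp (2 ^ L) := by
    by_contra! h
    have := Nat.mul_le_mul (Nat.le_of_lt_succ h) (Nat.le_of_lt_succ h)
    omega
  refine ⟨h3, ?_⟩
  obtain ⟨d, hd⟩ := Nat.exists_eq_add_of_le' h3
  rw [hd, show d + 3 - 1 = d + 2 by omega] at h2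
  nlinarith [h2]

end OctTet

theorem pos_of_one_lt_le_two_pow_sq {L p : ℕ} (hp1 : 1 < p) (hpn : p ≤ (2 ^ L) ^ 2) : 0 < L := by
  rcases Nat.eq_zero_or_pos L with rfl | h
  · norm_num at hpn
    omega
  · exact h

theorem stencilAlg_evaluates {n : ℕ} (hn : IsPowTwo n) :
    (stencilAlg n).Evaluates (stencilNodes n) Arc := by
  obtain ⟨L, rfl⟩ := hn
  exact OctTet.alg_evaluates (OctTet.params_branchExp L)

theorem H_stencilAlg_le {n p : ℕ} {C σ : ℝ} (hn : IsPowTwo n) (hp : IsPowTwo p) (hp1 : 1 < p)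
    (hpn : p ≤ n ^ 2) (hC : 0 ≤ C) (hσ0 : 0 ≤ σ) (hσ : σ ≤ C * ((n : ℝ) ^ 2 / p)) :
    (stencilAlg n).H p σ ≤ 34 * (OctTet.msgBound + C) * 8 *
      ((n : ℝ) ^ 2 / Real.sqrt p * (8 : ℝ) ^ Real.sqrt (rlog n)) := by
  obtain ⟨L, rfl⟩ := hn
  have hL := pos_of_one_lt_le_two_pow_sq hp1 hpn
  refine (OctTet.H_alg_le (OctTet.params_branchExp L) hL (OctTet.depth_le_branchExp hL) hp hp1 hpn
    hσ0 hσ).trans ?_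
  have h8 := OctTet.eight_pow_branchExp_le (2 ^ L)
  have hx : 0 ≤ 34 * ((OctTet.msgBound : ℝ) + C) := by positivity
  have hy : 0 ≤ ((2 ^ L : ℕ) : ℝ) ^ 2 / Real.sqrt p := by positivity
  calc _ ≤ 34 * ((OctTet.msgBound : ℝ) + C) * (8 * (8 : ℝ) ^ Real.sqrt (rlog (2 ^ L : ℕ))) *
        (((2 ^ L : ℕ) : ℝ) ^ 2 / Real.sqrt p) := by gcongr
    _ = _ := by ring

theorem stencilAlg_isWise {n : ℕ} (hn : IsPowTwo n) (hn1 : 1 < n) :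
    (stencilAlg n).IsWise (1 / OctTet.msgBound) (n ^ 2) := by
  obtain ⟨L, rfl⟩ := hn
  exact OctTet.alg_isWise (OctTet.params_branchExp L) (Nat.one_lt_two_pow_iff.1 hn1).bot_lt

theorem stencilAlg_inClass {n : ℕ} {ε : ℝ} (hn : IsPowTwo n) (hε : 4095 / 4096 ≤ ε) :
    InClass ε n (stencilAlg n) := by
  refine ⟨stencilAlg_evaluates hn, fun p hp hp2 hpn j _ => ?_⟩
  obtain ⟨L, rfl⟩ := hn
  have hL := pos_of_one_lt_le_two_pow_sq hp2 hpn
  refine (OctTet.load_alg_le (OctTet.params_branchExp L) hL (OctTet.branchExp_bounds hL) hp hp2 hpn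
    j).trans ?_
  gcongr

/-- The minimum with 1 only serves to keep the optimality factor at most 1. -/
theorem stencilAlg_isOptimalOn {ε C c₀ : ℝ} (hε : 4095 / 4096 ≤ ε) (hC : 0 ≤ C) (hc₀ : 0 < c₀)
    {n p : ℕ} (hn : IsPowTwo n) (hp : IsPowTwo p) (hp1 : 1 < p) (hpn : p ≤ n ^ 2) {σ : ℝ}
    (hσ0 : 0 ≤ σ) (hσ : σ ≤ C * ((n : ℝ) ^ 2 / p))
    (hlb : ∀ B : StaticAlg Node p, InClass ε n B → c₀ * ((n : ℝ) ^ 2 / Real.sqrt p) ≤ B.H p σ) :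
    IsOptimalOn (min 1 (c₀ / (34 * (OctTet.msgBound + C) * 8)) /
      (8 : ℝ) ^ Real.sqrt (rlog n)) ε n p σ (stencilAlg n) := by
  have hK : 0 < 34 * ((OctTet.msgBound : ℝ) + C) * 8 := by
    have : (0 : ℝ) < OctTet.msgBound := by norm_num [OctTet.msgBound]
    positivity
  have hX : (1 : ℝ) ≤ (8 : ℝ) ^ Real.sqrt (rlog n) :=
    Real.one_le_rpow (by norm_num) (Real.sqrt_nonneg _)
  have hA := H_stencilAlg_le hn hp hp1 hpn hC hσ0 hσ
  set K := 34 * ((OctTet.msgBound : ℝ) + C) * 8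
  set X := (8 : ℝ) ^ Real.sqrt (rlog n)
  have hX0 : 0 < X := zero_lt_one.trans_le hX
  have hc : 0 < min 1 (c₀ / K) := lt_min one_pos (div_pos hc₀ hK)
  refine ⟨⟨div_pos hc hX0, (div_le_one hX0).2 ((min_le_left _ _).trans hX)⟩,
    stencilAlg_inClass hn hε, fun B hB => hA.trans ?_⟩
  have hcK : min 1 (c₀ / K) * K ≤ c₀ := (le_div_iff₀ hK).1 (min_le_right _ _)
  have hy : 0 ≤ (n : ℝ) ^ 2 / Real.sqrt p := by positivity
  rw [one_div_div, div_mul_eq_mul_div X, le_div_iff₀ hc]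
  calc K * ((n : ℝ) ^ 2 / Real.sqrt p * X) * min 1 (c₀ / K)
      = X * (min 1 (c₀ / K) * K * ((n : ℝ) ^ 2 / Real.sqrt p)) := by ring
    _ ≤ X * (c₀ * ((n : ℝ) ^ 2 / Real.sqrt p)) := by gcongr
    _ ≤ X * B.H p σ := by gcongr; exact hlb B hB

end NetObl

theorem mainTheorem10 :
    -- for every power of two `n`, the algorithm evaluates the `(n,2)`-stencil DAG on `M(n²)`
    (∀ n : ℕ, NetObl.IsPowTwo n →
      (NetObl.stencilAlg n).Evaluates (NetObl.stencilNodes n) NetObl.Arc) ∧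
    -- communication complexity
    (∀ C : ℝ, 0 ≤ C → ∃ K : ℝ, 0 < K ∧
      ∀ n p : ℕ, NetObl.IsPowTwo n → NetObl.IsPowTwo p → 1 < p → p ≤ n ^ 2 →
        ∀ σ : ℝ, 0 ≤ σ → σ ≤ C * ((n : ℝ) ^ 2 / p) →
          (NetObl.stencilAlg n).H p σ ≤
            K * ((n : ℝ) ^ 2 / Real.sqrt p * (8 : ℝ) ^ Real.sqrt (NetObl.rlog n))) ∧
    -- wiseness
    (∃ α : ℝ, 0 < α ∧ α ≤ 1 ∧
      ∀ n : ℕ, NetObl.IsPowTwo n → 1 < n → (NetObl.stencilAlg n).IsWise α (n ^ 2)) ∧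
    -- optimality
    (∃ ε₀ : ℝ, 0 < ε₀ ∧ ε₀ < 1 ∧ ∀ ε : ℝ, ε₀ ≤ ε → ε < 1 →
      ∀ C : ℝ, 0 ≤ C → ∃ c : ℝ, 0 < c ∧
        ∀ n p : ℕ, NetObl.IsPowTwo n → NetObl.IsPowTwo p → 1 < p → p ≤ n ^ 2 →
          ∀ σ : ℝ, 0 ≤ σ → σ ≤ C * ((n : ℝ) ^ 2 / p) →
            NetObl.IsOptimalOn (c / (8 : ℝ) ^ Real.sqrt (NetObl.rlog n)) ε n p σ
              (NetObl.stencilAlg n)) := by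
  have hM : (1 : ℝ) ≤ NetObl.OctTet.msgBound := by norm_num [NetObl.OctTet.msgBound]
  have hM0 : (0 : ℝ) < NetObl.OctTet.msgBound := zero_lt_one.trans_le hM
  refine ⟨fun n hn => NetObl.stencilAlg_evaluates hn, fun C hC => ?_, ?_, ?_⟩
  · exact ⟨34 * (NetObl.OctTet.msgBound + C) * 8, by positivity,
      fun n p hn hp hp1 hpn σ hσ0 hσ => NetObl.H_stencilAlg_le hn hp hp1 hpn hC hσ0 hσ⟩
  · exact ⟨1 / NetObl.OctTet.msgBound, one_div_pos.2 hM0, (div_le_one hM0).2 hM,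
      fun n hn hn1 => NetObl.stencilAlg_isWise hn hn1⟩
  · refine ⟨4095 / 4096, by norm_num, by norm_num, fun ε hε hε1 C hC => ?_⟩
    obtain ⟨c₀, hc₀, hlb⟩ := NetObl.exists_stencil_lower_bound hε1
    exact ⟨min 1 (c₀ / (34 * (NetObl.OctTet.msgBound + C) * 8)),
      lt_min one_pos (div_pos hc₀ (by positivity)), fun n p hn hp hp1 hpn σ hσ0 hσ =>
        NetObl.stencilAlg_isOptimalOn hε hC hc₀ hn hp hp1 hpn hσ0 hσ (hlb n p hn hp hp1 hpn σ hσ0)⟩
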